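/- \textbf{Setting.} Let $X$ be a smooth ($C^\infty$, Hausdorff, second countable, boundaryless) manifold of dimension $d$ and let $\mathrm{Leb}$ be a Lebesgue measure on $X$, i.e. a Borel measure with a continuous positive density in every chart (for example the Riemannian volume of a Riemannian metric). Let $X_0\subset X$ be open with compact closure $\overline{X_0}$, and let $T:X_0\to X_0$ be measurable and nonsingular: $\mathrm{Leb}(A)=0$ implies $\mathrm{Leb}(T^{-1}A)=0$. Its transfer operator $\mathcal L$ is defined by $\int_{X_0}\mathcal Lu\cdot v\,d\mathrm{Leb}=\int_{X_0}u\cdot v\circ T\,d\mathrm{Leb}$ for all bounded measurable $v$. For $\alpha>0$, a function $f:X\to\mathbb R$ is $C^\alpha$ if, in charts, it is $C^{[\alpha]}$ and its derivatives of order $[\alpha]$ are locally $(\alpha-[\alpha])$-Hölder, $[\alpha]$ being the integer part of $\alpha$; $\|f\|_{C^\alpha}$ is computed in an arbitrary fixed finite family of charts and compact pieces of them whose interiors cover $\overline{X_0}$. The discontinuity set $\mathrm{Disc}\,T$ is the set of points of $\overline{X_0}$ that are not points of $X_0$ at which $T$ is continuous (so it contains $\partial X_0$). The essential spectral radius of a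 bounded operator is the spectral radius of its class modulo compact operators. A \emph{physical description} of $T$ consists of finitely many $T$-invariant ergodic probability measures $\mu_1,\dots,\mu_l$ on $X_0$ and disjoint measurable sets $A_1,\dots,A_l\subset X_0$ such that $\mu_i(A_i)=1$, $\mathrm{Leb}(A_i)>0$, $\mathrm{Leb}(X_0\setminus\bigcup_i A_i)=0$ and, for every $x\in A_i$ and every bounded continuous $f:X_0\to\mathbb R$, $\frac1n\sum_{j=0}^{n-1}f(T^jx)\to\int f\,d\mu_i$. Moreover, for every $i$ there are an integer $k_i\ge1$ and a decomposition $\mu_i=\mu_{i,1}+\dots+\mu_{i,k_i}$ into positive measures such that $T_*\mu_{i,j}=\mu_{i,j+1}$ for $j\in\mathbb Z/k_i\mathbb Z$ and the measures $k_i\mu_{i,j}$ are probability measures that are invariant and mixing for $T^{k_i}$. \textbf{Theorem E.4.} Let $H_0$ be a (complex) vector subspace of $L^\infty(X_0,\mathrm{Leb})$ endowed with a possibly non-complete norm $\|\cdot\|$. Assume: \begin{enumerate} \item There are $\alpha>0$ and $C>0$ such that $fu\in H_0$ and $\|fu\|\le C\|f\|_{C^\alpha}\|u\|$ for all $u\in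 H_0$ and all $C^\alpha$ functions $f:X\to\mathbb R$. \item There is $C>0$ such that $|\int u\,d\mathrm{Leb}|\le C\|u\|$ for all $u\in H_0$. \item $\mathcal L$ maps $H_0$ to itself and is bounded on $H_0$, its iterates on $H_0$ are uniformly bounded, and the essential spectral radius of its continuous extension to the completion $H$ of $H_0$ is $<1$. \item There are $f_0\in H_0$ with values in $[0,1]$ and $N_0>0$ such that $f_0=1$ on $T^{N_0}(X_0)$ (both almost everywhere). \item For any $u\in H$ which is a limit in $H$ of functions $u_n\in H_0$ with $u_n\ge 0$, and any finite positive Borel measure $\mu_u$ on $X$ such that $\langle u,g\,d\mathrm{Leb}\rangle=\int g\,d\mu_u$ for all $C^\alpha$ functions $g$, one has $\mu_u(\mathrm{Disc}\,T)=0$. Here $u\mapsto\langle u,g\,d\mathrm{Leb}\rangle$ is the continuous extension to $H$ of $u\mapsto\int gu\,d\mathrm{Leb}$ on $H_0$. \end{enumerate} Then $T$ admits a physical description. -/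

import Mathlib

open MeasureTheory Filter Topology Set
open scoped ENNReal NNReal Manifold ContDiff BoundedContinuousFunction

noncomputable section

/-- `Leb` is a Lebesgue (smooth) measure on the `d`-dimensional manifold `X`: in each chart of the
atlas it has a continuous positive density with respect to the Lebesgue measure of `ℝ^d`.
The Riemannian volume of any (continuous) Riemannian metric has this property. -/
def IsLebesgueMeasure (d : ℕ) {X : Type*} [TopologicalSpace X]
    [ChartedSpace (EuclideanSpace ℝ (Fin d)) X] [MeasurableSpace X] (Leb : Measure X) : Prop :=
  ∀ e ∈ atlas (EuclideanSpace ℝ (Fin d)) X, ∃ ρ : EuclideanSpace ℝ (Fin d) → ℝ≥0,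
    ContinuousOn ρ e.target ∧ (∀ y ∈ e.target, 0 < ρ y) ∧
      ∀ A : Set X, MeasurableSet A → A ⊆ e.source →
        Leb A = ∫⁻ y in e '' A, (ρ y : ℝ≥0∞) ∂volume

/-- The restriction of the measure `Leb` to the subset `X₀`, as a measure on the subtype. -/
def lebOn {X : Type*} [MeasurableSpace X] (Leb : Measure X) (X₀ : Set X) : Measure X₀ :=
  Leb.comap ((↑) : X₀ → X)

/-- `f : X → ℝ` is of class `C^α`, `α > 0`: in charts it is of class `C^[α]` and its derivative of
order `[α]` is (locally) Hölder continuous with exponent `α - [α]`. -/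
def IsHolder (d : ℕ) {X : Type*} [TopologicalSpace X]
    [ChartedSpace (EuclideanSpace ℝ (Fin d)) X] (α : ℝ) (f : X → ℝ) : Prop :=
  ∀ e ∈ atlas (EuclideanSpace ℝ (Fin d)) X,
    ContDiffOn ℝ (⌊α⌋₊ : ℕ) (f ∘ e.symm) e.target ∧
      ∀ K ⊆ e.target, IsCompact K → ∃ M : ℝ, ∀ x ∈ K, ∀ y ∈ K,
        ‖iteratedFDeriv ℝ ⌊α⌋₊ (f ∘ e.symm) x - iteratedFDeriv ℝ ⌊α⌋₊ (f ∘ e.symm) y‖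
          ≤ M * ‖x - y‖ ^ (α - ⌊α⌋₊)

/-- Finitely many charts of `X`, together with a compact subset of the image of each of them, such
that the interiors of these compact sets cover the closure of `X₀`. Such a family is used to define
a `C^α` norm. Only the values of the functions near the closure of `X₀` matter here, and for
functions supported in a given compact subset of the interiors, different families give equivalent
norms. -/
structure ChartCover (d : ℕ) {X : Type*} [TopologicalSpace X]
    [ChartedSpace (EuclideanSpace ℝ (Fin d)) X] (X₀ : Set X) where
  /-- number of charts -/
  num : ℕ
  /-- the charts -/
  chart : Fin num → OpenPartialHomeomorph X (EuclideanSpace ℝ (Fin d))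
  chart_mem : ∀ i, chart i ∈ atlas (EuclideanSpace ℝ (Fin d)) X
  /-- the compact pieces, in coordinates -/
  piece : Fin num → Set (EuclideanSpace ℝ (Fin d))
  isCompact_piece : ∀ i, IsCompact (piece i)
  piece_subset : ∀ i, piece i ⊆ (chart i).target
  cover : closure X₀ ⊆ ⋃ i, (chart i).symm '' interior (piece i)

/-- The `C^α` norm of `f`, computed in the charts of `𝒰`: the smallest `M ≥ 0` that bounds, on all
the compact pieces, the derivatives of `f` of order at most `[α]` and the Hölder constant, with
exponent `α - [α]`, of the derivative of order `[α]`. -/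
def ChartCover.holderNorm {d : ℕ} {X : Type*} [TopologicalSpace X]
    [ChartedSpace (EuclideanSpace ℝ (Fin d)) X] {X₀ : Set X} (𝒰 : ChartCover d X₀)
    (α : ℝ) (f : X → ℝ) : ℝ :=
  sInf {M : ℝ | 0 ≤ M ∧ ∀ i,
    (∀ j ≤ ⌊α⌋₊, ∀ x ∈ 𝒰.piece i, ‖iteratedFDeriv ℝ j (f ∘ (𝒰.chart i).symm) x‖ ≤ M) ∧
    ∀ x ∈ 𝒰.piece i, ∀ y ∈ 𝒰.piece i,
      ‖iteratedFDeriv ℝ ⌊α⌋₊ (f ∘ (𝒰.chart i).symm) x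
        - iteratedFDeriv ℝ ⌊α⌋₊ (f ∘ (𝒰.chart i).symm) y‖ ≤ M * ‖x - y‖ ^ (α - ⌊α⌋₊)}

/-- `w` is the image `𝓛 u` of `u ∈ L^∞(μ)` under the transfer operator of `T`:
`∫ w v dμ = ∫ u (v ∘ T) dμ` for every bounded measurable `v`. This determines `w`. -/
def IsTransfer {Y : Type*} [MeasurableSpace Y] (T : Y → Y) (μ : Measure Y)
    (u w : Lp ℂ (⊤ : ℝ≥0∞) μ) : Prop :=
  ∀ v : Y → ℂ, Measurable v → (∃ M : ℝ, ∀ x, ‖v x‖ ≤ M) →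
    ∫ x, w x * v x ∂μ = ∫ x, u x * v (T x) ∂μ

/-- The essential spectral radius of a bounded operator `L` on a complex Banach space `E`: the
spectral radius (by Gelfand's formula) of the class of `L` in the Calkin algebra of bounded
operators modulo compact operators, with its quotient norm. -/
def essentialSpectralRadius {E : Type*} [NormedAddCommGroup E] [NormedSpace ℂ E]
    (L : E →L[ℂ] E) : ℝ :=
  ⨅ n : ℕ, Metric.infDist (L ^ (n + 1))
    (compactOperator (RingHom.id ℂ) E E : Set (E →L[ℂ] E)) ^ (1 / ((n : ℝ) + 1))

/-- The pairing `⟨u, g dLeb⟩` for `u` in the completion of `H₀`: the continuous extension of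
`u ↦ ∫ g u dLeb` from `H₀` to its completion. The map `ι` is the inclusion of `H₀` in `L^∞`. -/
def pairing {X : Type*} [MeasurableSpace X] {X₀ : Set X} {μ : Measure X₀}
    {H₀ : Type*} [NormedAddCommGroup H₀] [NormedSpace ℂ H₀]
    (ι : H₀ →ₗ[ℂ] Lp ℂ (⊤ : ℝ≥0∞) μ) (g : X → ℝ) : UniformSpace.Completion H₀ → ℂ :=
  UniformSpace.Completion.extension fun u : H₀ => ∫ x : X₀, (g x : ℂ) * ι u x ∂μ

/-- The discontinuity set of a map `T` defined on `X₀`: the points of the closure of `X₀` which are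
not points of `X₀` at which `T` is continuous. -/
def discontinuitySet {X : Type*} [TopologicalSpace X] {X₀ : Set X} (T : X₀ → X₀) : Set X :=
  closure X₀ \ {x | ∃ h : x ∈ X₀, ContinuousAt T ⟨x, h⟩}

/-- The map `S` preserves `ν` and is mixing for `ν`. -/
def IsMixing {Y : Type*} [MeasurableSpace Y] (S : Y → Y) (ν : Measure Y) : Prop :=
  MeasurePreserving S ν ν ∧
    ∀ A B : Set Y, MeasurableSet A → MeasurableSet B →
      Tendsto (fun n : ℕ => ν (A ∩ S^[n] ⁻¹' B)) atTop (𝓝 (ν A * ν B))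

/-- `T` admits a physical description (with respect to the reference measure `m`). -/
def HasPhysicalDescription {Y : Type*} [TopologicalSpace Y] [MeasurableSpace Y]
    (T : Y → Y) (m : Measure Y) : Prop :=
  ∃ (l : ℕ) (μ : Fin l → Measure Y) (A : Fin l → Set Y),
    (∀ i, IsProbabilityMeasure (μ i)) ∧
    (∀ i, MeasurePreserving T (μ i) (μ i)) ∧
    (∀ i, Ergodic T (μ i)) ∧
    (∀ i, MeasurableSet (A i)) ∧
    (∀ i j, i ≠ j → Disjoint (A i) (A j)) ∧
    (∀ i, μ i (A i) = 1) ∧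
    (∀ i, 0 < m (A i)) ∧
    m (⋃ i, A i)ᶜ = 0 ∧
    (∀ i, ∀ x ∈ A i, ∀ f : Y →ᵇ ℝ,
      Tendsto (fun n : ℕ => (1 / (n : ℝ)) * ∑ j ∈ Finset.range n, f (T^[j] x)) atTop
        (𝓝 (∫ y, f y ∂(μ i)))) ∧
    ∀ i, ∃ k : ℕ, 0 < k ∧ ∃ ν : ZMod k → Measure Y,
      μ i = Measure.sum ν ∧
      (∀ j, (ν j).map T = ν (j + 1)) ∧
      ∀ j, IsProbabilityMeasure ((k : ℝ≥0∞) • ν j) ∧ IsMixing T^[k] ((k : ℝ≥0∞) • ν j)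

end

set_option linter.unusedSectionVars false

noncomputable section

/-! ### Power bounded operators with essential spectral radius below one -/

section Operators

variable {E : Type*} [NormedAddCommGroup E] [NormedSpace ℂ E]

/-! Modulo operators of small norm, a high power of `L` has the form `K * L ^ j * K` with `K`
compact. As the powers are bounded, they form a totally bounded set in operator norm. The closure of
the positive powers is then a compact semigroup and contains an idempotent `P`, the limit of some `L
^ n k`. It has finite rank, commutes with `L`, and `L ^ m * (1 - P)` decays exponentially
(`exists_isPeripheralProjection`).

Limits in `H` of nonnegative functions are represented by measures. By the last assumption these do
not charge the discontinuities, so by the continuous mapping theorem `L` acts on them as the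
push-forward by `T`. Everything afterwards takes place in the abstract setting of `TransferModel`.

The peripheral part is described through measures instead of eigenvectors. A measure `ν` is rigid if
its images under `T^[n k]` converge to `ν`; elements fixed by `P` give rigid measures. With respect
to a rigid reference measure `lam`, rigid densities form a lattice: the positive part of a
difference of rigid measures is rigid (`IsRigid.positive_part`), hence so are the restrictions of
`lam` to superlevel sets of rigid densities. Disjoint rigid sets produce independent vectors in the
range of `P` (`card_rigidFamily_le`), so `lam` splits into finitely many rigid atoms, and rigid
densities are constant on each atom. Then `T` permutes the normalized atoms `q i`
(`exists_isCyclicDecomposition`). If `K` is a common period, the contraction off `P` makes the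
images under `T^[K * m]` converge without passing to a subsequence, which shows that each `q i` is
mixing for `T^[K]`.

The same contraction gives exponential decorrelation of test functions with respect to the measure
of any positive element with absolutely continuous projection, invariant or not. A variance estimate
yields almost sure convergence of orbit averages, with an `L¹` rate that is uniform when the first
`m` iterates are dropped. The limiting averages can thus be read off after pushing the measure
forward to its projection by `P`, a combination of the `q i`, and almost every point lies in the
basin of some `q i` (`ae_exists_mem_basin`). The cutoff `f₀` and nonsingularity extend this to
Lebesgue almost every point. The physical measures are the means of the `q i` over the cycles of the
permutation. -/

theorem totallyBounded_image_comp_comp {K : E →L[ℂ] E} (hK : IsCompactOperator K) (C : ℝ) :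
    TotallyBounded ((fun B : E →L[ℂ] E => K * B * K) '' Metric.closedBall 0 C) := by
  obtain ⟨s, hs, hsK⟩ := hK.image_closedBall_subset_compact (𝕜₁ := ℂ) (f := (K : E →ₗ[ℂ] E)) 1
  obtain ⟨s', hs', hsK'⟩ := hK.image_closedBall_subset_compact (𝕜₁ := ℂ) (f := (K : E →ₗ[ℂ] E))
    (|C| * ‖K‖)
  -- `B` is encoded by a map between finite nets: each net point `y` of the image under `K` of the
  -- unit ball is sent to a net point near `K (B y)`. Operators with the same code satisfy `‖K * B *
  -- K - K * B' * K‖ ≤ (2 * ‖K‖ * |C| + 2) * δ`, which is `ε / 4` by the choice of `δ`.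
  refine Metric.totallyBounded_of_finite_discretization fun ε hε => ?_
  set δ : ℝ := ε / (4 * (2 * ‖K‖ * |C| + 2)) with hδ
  have hden : 0 < 2 * ‖K‖ * |C| + 2 := by positivity
  have hδ0 : 0 < δ := by positivity
  have tb : TotallyBounded (K '' Metric.closedBall (0 : E) 1) := hs.totallyBounded.subset hsK
  obtain ⟨t, ht, htf, htc⟩ := Metric.finite_approx_of_totallyBounded tb δ hδ0
  have tb' : TotallyBounded (K '' Metric.closedBall (0 : E) (|C| * ‖K‖)) :=
    hs'.totallyBounded.subset hsK'
  obtain ⟨t', ht', htf', htc'⟩ := Metric.finite_approx_of_totallyBounded tb' δ hδ0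
  have key : ∀ B ∈ Metric.closedBall (0 : E →L[ℂ] E) C, ∀ y ∈ t, ∃ z ∈ t', dist (K (B y)) z < δ := by
    intro B hB y hy
    obtain ⟨x, hx, rfl⟩ := ht hy
    have hB' : ‖B‖ ≤ |C| := (by simpa using hB : ‖B‖ ≤ C).trans (le_abs_self C)
    have : K (B (K x)) ∈ K '' Metric.closedBall (0 : E) (|C| * ‖K‖) := by
      refine ⟨B (K x), ?_, rfl⟩
      have hx' : ‖x‖ ≤ 1 := by simpa using hx
      rw [mem_closedBall_zero_iff]
      calc ‖B (K x)‖ ≤ ‖B‖ * ‖K x‖ := B.le_opNorm _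
        _ ≤ |C| * (‖K‖ * 1) := by
            gcongr
            exact (K.le_opNorm x).trans (by gcongr)
        _ = |C| * ‖K‖ := by ring
    have := htc' this
    simpa using this
  have : Finite t := htf
  have : Finite t' := htf'
  have := Fintype.ofFinite (t → t')
  choose! F hF1 hF2 using key
  have hmem : ∀ x : ((fun B : E →L[ℂ] E => K * B * K) '' Metric.closedBall 0 C),
      ∃ B ∈ Metric.closedBall (0 : E →L[ℂ] E) C, K * B * K = x := fun x => x.2
  choose G hG1 hG2 using hmem
  refine ⟨t → t', inferInstance, fun x y => ⟨F (G x) y, hF1 _ (hG1 x) _ y.2⟩, fun x y hxy => ?_⟩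
  have hxy' : ∀ z ∈ t, F (G x) z = F (G y) z := fun z hz => by
    have := congrFun hxy ⟨z, hz⟩
    simpa using this
  rw [← hG2 x, ← hG2 y, dist_eq_norm]
  refine lt_of_le_of_lt (ContinuousLinearMap.opNorm_le_of_unit_norm
    (C := ε / 2) (by positivity) fun v hv => ?_) (by linarith)
  have hv' : K v ∈ K '' Metric.closedBall (0 : E) 1 := ⟨v, by simp [hv], rfl⟩
  obtain ⟨z, hz, hvz⟩ : ∃ z ∈ t, dist (K v) z < δ := by simpa using htc hv'
  have b : ∀ B ∈ Metric.closedBall (0 : E →L[ℂ] E) C, ‖K (B (K v)) - K (B z)‖ ≤ ‖K‖ * |C| * δ := by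
    intro B hB
    have hB' : ‖B‖ ≤ |C| := (by simpa using hB : ‖B‖ ≤ C).trans (le_abs_self C)
    rw [← map_sub, ← map_sub]
    calc ‖K (B (K v - z))‖ ≤ ‖K‖ * (‖B‖ * ‖K v - z‖) :=
          (K.le_opNorm _).trans (by gcongr; exact B.le_opNorm _)
      _ ≤ ‖K‖ * (|C| * δ) := by gcongr; rw [← dist_eq_norm]; exact hvz.le
      _ = _ := by ring
  have h1 := b _ (hG1 x)
  have h2 := b _ (hG1 y)
  have h3 := (hF2 _ (hG1 x) z hz).le
  have h4 := (hF2 _ (hG1 y) z hz).le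
  rw [hxy' z hz] at h3
  have h5 : ‖K (G x z) - K (G y z)‖ ≤ 2 * δ := by
    rw [← dist_eq_norm]
    calc _ ≤ _ := dist_triangle_right _ _ (F (G y) z)
      _ ≤ _ := by linarith
  have e : (K * G x * K - K * G y * K) v = (K (G x (K v)) - K (G x z)) + (K (G x z) - K (G y z))
      - (K (G y (K v)) - K (G y z)) := by simp
  rw [e]
  have h6 : δ * (2 * ‖K‖ * |C| + 2) = ε / 4 := by rw [hδ]; field_simp
  calc _ ≤ ‖K (G x (K v)) - K (G x z)‖ + ‖K (G x z) - K (G y z)‖ + ‖K (G y (K v)) - K (G y z)‖ :=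
        (norm_sub_le _ _).trans (by gcongr; exact norm_add_le _ _)
    _ ≤ ‖K‖ * |C| * δ + 2 * δ + ‖K‖ * |C| * δ := by gcongr
    _ = δ * (2 * ‖K‖ * |C| + 2) := by ring
    _ ≤ ε / 2 := by rw [h6]; linarith

theorem exists_isCompactOperator_norm_sub_lt_one {L : E →L[ℂ] E}
    (h : essentialSpectralRadius L < 1) :
    ∃ N : ℕ, 0 < N ∧ ∃ K : E →L[ℂ] E, IsCompactOperator K ∧ ‖L ^ N - K‖ < 1 := by
  obtain ⟨n, hn⟩ := exists_lt_of_ciInf_lt h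
  have h1 : Metric.infDist (L ^ (n + 1)) (compactOperator (RingHom.id ℂ) E E : Set (E →L[ℂ] E)) < 1 := by
    by_contra hc
    push Not at hc
    exact absurd hn (not_lt.2 (Real.one_le_rpow hc (by positivity)))
  obtain ⟨K, hK, hd⟩ := (Metric.infDist_lt_iff ⟨0, Submodule.zero_mem _⟩).1 h1
  exact ⟨n + 1, by omega, K, hK, by rwa [← dist_eq_norm]⟩

/-- `A` and `A - K` have the same class modulo compact operators, hence so do their powers. This
lets a distance below one to the compact operators be raised to a power until it is as small as
desired. -/
theorem isCompactOperator_pow_sub_pow {A K : E →L[ℂ] E} (hK : IsCompactOperator K) (q : ℕ) :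
    IsCompactOperator (A ^ q - (A - K) ^ q : E →L[ℂ] E) := by
  induction q with
  | zero => simpa using isCompactOperator_zero
  | succ q ih =>
    have : A ^ (q + 1) - (A - K) ^ (q + 1) = A * (A ^ q - (A - K) ^ q) + K * (A - K) ^ q := by
      rw [pow_succ', pow_succ' (A - K)]; noncomm_ring
    rw [this]
    exact (ih.clm_comp A).add (hK.comp_clm ((A - K) ^ q))

theorem exists_isCompactOperator_norm_sub_lt {L : E →L[ℂ] E}
    (h : essentialSpectralRadius L < 1) {δ : ℝ} (hδ : 0 < δ) :
    ∃ N : ℕ, 0 < N ∧ ∃ K : E →L[ℂ] E, IsCompactOperator K ∧ ‖L ^ N - K‖ < δ := by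
  obtain ⟨N, hN, K, hK, hlt⟩ := exists_isCompactOperator_norm_sub_lt_one h
  obtain ⟨q, hq⟩ := exists_pow_lt_of_lt_one hδ hlt
  refine ⟨N * (q + 1), by positivity, _, isCompactOperator_pow_sub_pow (A := L ^ N) hK (q + 1), ?_⟩
  rw [pow_mul, sub_sub_cancel]
  refine (norm_pow_le' _ (by omega)).trans_lt (lt_of_le_of_lt ?_ hq)
  exact pow_le_pow_of_le_one (norm_nonneg _) hlt.le (by omega)

/-- Writing `L ^ (2 * N + j) = L ^ N * L ^ j * L ^ N` and replacing both outer factors by the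
compact `K` costs little, uniformly in `j`. The operators `K * L ^ j * K` form a totally bounded
set. -/
theorem totallyBounded_range_pow {L : E →L[ℂ] E} {C : ℝ} (hC : ∀ n, ‖L ^ n‖ ≤ C)
    (h : essentialSpectralRadius L < 1) : TotallyBounded (range fun n : ℕ => L ^ n) := by
  have hC0 : 0 ≤ C := (norm_nonneg _).trans (hC 0)
  rw [Metric.totallyBounded_iff]
  intro ε hε
  set δ : ℝ := min 1 (ε / (2 * (2 * (C + 1) * C + C + 1))) with hδ
  have hδ0 : 0 < δ := by positivity
  have hδ1 : δ ≤ 1 := min_le_left _ _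
  have hδ2 : δ * (2 * (C + 1) * C + C + 1) ≤ ε / 2 := by
    have : δ ≤ ε / (2 * (2 * (C + 1) * C + C + 1)) := min_le_right _ _
    rw [le_div_iff₀ (by positivity)] at this
    linarith
  obtain ⟨N, hN, K, hK, hlt⟩ := exists_isCompactOperator_norm_sub_lt h hδ0
  obtain ⟨t, htf, htc⟩ := Metric.totallyBounded_iff.1 (totallyBounded_image_comp_comp hK C) (ε / 2)
    (by positivity)
  refine ⟨t ∪ (fun n : ℕ => L ^ n) '' Iio (2 * N), htf.union ((finite_Iio _).image _), ?_⟩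
  rintro _ ⟨n, rfl⟩
  rw [biUnion_union]
  rcases lt_or_ge n (2 * N) with hn | hn
  · exact Or.inr (mem_biUnion (mem_image_of_mem _ hn) (Metric.mem_ball_self hε))
  · left
    obtain ⟨j, rfl⟩ := Nat.exists_eq_add_of_le hn
    have hmem : K * L ^ j * K ∈ ⋃ y ∈ t, Metric.ball y (ε / 2) :=
      htc ⟨L ^ j, by simpa using hC j, rfl⟩
    obtain ⟨y, hy, hyd⟩ := mem_iUnion₂.1 hmem
    refine mem_iUnion₂.2 ⟨y, hy, ?_⟩
    rw [Metric.mem_ball] at hyd ⊢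
    refine (dist_triangle _ (K * L ^ j * K) _).trans_lt ?_
    suffices dist (L ^ (2 * N + j)) (K * L ^ j * K) ≤ ε / 2 by linarith
    set R := L ^ N - K with hR
    have hK' : ‖K‖ ≤ C + 1 := by
      have : K = L ^ N - R := by rw [hR]; abel
      rw [this]
      exact (norm_sub_le _ _).trans (add_le_add (hC _) (hlt.le.trans hδ1))
    have e : L ^ (2 * N + j) = L ^ N * L ^ j * L ^ N := by
      rw [← pow_add, ← pow_add]; congr 1; omega
    have e2 : L ^ (2 * N + j) - K * L ^ j * K = K * L ^ j * R + R * L ^ j * K + R * L ^ j * R := by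
      rw [e, show L ^ N = K + R by rw [hR]; abel]
      noncomm_ring
    rw [dist_eq_norm, e2]
    have hj := hC j
    have m3 : ∀ a b c : E →L[ℂ] E, ‖a * b * c‖ ≤ ‖a‖ * ‖b‖ * ‖c‖ := fun a b c =>
      (norm_mul_le _ _).trans (by gcongr; exact norm_mul_le _ _)
    calc _ ≤ ‖K‖ * ‖L ^ j‖ * ‖R‖ + ‖R‖ * ‖L ^ j‖ * ‖K‖ + ‖R‖ * ‖L ^ j‖ * ‖R‖ :=
          (norm_add₃_le).trans (add_le_add_three (m3 _ _ _) (m3 _ _ _) (m3 _ _ _))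
      _ ≤ (C + 1) * C * δ + δ * C * (C + 1) + δ * C * 1 := by
          gcongr
          exact hlt.le.trans hδ1
      _ ≤ δ * (2 * (C + 1) * C + C + 1) := by nlinarith
      _ ≤ _ := hδ2

/-- `P` is the projection on the finite-dimensional peripheral part of the power bounded operator `L`
along which `L` contracts exponentially; it is a limit of powers of `L`. -/
structure IsPeripheralProjection (L P : E →L[ℂ] E) (n : ℕ → ℕ) (B C ρ : ℝ) : Prop where
  norm_pow_le : ∀ m, ‖L ^ m‖ ≤ B
  mul_self : P * P = P
  comm : P * L = L * P
  finiteDimensional : FiniteDimensional ℂ (LinearMap.range (P : E →ₗ[ℂ] E))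
  pos : ∀ k, 0 < n k
  tendsto : Tendsto (fun k => L ^ n k) atTop (𝓝 P)
  nonneg : 0 ≤ C
  rate_nonneg : 0 ≤ ρ
  rate_lt_one : ρ < 1
  norm_le : ∀ m, ‖L ^ m * (1 - P)‖ ≤ C * ρ ^ m

theorem exists_isPeripheralProjection [CompleteSpace E] {L : E →L[ℂ] E} {C : ℝ}
    (hC : ∀ n, ‖L ^ n‖ ≤ C) (h : essentialSpectralRadius L < 1) :
    ∃ (P : E →L[ℂ] E) (n : ℕ → ℕ) (C' ρ : ℝ), IsPeripheralProjection L P n C C' ρ := by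
  have hC0 : 0 ≤ C := (norm_nonneg _).trans (hC 0)
  -- Exponent zero is left out: the identity is always idempotent and would carry no information.
  set s : Set (E →L[ℂ] E) := (fun n : ℕ => L ^ n) '' Ioi 0 with hs
  have hcpt : IsCompact (closure s) :=
    (((totallyBounded_range_pow hC h).subset (image_subset_range _ _)).closure).isCompact_of_isClosed
      isClosed_closure
  have hmul : ∀ x ∈ s, ∀ y ∈ s, x * y ∈ s := by
    rintro _ ⟨a, ha, rfl⟩ _ ⟨b, hb, rfl⟩
    exact ⟨a + b, Nat.add_pos_left ha b, pow_add _ _ _⟩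
  -- Ellis–Numakura: a compact semigroup with continuous translations contains an idempotent.
  obtain ⟨P, hP, hPP⟩ := exists_idempotent_in_compact_subsemigroup
    (fun r : E →L[ℂ] E => continuous_mul_const r) (closure s) ⟨L ^ 1, subset_closure ⟨1, by simp, rfl⟩⟩ hcpt
    (fun x hx y hy => map_mem_closure₂ continuous_mul hx hy hmul)
  obtain ⟨x, hx, hxP⟩ := mem_closure_iff_seq_limit.1 hP
  choose n hn hnx using hx
  have hlim : Tendsto (fun k => L ^ n k) atTop (𝓝 P) := by simpa [hnx] using hxP
  have hcomm : P * L = L * P := by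
    refine tendsto_nhds_unique (hlim.mul_const L) ?_
    simpa only [← pow_succ, ← pow_succ'] using hlim.const_mul L
  have hPpow : ∀ N : ℕ, 0 < N → P ^ N = P := fun N hN => by
    have : IsIdempotentElem P := hPP
    exact this.pow_eq hN.ne'
  -- Since `P = P ^ N`, it is the limit of `(L ^ n k) ^ N = L ^ N * L ^ (N * j)` with `j = n k - 1`.
  -- This is close to the compact operator `K * L ^ (N * j)`, with an error uniform in `k`.
  have hcompact : IsCompactOperator P := by
    have : P ∈ closure {A : E →L[ℂ] E | IsCompactOperator A} := by
      refine Metric.mem_closure_iff.2 fun ε hε => ?_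
      obtain ⟨N, hN, K, hK, hlt⟩ := exists_isCompactOperator_norm_sub_lt h
        (δ := ε / (2 * (C + 1))) (by positivity)
      have h1 : Tendsto (fun k => (L ^ n k) ^ N) atTop (𝓝 P) := by
        simpa only [hPpow N hN] using hlim.pow N
      obtain ⟨k, hk⟩ := ((Metric.tendsto_nhds.1 h1) (ε / 2) (by positivity)).exists
      obtain ⟨j, hj⟩ := Nat.exists_eq_add_of_lt (hn k)
      refine ⟨K * L ^ (N * j), hK.comp_clm _, ?_⟩
      have e : (L ^ n k) ^ N - K * L ^ (N * j) = (L ^ N - K) * L ^ (N * j) := by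
        rw [sub_mul, ← pow_add, ← pow_mul, hj]; congr 2; ring
      have : ‖(L ^ n k) ^ N - K * L ^ (N * j)‖ ≤ ε / 2 := by
        rw [e]
        calc _ ≤ ‖L ^ N - K‖ * ‖L ^ (N * j)‖ := norm_mul_le _ _
          _ ≤ ε / (2 * (C + 1)) * (C + 1) := by
            gcongr
            exact (hC _).trans (by linarith)
          _ = ε / 2 := by field_simp
      calc dist P (K * L ^ (N * j)) ≤ _ := dist_triangle_left _ _ ((L ^ n k) ^ N)
        _ < ε / 2 + ε / 2 := add_lt_add_of_lt_of_le hk (by rwa [dist_eq_norm])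
        _ = ε := by ring
    exact (isClosed_setOfPred_isCompactOperator (σ₁₂ := RingHom.id ℂ)).closure_subset this
  have hfin : FiniteDimensional ℂ (LinearMap.range (P : E →ₗ[ℂ] E)) := by
    have hinv : ∀ v ∈ LinearMap.range (P : E →ₗ[ℂ] E), (P : E →ₗ[ℂ] E) v = v := by
      rintro _ ⟨v, rfl⟩
      exact congrArg (fun A : E →L[ℂ] E => A v) hPP
    have hcl : IsClosed (LinearMap.range (P : E →ₗ[ℂ] E) : Set E) := by
      have : (LinearMap.range (P : E →ₗ[ℂ] E) : Set E) = {v | P v = v} := by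
        ext v
        exact ⟨fun hv => hinv v hv, fun hv => ⟨v, hv⟩⟩
      rw [this]
      exact isClosed_eq P.continuous continuous_id
    have hr := IsCompactOperator.restrict (f := (P : E →ₗ[ℂ] E)) hcompact
      (V := LinearMap.range (P : E →ₗ[ℂ] E)) (fun v hv => by rw [hinv v hv]; exact hv) hcl
    refine FiniteDimensional.of_isCompactOperator_id (𝕜 := ℂ) ?_
    convert! hr using 1
    ext v
    exact (hinv v v.2).symm
  have hpowcomm : ∀ m : ℕ, Commute (L ^ m) (1 - P) := fun m =>
    ((Commute.one_right L).sub_right (Commute.symm hcomm)).pow_left m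
  have hidem : IsIdempotentElem (1 - P) := IsIdempotentElem.one_sub hPP
  -- `L ^ n k * (1 - P)` tends to `P * (1 - P) = 0`. Iterating a single power `M` of norm below `1 /
  -- 2` gives the rate `ρ = (1 / 2) ^ (1 / M)`; the incomplete last block of length below `M`
  -- accounts for the factor `2`.
  obtain ⟨k, hk⟩ : ∃ k, ‖L ^ n k * (1 - P)‖ < 1 / 2 := by
    have h1 : Tendsto (fun k => ‖L ^ n k * (1 - P)‖) atTop (𝓝 ‖P * (1 - P)‖) :=
      (hlim.mul_const _).norm
    rw [mul_sub, hPP, mul_one, sub_self, norm_zero] at h1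
    exact (h1.eventually_lt_const (by norm_num)).exists
  set M := n k
  have hM : 0 < M := hn k
  set ρ : ℝ := (1 / 2 : ℝ) ^ (1 / (M : ℝ)) with hρ
  have hρM : ρ ^ M = 1 / 2 := by
    rw [hρ, ← Real.rpow_natCast, ← Real.rpow_mul (by norm_num)]
    field_simp
    simp
  have hρ0 : 0 < ρ := by positivity
  have hρ1 : ρ < 1 := Real.rpow_lt_one (by norm_num) (by norm_num) (by positivity)
  refine ⟨P, n, C * (1 + ‖P‖ + 1) * 2, ρ, hC, hPP, hcomm, hfin, hn, hlim, by positivity, hρ0.le, hρ1, fun m => ?_⟩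
  have hb : ∀ r q : ℕ, ‖L ^ (r + M * q) * (1 - P)‖ ≤ C * (1 + ‖P‖ + 1) * (1 / 2) ^ q := by
    intro r q
    rcases Nat.eq_zero_or_pos q with rfl | hq
    · have : ‖(1 : E →L[ℂ] E) - P‖ ≤ 1 + ‖P‖ + 1 := by
        refine (norm_sub_le _ _).trans ?_
        have : ‖(1 : E →L[ℂ] E)‖ ≤ 1 := ContinuousLinearMap.norm_id_le
        linarith
      calc _ ≤ ‖L ^ (r + M * 0)‖ * ‖1 - P‖ := norm_mul_le _ _
        _ ≤ C * (1 + ‖P‖ + 1) := by gcongr; exact hC _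
        _ = _ := by simp
    · have e : L ^ (r + M * q) * (1 - P) = L ^ r * (L ^ M * (1 - P)) ^ q := by
        rw [(hpowcomm M).mul_pow, hidem.pow_eq hq.ne', pow_add, pow_mul, mul_assoc]
      rw [e]
      calc _ ≤ ‖L ^ r‖ * ‖(L ^ M * (1 - P)) ^ q‖ := norm_mul_le _ _
        _ ≤ C * (1 / 2) ^ q := by
          gcongr
          · exact hC _
          · exact (norm_pow_le' _ hq).trans (by gcongr)
        _ ≤ _ := by
          gcongr
          have := norm_nonneg P
          nlinarith
  have hm := hb (m % M) (m / M)
  rw [Nat.mod_add_div] at hm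
  refine hm.trans ?_
  have h2 : (1 / 2 : ℝ) ^ (m / M) ≤ 2 * ρ ^ m := by
    rw [← hρM, ← pow_mul]
    have h3 : ρ ^ (M * (m / M) + M) ≤ ρ ^ m := by
      refine pow_le_pow_of_le_one hρ0.le hρ1.le ?_
      have := Nat.mod_add_div m M
      have := Nat.mod_lt m hM
      omega
    rw [pow_add, hρM] at h3
    linarith
  calc _ ≤ C * (1 + ‖P‖ + 1) * (2 * ρ ^ m) := by gcongr
    _ = _ := by ring

end Operators

/-! ### Weak convergence tested on a class of functions -/

section TestFunctions

theorem integrable_of_measurable_of_mem_Icc {Y : Type*} [MeasurableSpace Y] {ν : Measure Y} [IsFiniteMeasure ν] {h : Y → ℝ}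
    (hm : Measurable h) (hI : ∀ y, h y ∈ Icc (0 : ℝ) 1) : Integrable h ν :=
  Integrable.of_bound hm.aestronglyMeasurable 1 (.of_forall fun y => by
    rw [Real.norm_eq_abs, abs_of_nonneg (hI y).1]; exact (hI y).2)

variable {Y : Type*} [TopologicalSpace Y] [MeasurableSpace Y]

/-- A class of continuous functions with values in `[0, 1]` that is rich enough to determine the
weak convergence of finite measures. -/
structure IsTestClass (S : Set (Y → ℝ)) : Prop where
  continuous : ∀ g ∈ S, Continuous g
  mem_Icc : ∀ g ∈ S, ∀ y, g y ∈ Icc (0 : ℝ) 1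
  one_mem : (fun _ => 1) ∈ S
  one_sub_mem : ∀ g ∈ S, (fun y => 1 - g y) ∈ S
  mul_mem : ∀ g ∈ S, ∀ h ∈ S, (fun y => g y * h y) ∈ S
  exists_below : ∀ ν : Measure Y, IsFiniteMeasure ν → ∀ G : Set Y, IsOpen G → ∀ ε > 0,
    ∃ g ∈ S, (∀ y ∉ G, g y = 0) ∧ ν.real G ≤ ∫ y, g y ∂ν + ε
  exists_countable : ∃ S' ⊆ S, S'.Countable ∧ ∀ g ∈ S, ∀ ε > 0, ∃ g' ∈ S', ∀ y, |g y - g' y| ≤ ε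

/-- Convergence of measures against the functions of the class `S`. -/
def WeakTendsto (S : Set (Y → ℝ)) (ν : ℕ → Measure Y) (ν₀ : Measure Y) : Prop :=
  ∀ g ∈ S, Tendsto (fun n => ∫ y, g y ∂ν n) atTop (𝓝 (∫ y, g y ∂ν₀))

variable {S : Set (Y → ℝ)}

section

variable (hS : IsTestClass S)
include hS

theorem WeakTendsto.tendsto_real_univ {ν : ℕ → Measure Y} {ν₀ : Measure Y}
    (h : WeakTendsto S ν ν₀) : Tendsto (fun n => (ν n).real univ) atTop (𝓝 (ν₀.real univ)) := by
  simpa using h _ hS.one_mem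

variable [OpensMeasurableSpace Y]

theorem IsTestClass.measurable {g : Y → ℝ} (hg : g ∈ S) : Measurable g := (hS.continuous g hg).measurable

theorem IsTestClass.integrable {g : Y → ℝ} (hg : g ∈ S) (ν : Measure Y) [IsFiniteMeasure ν] :
    Integrable g ν :=
  integrable_of_measurable_of_mem_Icc (hS.measurable hg) (hS.mem_Icc g hg)

theorem WeakTendsto.le_liminf_measure_open {ν : ℕ → Measure Y} {ν₀ : Measure Y}
    [∀ n, IsFiniteMeasure (ν n)] [IsFiniteMeasure ν₀] (h : WeakTendsto S ν ν₀) {G : Set Y}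
    (hG : IsOpen G) : ν₀ G ≤ atTop.liminf fun n => ν n G := by
  refine le_of_forall_lt fun c hc => ?_
  have hcf : c ≠ ⊤ := ne_top_of_lt hc
  obtain ⟨c', hcc', hc'⟩ := exists_between hc
  have hcf' : c' ≠ ⊤ := ne_top_of_lt hc'
  refine hcc'.trans_le ?_
  have hr : c'.toReal < ν₀.real G := (ENNReal.toReal_lt_toReal hcf' (measure_ne_top _ _)).2 hc'
  obtain ⟨g, hg, hg0, hgG⟩ := hS.exists_below ν₀ inferInstance G hG ((ν₀.real G - c'.toReal) / 2)
    (by linarith)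
  have h1 : ∀ᶠ n in atTop, c'.toReal < ∫ y, g y ∂ν n :=
    (h g hg).eventually_const_lt (by linarith)
  refine le_liminf_of_le (by isBoundedDefault) (h1.mono fun n hn => ?_)
  have h2 : ∫ y, g y ∂ν n ≤ (ν n).real G := by
    rw [← integral_indicator_one hG.measurableSet]
    refine integral_mono (hS.integrable hg _)
      ((integrable_const (1 : ℝ)).indicator hG.measurableSet) fun y => ?_
    by_cases hy : y ∈ G
    · simpa [hy] using (hS.mem_Icc g hg y).2
    · simp [hy, hg0 y hy]
  rw [← ENNReal.ofReal_toReal hcf']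
  exact (ENNReal.ofReal_le_ofReal (hn.le.trans h2)).trans ENNReal.ofReal_toReal_le

/-- By the layer cake formula it suffices to bound the measures of `{t < f}`. At a continuity point
of `f` this set agrees with its interior, to which the lower bound for open sets applies. The upper
bound follows later from `1 - f`. -/
theorem WeakTendsto.eventually_lt_integral {ν : ℕ → Measure Y} {ν₀ : Measure Y}
    [∀ n, IsFiniteMeasure (ν n)] [IsFiniteMeasure ν₀] (h : WeakTendsto S ν ν₀) {f : Y → ℝ}
    (hfm : Measurable f) (hf : ∀ y, f y ∈ Icc (0 : ℝ) 1) (hc : ∀ᵐ y ∂ν₀, ContinuousAt f y) {ε : ℝ}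
    (hε : 0 < ε) : ∀ᶠ n in atTop, ∫ y, f y ∂ν₀ - ε < ∫ y, f y ∂ν n := by
  have hn : ∀ (ν : Measure Y) [IsFiniteMeasure ν],
      ENNReal.ofReal (∫ y, f y ∂ν) = ∫⁻ y, ENNReal.ofReal (f y) ∂ν := fun ν _ =>
    ofReal_integral_eq_lintegral_ofReal (integrable_of_measurable_of_mem_Icc hfm hf)
      (.of_forall fun y => (hf y).1)
  have key : ∫⁻ y, ENNReal.ofReal (f y) ∂ν₀
      ≤ atTop.liminf fun n => ∫⁻ y, ENNReal.ofReal (f y) ∂ν n := by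
    simp_rw [lintegral_eq_lintegral_meas_lt _ (Eventually.of_forall fun y => (hf y).1)
      hfm.aemeasurable]
    refine (lintegral_mono fun t => ?_).trans (lintegral_liminf_le fun n =>
      Antitone.measurable fun s t hst => measure_mono fun y hy => lt_of_le_of_lt hst hy)
    calc ν₀ {a | t < f a} ≤ ν₀ (interior {a | t < f a}) := by
          refine measure_mono_ae ?_
          filter_upwards [hc] with y hy hty
          exact mem_interior_iff_mem_nhds.2 (hy.eventually (lt_mem_nhds hty))
      _ ≤ atTop.liminf fun n => ν n (interior {a | t < f a}) :=
          h.le_liminf_measure_open hS isOpen_interior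
      _ ≤ _ := liminf_le_liminf (.of_forall fun n => measure_mono interior_subset)
  by_cases hpos : ∫ y, f y ∂ν₀ - ε < 0
  · exact .of_forall fun n => hpos.trans_le (integral_nonneg fun y => (hf y).1)
  · push Not at hpos
    have h1 : ENNReal.ofReal (∫ y, f y ∂ν₀ - ε) < atTop.liminf
        fun n => ∫⁻ y, ENNReal.ofReal (f y) ∂ν n := by
      refine lt_of_lt_of_le ?_ key
      rw [← hn]
      exact ENNReal.ofReal_lt_ofReal_iff_of_nonneg hpos |>.2 (by linarith)
    filter_upwards [eventually_lt_of_lt_liminf h1] with n hn'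
    rw [← hn] at hn'
    exact (ENNReal.ofReal_lt_ofReal_iff_of_nonneg hpos).1 hn'

theorem WeakTendsto.tendsto_integral_of_mem_Icc {ν : ℕ → Measure Y} {ν₀ : Measure Y}
    [∀ n, IsFiniteMeasure (ν n)] [IsFiniteMeasure ν₀] (h : WeakTendsto S ν ν₀) {f : Y → ℝ}
    (hfm : Measurable f) (hf : ∀ y, f y ∈ Icc (0 : ℝ) 1) (hc : ∀ᵐ y ∂ν₀, ContinuousAt f y) :
    Tendsto (fun n => ∫ y, f y ∂ν n) atTop (𝓝 (∫ y, f y ∂ν₀)) := by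
  have hf' : ∀ y, 1 - f y ∈ Icc (0 : ℝ) 1 := fun y => ⟨by linarith [(hf y).2], by linarith [(hf y).1]⟩
  have hi : ∀ (ν : Measure Y) [IsFiniteMeasure ν], ∫ y, (1 - f y) ∂ν = ν.real univ - ∫ y, f y ∂ν :=
    fun ν _ => by
      rw [integral_sub (integrable_const _) (integrable_of_measurable_of_mem_Icc hfm hf)]; simp
  rw [Metric.tendsto_nhds]
  intro ε hε
  filter_upwards [h.eventually_lt_integral hS hfm hf hc hε,
    h.eventually_lt_integral hS (hfm.const_sub 1) hf' (hc.mono fun y hy => hy.const_sub 1)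
      (half_pos hε), (Metric.tendsto_nhds.1 (h.tendsto_real_univ hS)) (ε / 2) (half_pos hε)]
    with n h1 h2 h3
  rw [hi, hi] at h2
  rw [Real.dist_eq, abs_lt] at h3 ⊢
  constructor <;> linarith

theorem WeakTendsto.tendsto_integral {ν : ℕ → Measure Y} {ν₀ : Measure Y}
    [∀ n, IsFiniteMeasure (ν n)] [IsFiniteMeasure ν₀] (h : WeakTendsto S ν ν₀) {f : Y → ℝ}
    (hfm : Measurable f) {M : ℝ} (hf : ∀ y, |f y| ≤ M) (hc : ∀ᵐ y ∂ν₀, ContinuousAt f y) :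
    Tendsto (fun n => ∫ y, f y ∂ν n) atTop (𝓝 (∫ y, f y ∂ν₀)) := by
  set M' : ℝ := |M| + 1 with hM'
  have hM0 : 0 < M' := by positivity
  have hf2 : ∀ y, |f y| ≤ M' := fun y => (hf y).trans ((le_abs_self M).trans (by linarith))
  set F : Y → ℝ := fun y => (f y + M') / (2 * M') with hF
  have hFm : Measurable F := (hfm.add_const _).div_const _
  have hFI : ∀ y, F y ∈ Icc (0 : ℝ) 1 := fun y => by
    have := abs_le.1 (hf2 y)
    constructor
    · exact div_nonneg (by linarith) (by positivity)
    · rw [hF]; simp only; rw [div_le_one (by positivity)]; linarith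
  have e : f = fun y => 2 * M' * F y - M' := by
    ext y; rw [hF]; field_simp; ring
  have hi : ∀ (ν : Measure Y) [IsFiniteMeasure ν],
      ∫ y, f y ∂ν = 2 * M' * ∫ y, F y ∂ν - M' * ν.real univ := fun ν _ => by
    rw [e, integral_sub ((integrable_of_measurable_of_mem_Icc hFm hFI).const_mul _)
      (integrable_const _), integral_const_mul]
    simp [mul_comm]
  simp_rw [hi]
  refine ((h.tendsto_integral_of_mem_Icc hS hFm hFI (hc.mono fun y hy => ?_)).const_mul _).sub
    ((h.tendsto_real_univ hS).const_mul _)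
  exact (hy.add_const _).div_const _

theorem WeakTendsto.map {ν : ℕ → Measure Y} {ν₀ : Measure Y}
    [∀ n, IsFiniteMeasure (ν n)] [IsFiniteMeasure ν₀] (h : WeakTendsto S ν ν₀) {T : Y → Y}
    (hT : Measurable T) (hc : ∀ᵐ y ∂ν₀, ContinuousAt T y) :
    WeakTendsto S (fun n => (ν n).map T) (ν₀.map T) := by
  intro g hg
  have hi : ∀ ν : Measure Y, ∫ y, g y ∂(ν.map T) = ∫ y, g (T y) ∂ν := fun ν =>
    integral_map hT.aemeasurable (hS.measurable hg).aestronglyMeasurable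
  simp_rw [hi]
  exact h.tendsto_integral_of_mem_Icc hS ((hS.measurable hg).comp hT)
    (fun y => hS.mem_Icc g hg (T y)) (hc.mono fun y hy => (hS.continuous g hg).continuousAt.comp hy)

end

section

variable [TopologicalSpace.PseudoMetrizableSpace Y] [BorelSpace Y] (hS : IsTestClass S)
include hS

theorem IsTestClass.measure_le_of_forall_integral_le {ν ν' : Measure Y} [IsFiniteMeasure ν]
    [IsFiniteMeasure ν'] (h : ∀ g ∈ S, ∫ y, g y ∂ν ≤ ∫ y, g y ∂ν') : ν ≤ ν' := by
  have hopen : ∀ G, IsOpen G → ν G ≤ ν' G := by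
    intro G hG
    rw [← ENNReal.toReal_le_toReal (measure_ne_top _ _) (measure_ne_top _ _)]
    refine le_of_forall_pos_le_add fun ε hε => ?_
    obtain ⟨g, hg, hg0, hgG⟩ := hS.exists_below ν inferInstance G hG ε hε
    have h2 : ∫ y, g y ∂ν' ≤ ν'.real G := by
      rw [← integral_indicator_one hG.measurableSet]
      refine integral_mono (hS.integrable hg _)
        ((integrable_const (1 : ℝ)).indicator hG.measurableSet) fun y => ?_
      by_cases hy : y ∈ G
      · simpa [hy] using (hS.mem_Icc g hg y).2
      · simp [hy, hg0 y hy]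
    exact hgG.trans (add_le_add_left ((h g hg).trans h2) ε)
  refine Measure.le_iff.2 fun A _ => ?_
  rw [A.measure_eq_iInf_isOpen ν']
  exact le_iInf₂ fun U hAU => le_iInf fun hU => (measure_mono hAU).trans (hopen U hU)

theorem IsTestClass.measure_ext {ν ν' : Measure Y} [IsFiniteMeasure ν]
    [IsFiniteMeasure ν'] (h : ∀ g ∈ S, ∫ y, g y ∂ν = ∫ y, g y ∂ν') : ν = ν' :=
  le_antisymm (hS.measure_le_of_forall_integral_le fun g hg => (h g hg).le)
    (hS.measure_le_of_forall_integral_le fun g hg => (h g hg).ge)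

theorem WeakTendsto.unique {ν : ℕ → Measure Y} {ν₀ ν₁ : Measure Y} [IsFiniteMeasure ν₀]
    [IsFiniteMeasure ν₁] (h₀ : WeakTendsto S ν ν₀) (h₁ : WeakTendsto S ν ν₁) : ν₀ = ν₁ :=
  hS.measure_ext fun g hg => tendsto_nhds_unique (h₀ g hg) (h₁ g hg)

/-- Outer regularity gives an open `U ⊇ A` of nearly the same measure, and a test function supported
in `U` nearly exhausts it; both errors are halves of `ε`. -/
theorem IsTestClass.exists_approx (ν : Measure Y) [IsFiniteMeasure ν] {A : Set Y}
    (hA : MeasurableSet A) {ε : ℝ} (hε : 0 < ε) :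
    ∃ g ∈ S, ∫ y, |g y - A.indicator 1 y| ∂ν ≤ ε := by
  obtain ⟨U, hAU, hU, hlt⟩ := A.exists_isOpen_lt_add (measure_ne_top ν A)
    (ε := ENNReal.ofReal (ε / 2)) (by positivity)
  obtain ⟨g, hg, hg0, hgU⟩ := hS.exists_below ν inferInstance U hU (ε / 2) (by positivity)
  have hUA : ν.real U ≤ ν.real A + ε / 2 := by
    have := ENNReal.toReal_mono (by finiteness) hlt.le
    rwa [ENNReal.toReal_add (measure_ne_top _ _) (by finiteness), ENNReal.toReal_ofReal (by positivity)] at this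
  refine ⟨g, hg, ?_⟩
  have iU : Integrable (U.indicator (1 : Y → ℝ)) ν := (integrable_const (1 : ℝ)).indicator hU.measurableSet
  have iA : Integrable (A.indicator (1 : Y → ℝ)) ν := (integrable_const (1 : ℝ)).indicator hA
  have ig := hS.integrable hg ν
  have i1 : Integrable (fun y => U.indicator (1 : Y → ℝ) y - g y) ν := iU.sub ig
  have i2 : Integrable (fun y => U.indicator (1 : Y → ℝ) y - A.indicator (1 : Y → ℝ) y) ν := iU.sub iA
  calc ∫ y, |g y - A.indicator 1 y| ∂ν
      ≤ ∫ y, ((U.indicator (1 : Y → ℝ) y - g y) + (U.indicator (1 : Y → ℝ) y - A.indicator (1 : Y → ℝ) y)) ∂ν := by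
        refine integral_mono (ig.sub iA).abs (i1.add i2) fun y => ?_
        have h01 := hS.mem_Icc g hg y
        by_cases hy : y ∈ A
        · have hyU := hAU hy
          simp only [indicator_of_mem hy, indicator_of_mem hyU, Pi.one_apply]
          rw [abs_sub_comm, abs_of_nonneg (by linarith [h01.2])]; linarith
        · by_cases hyU : y ∈ U
          · simp only [indicator_of_notMem hy, indicator_of_mem hyU, Pi.one_apply]
            rw [sub_zero, abs_of_nonneg h01.1]; linarith [h01.2]
          · simp [hy, hyU, hg0 y hyU]
    _ = (ν.real U - ∫ y, g y ∂ν) + (ν.real U - ν.real A) := by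
        rw [integral_add i1 i2, integral_sub iU ig, integral_sub iU iA,
          integral_indicator_one hU.measurableSet, integral_indicator_one hA]
    _ ≤ ε := by linarith

end

end TestFunctions

/-! ### The lattice of rigid measures -/

section Rigid

variable {Y : Type*} [TopologicalSpace Y] [MeasurableSpace Y]

/-- The measure `ν` is rigid along the sequence `n` of times: its images under `T^[n k]` converge
to `ν`. -/
def IsRigid (S : Set (Y → ℝ)) (T : Y → Y) (n : ℕ → ℕ) (ν : Measure Y) : Prop :=
  WeakTendsto S (fun k => ν.map T^[n k]) ν

variable {S : Set (Y → ℝ)} {T : Y → Y} {n : ℕ → ℕ}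

/-- With equal masses, a lower bound for `1 - g` is an upper bound for `g`, so one-sided estimates
prove convergence. The rigidity proofs below exploit this. -/
theorem weakTendsto_of_eventually_lt [OpensMeasurableSpace Y] (hS : IsTestClass S) {ν : ℕ → Measure Y} {ν₀ : Measure Y}
    [∀ n, IsFiniteMeasure (ν n)] [IsFiniteMeasure ν₀] (hu : ∀ n, (ν n).real univ = ν₀.real univ)
    (h : ∀ g ∈ S, ∀ ε > 0, ∀ᶠ n in atTop, ∫ y, g y ∂ν₀ - ε ≤ ∫ y, g y ∂ν n) :
    WeakTendsto S ν ν₀ := by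
  intro g hg
  have hi : ∀ (ν : Measure Y) [IsFiniteMeasure ν], ∫ y, (1 - g y) ∂ν = ν.real univ - ∫ y, g y ∂ν :=
    fun ν _ => by rw [integral_sub (integrable_const _) (hS.integrable hg ν)]; simp
  rw [Metric.tendsto_nhds]
  intro ε hε
  filter_upwards [h g hg (ε / 2) (by positivity), h _ (hS.one_sub_mem g hg) (ε / 2) (by positivity)]
    with n h1 h2
  rw [hi, hi, hu] at h2
  rw [Real.dist_eq, abs_lt]
  constructor <;> linarith

theorem map_real_univ (hT : Measurable T) (ν : Measure Y) (m : ℕ) :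
    (ν.map T^[m]).real univ = ν.real univ := by
  rw [map_measureReal_apply (hT.iterate m) MeasurableSet.univ, preimage_univ]

theorem integral_indicator_sub_le {ν : Measure Y} [IsFiniteMeasure ν] {h χ : Y → ℝ}
    (hm : Measurable h) (hh : ∀ y, h y ∈ Icc (0 : ℝ) 1) (χm : Measurable χ)
    (hχ : ∀ y, χ y ∈ Icc (0 : ℝ) 1) {D : Set Y} (hD : MeasurableSet D) {ε : ℝ}
    (hε : ∫ y, |χ y - D.indicator 1 y| ∂ν ≤ ε) :
    |∫ y, h y * χ y ∂ν - ∫ y in D, h y ∂ν| ≤ ε := by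
  have i1 : Integrable (fun y => h y * χ y) ν :=
    integrable_of_measurable_of_mem_Icc (hm.mul χm) fun y =>
      ⟨mul_nonneg (hh y).1 (hχ y).1, mul_le_one₀ (hh y).2 (hχ y).1 (hχ y).2⟩
  have i2 : Integrable (D.indicator h) ν := (integrable_of_measurable_of_mem_Icc hm hh).indicator hD
  have i3 : Integrable (fun y => χ y - D.indicator (1 : Y → ℝ) y) ν :=
    (integrable_of_measurable_of_mem_Icc χm hχ).sub ((integrable_const (1 : ℝ)).indicator hD)
  rw [← integral_indicator hD, ← integral_sub i1 i2]
  refine (abs_integral_le_integral_abs).trans (le_trans ?_ hε)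
  refine integral_mono (i1.sub i2).abs i3.abs fun y => ?_
  have : h y * χ y - D.indicator h y = h y * (χ y - D.indicator (1 : Y → ℝ) y) := by
    by_cases hy : y ∈ D <;> simp [hy]; ring
  simp only [this, abs_mul, abs_of_nonneg (hh y).1]
  exact mul_le_of_le_one_left (abs_nonneg _) (hh y).2

section

variable [OpensMeasurableSpace Y] (hS : IsTestClass S) (hT : Measurable T)
include hS hT

theorem IsTestClass.integral_map_iterate {g : Y → ℝ} (hg : g ∈ S) (m : ℕ) (ν : Measure Y) :
    ∫ y, g y ∂(ν.map T^[m]) = ∫ y, g (T^[m] y) ∂ν :=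
  integral_map (hT.iterate m).aemeasurable (hS.measurable hg).aestronglyMeasurable

omit hS in
theorem IsRigid.smul {ν : Measure Y} (h : IsRigid S T n ν) (c : ℝ≥0) : IsRigid S T n (c • ν) := by
  intro g hg
  have := (h g hg).const_mul (c : ℝ)
  simp_rw [Measure.map_smul, integral_smul_nnreal_measure]
  simpa [NNReal.smul_def] using this

/-- The image of `κ` dominates the image of `κ' j`, which returns to `κ' j`; the discarded mass is
small. Rigidity thus passes to increasing limits. -/
theorem IsRigid.of_le {κ : Measure Y} [IsFiniteMeasure κ] {κ' : ℕ → Measure Y}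
    (hle : ∀ j, κ' j ≤ κ) (hr : ∀ j, IsRigid S T n (κ' j))
    (ht : Tendsto (fun j => (κ' j).real univ) atTop (𝓝 (κ.real univ))) : IsRigid S T n κ := by
  have hf : ∀ j, IsFiniteMeasure (κ' j) := fun j => isFiniteMeasure_of_le κ (hle j)
  refine weakTendsto_of_eventually_lt hS (fun k => map_real_univ hT κ _) fun g hg ε hε => ?_
  obtain ⟨j, hj⟩ := (ht.eventually_const_lt (show κ.real univ - ε / 2 < κ.real univ by linarith)).exists
  have hdiff : ∫ y, g y ∂κ ≤ ∫ y, g y ∂κ' j + ε / 2 := by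
    have hsub := Measure.sub_add_cancel_of_le (hle j)
    have hfs : IsFiniteMeasure (κ - κ' j) := isFiniteMeasure_of_le κ Measure.sub_le
    have h1 : ∫ y, g y ∂κ = ∫ y, g y ∂(κ - κ' j) + ∫ y, g y ∂κ' j := by
      rw [← integral_add_measure (hS.integrable hg _) (hS.integrable hg _), hsub]
    have h2 : ∫ y, g y ∂(κ - κ' j) ≤ (κ - κ' j).real univ := by
      calc _ ≤ ∫ _, (1 : ℝ) ∂(κ - κ' j) :=
            integral_mono (hS.integrable hg _) (integrable_const _) fun y => (hS.mem_Icc g hg y).2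
        _ = _ := by simp
    have h3 : κ.real univ = (κ - κ' j).real univ + (κ' j).real univ := by
      rw [← measureReal_add_apply, hsub]
    linarith
  filter_upwards [(hr j g hg).eventually_const_lt
    (show ∫ y, g y ∂κ' j - ε / 2 < ∫ y, g y ∂κ' j by linarith)] with k hk
  have h4 : ∫ y, g y ∂(κ' j).map T^[n k] ≤ ∫ y, g y ∂κ.map T^[n k] :=
    integral_mono_measure (Measure.map_mono (hle j) (hT.iterate _))
      (.of_forall fun y => (hS.mem_Icc g hg y).1) (hS.integrable hg _)
  linarith

end

section

variable [TopologicalSpace.PseudoMetrizableSpace Y] [BorelSpace Y] (hS : IsTestClass S)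
  (hT : Measurable T)
include hS hT

/-- The hypotheses say that `κ` is the positive part of `ν - ν'`, carried by `D`. Pushing forward `κ
≥ ν - ν'` and testing against `g * χ`, with `χ` close to the indicator of `D`, gives in the limit at
least about `∫ g ∂ν - ∫ g ∂ν'` over `D`, which is `∫ g ∂κ`. This lower bound is enough. -/
theorem IsRigid.positive_part {ν ν' κ : Measure Y} [IsFiniteMeasure ν] [IsFiniteMeasure ν']
    [IsFiniteMeasure κ] (h : IsRigid S T n ν) (h' : IsRigid S T n ν') {D : Set Y}
    (hD : MeasurableSet D) (hle : ν ≤ κ + ν') (heq : κ + ν'.restrict D = ν.restrict D) :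
    IsRigid S T n κ := by
  refine weakTendsto_of_eventually_lt hS (fun k => map_real_univ hT κ _) fun g hg ε hε => ?_
  obtain ⟨χ, hχ, hχD⟩ := hS.exists_approx (ν + ν') hD (ε := ε / 4) (by positivity)
  have hi : Integrable (fun y => |χ y - D.indicator 1 y|) (ν + ν') :=
    ((hS.integrable hχ _).sub ((integrable_const (1 : ℝ)).indicator hD)).abs
  have hi1 := hi.left_of_add_measure
  have hi2 := hi.right_of_add_measure
  rw [integral_add_measure hi1 hi2] at hχD
  have e1 := abs_le.1 (integral_indicator_sub_le (hS.measurable hg) (hS.mem_Icc g hg) (hS.measurable hχ)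
    (hS.mem_Icc χ hχ) hD (show ∫ y, |χ y - D.indicator 1 y| ∂ν ≤ ε / 4 by
      linarith [(integral_nonneg fun y => abs_nonneg _ : 0 ≤ ∫ y, |χ y - D.indicator 1 y| ∂ν')]))
  have e2 := abs_le.1 (integral_indicator_sub_le (hS.measurable hg) (hS.mem_Icc g hg) (hS.measurable hχ)
    (hS.mem_Icc χ hχ) hD (show ∫ y, |χ y - D.indicator 1 y| ∂ν' ≤ ε / 4 by
      linarith [(integral_nonneg fun y => abs_nonneg _ : 0 ≤ ∫ y, |χ y - D.indicator 1 y| ∂ν)]))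
  have e3 : ∫ y, g y ∂κ + ∫ y in D, g y ∂ν' = ∫ y in D, g y ∂ν := by
    rw [← integral_add_measure (hS.integrable hg _) (hS.integrable hg _), heq]
  have hgχ := hS.mul_mem g hg χ hχ
  filter_upwards [(h _ hgχ).eventually_const_lt (sub_lt_self _ (by positivity : 0 < ε / 4)),
    (h' _ hgχ).eventually_lt_const (lt_add_of_pos_right _ (by positivity : 0 < ε / 4))] with k h1 h2
  have h3 : ∫ y, g y * χ y ∂ν.map T^[n k] ≤ ∫ y, g y * χ y ∂κ.map T^[n k]
      + ∫ y, g y * χ y ∂ν'.map T^[n k] := by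
    rw [← integral_add_measure (hS.integrable hgχ _) (hS.integrable hgχ _),
      ← Measure.map_add _ _ (hT.iterate _)]
    exact integral_mono_measure (Measure.map_mono hle (hT.iterate _))
      (.of_forall fun y => (hS.mem_Icc _ hgχ y).1) (hS.integrable hgχ _)
  have h4 : ∫ y, g y * χ y ∂κ.map T^[n k] ≤ ∫ y, g y ∂κ.map T^[n k] :=
    integral_mono (hS.integrable hgχ _) (hS.integrable hg _) fun y =>
      mul_le_of_le_one_right (hS.mem_Icc g hg y).1 (hS.mem_Icc χ hχ y).2
  linarith [e1.1, e2.2]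

variable {lam : Measure Y} [IsFiniteMeasure lam]

theorem IsRigid.withDensity_tsub {φ ψ : Y → ℝ≥0} (hφ : Measurable φ) (hψ : Measurable ψ)
    (fφ : IsFiniteMeasure (lam.withDensity fun y => φ y))
    (fψ : IsFiniteMeasure (lam.withDensity fun y => ψ y))
    (h : IsRigid S T n (lam.withDensity fun y => φ y))
    (h' : IsRigid S T n (lam.withDensity fun y => ψ y)) :
    IsRigid S T n (lam.withDensity fun y => (φ y - ψ y : ℝ≥0)) := by
  have hD : MeasurableSet {y | ψ y < φ y} := measurableSet_lt hψ hφ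
  have hle : lam.withDensity (fun y => ((φ y - ψ y : ℝ≥0) : ℝ≥0∞)) ≤ lam.withDensity fun y => φ y :=
    withDensity_mono (.of_forall fun y => by simp)
  have := isFiniteMeasure_of_le _ hle
  refine IsRigid.positive_part hS hT h h' hD ?_ ?_
  · rw [← withDensity_add_right _ (by fun_prop)]
    refine withDensity_mono (.of_forall fun y => ?_)
    simp only [Pi.add_apply, ← ENNReal.coe_add]
    exact_mod_cast le_tsub_add
  · rw [restrict_withDensity hD, restrict_withDensity hD, ← withDensity_indicator hD,
      ← withDensity_indicator hD, ← withDensity_add_right _ ((by fun_prop : Measurable fun y => (ψ y : ℝ≥0∞)).indicator hD)]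
    congr 1
    ext y
    by_cases hy : y ∈ {y | ψ y < φ y}
    · simp only [Pi.add_apply, indicator_of_mem hy, ← ENNReal.coe_add]
      rw [tsub_add_cancel_of_le (le_of_lt hy)]
    · simp only [Pi.add_apply, indicator_of_notMem hy, add_zero]
      simp only [mem_ofPred_eq, not_lt] at hy
      simp [tsub_eq_zero_of_le hy]

theorem IsRigid.withDensity_min {φ ψ : Y → ℝ≥0} (hφ : Measurable φ) (hψ : Measurable ψ)
    (fφ : IsFiniteMeasure (lam.withDensity fun y => φ y))
    (fψ : IsFiniteMeasure (lam.withDensity fun y => ψ y))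
    (h : IsRigid S T n (lam.withDensity fun y => φ y))
    (h' : IsRigid S T n (lam.withDensity fun y => ψ y)) :
    IsRigid S T n (lam.withDensity fun y => (min (φ y) (ψ y) : ℝ≥0)) := by
  have hle : lam.withDensity (fun y => ((φ y - ψ y : ℝ≥0) : ℝ≥0∞)) ≤ lam.withDensity fun y => φ y :=
    withDensity_mono (.of_forall fun y => by simp)
  have := IsRigid.withDensity_tsub hS hT hφ (hφ.sub hψ) fφ (isFiniteMeasure_of_le _ hle) h
    (IsRigid.withDensity_tsub hS hT hφ hψ fφ fψ h h')
  simpa only [Pi.sub_apply, tsub_tsub_eq_min] using this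

omit hS in
theorem IsRigid.withDensity_const_mul {φ : Y → ℝ≥0} (hφ : Measurable φ)
    (h : IsRigid S T n (lam.withDensity fun y => φ y)) (c : ℝ≥0) :
    IsRigid S T n (lam.withDensity fun y => (c * φ y : ℝ≥0)) := by
  have h1 := h.smul hT c
  have e : c • (lam.withDensity fun y => (φ y : ℝ≥0∞)) = lam.withDensity fun y => ((c * φ y : ℝ≥0) : ℝ≥0∞) := by
    have : c • (lam.withDensity fun y => (φ y : ℝ≥0∞)) = (c : ℝ≥0∞) • lam.withDensity fun y => (φ y : ℝ≥0∞) := rfl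
    rw [this, ← withDensity_smul _ (by fun_prop)]
    congr 1
  rwa [e] at h1

omit hS hT in
theorem isFiniteMeasure_withDensity_of_le_const {φ : Y → ℝ≥0} {c : ℝ≥0} (h : ∀ y, φ y ≤ c) :
    IsFiniteMeasure (lam.withDensity fun y => φ y) := by
  refine isFiniteMeasure_withDensity (ne_top_of_le_ne_top ?_ (lintegral_mono
    (g := fun _ => (c : ℝ≥0∞)) fun y => ENNReal.coe_le_coe.2 (h y)))
  rw [lintegral_const]
  finiteness

theorem IsRigid.withDensity_of_monotone {φ : Y → ℝ≥0} {ψ : ℕ → Y → ℝ≥0}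
    (fφ : IsFiniteMeasure (lam.withDensity fun y => φ y)) (hψ : ∀ j, Measurable (ψ j))
    (hmono : ∀ y, Monotone fun j => ψ j y) (hlim : ∀ y, ∀ᶠ j in atTop, ψ j y = φ y)
    (h : ∀ j, IsRigid S T n (lam.withDensity fun y => ψ j y)) :
    IsRigid S T n (lam.withDensity fun y => φ y) := by
  have ht : ∀ y, Tendsto (fun j => ψ j y) atTop (𝓝 (φ y)) := fun y =>
    tendsto_const_nhds.congr' ((hlim y).mono fun j hj => hj.symm)
  have hle : ∀ j y, ψ j y ≤ φ y := fun j y => (hmono y).ge_of_tendsto (ht y) j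
  refine IsRigid.of_le hS hT (κ' := fun j => lam.withDensity fun y => ψ j y)
    (fun j => withDensity_mono (.of_forall fun y => ENNReal.coe_le_coe.2 (hle j y))) h ?_
  refine (ENNReal.tendsto_toReal (measure_ne_top _ _)).comp ?_
  simp only [withDensity_apply _ MeasurableSet.univ, Measure.restrict_univ]
  exact lintegral_tendsto_of_tendsto_of_monotone (fun j => (hψ j).coe_nnreal_ennreal.aemeasurable)
    (.of_forall fun y i j hij => ENNReal.coe_le_coe.2 (hmono y hij))
    (.of_forall fun y => by exact_mod_cast ht y)

omit hS hT in
theorem exists_withDensity_nnreal {ν : Measure Y} [IsFiniteMeasure ν] (h : ν ≪ lam) :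
    ∃ φ : Y → ℝ≥0, Measurable φ ∧ ν = lam.withDensity fun y => φ y := by
  refine ⟨fun y => (ν.rnDeriv lam y).toNNReal, (Measure.measurable_rnDeriv ν lam).ennreal_toNNReal, ?_⟩
  conv_lhs => rw [← Measure.withDensity_rnDeriv_eq ν lam h]
  refine withDensity_congr_ae ?_
  filter_upwards [Measure.rnDeriv_lt_top ν lam] with y hy
  rw [ENNReal.coe_toNNReal hy.ne]

/-- The truncations `min 1 (j * (φ - t))` are rigid by the lattice operations and increase to the
indicator of `{t < φ}`. -/
theorem IsRigid.restrict_superlevel (hlam : IsRigid S T n lam) {φ : Y → ℝ≥0} (hφ : Measurable φ)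
    (fφ : IsFiniteMeasure (lam.withDensity fun y => φ y))
    (h : IsRigid S T n (lam.withDensity fun y => φ y)) (t : ℝ≥0) :
    IsRigid S T n (lam.restrict {y | t < φ y}) := by
  have hD : MeasurableSet {y | t < φ y} := measurableSet_lt measurable_const hφ
  have hc : ∀ c : ℝ≥0, IsRigid S T n (lam.withDensity fun _ => (c : ℝ≥0∞)) := fun c => by
    have := hlam.smul hT c
    rwa [show c • lam = (c : ℝ≥0∞) • lam from rfl, ← withDensity_const] at this
  have fc : ∀ c : ℝ≥0, IsFiniteMeasure (lam.withDensity fun _ => (c : ℝ≥0∞)) := fun c =>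
    isFiniteMeasure_withDensity_of_le_const (φ := fun _ => c) (fun _ => le_rfl)
  have key : ∀ j : ℕ, IsRigid S T n
      (lam.withDensity fun y => ((min 1 ((j : ℝ≥0) * (φ y - t)) : ℝ≥0) : ℝ≥0∞)) := fun j => by
    have h1 := IsRigid.withDensity_tsub hS hT hφ measurable_const fφ (fc t) h (hc t)
    have h2 := h1.withDensity_const_mul hT (hφ.sub_const t) (j : ℝ≥0)
    refine IsRigid.withDensity_min hS hT (φ := fun _ => 1) (ψ := fun y => (j : ℝ≥0) * (φ y - t))
      measurable_const ((hφ.sub_const t).const_mul _) (fc 1) ?_ (hc 1) h2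
    refine isFiniteMeasure_of_le ((j : ℝ≥0) • lam.withDensity fun y => (φ y : ℝ≥0∞)) ?_
    rw [show ∀ μ : Measure Y, (j : ℝ≥0) • μ = ((j : ℝ≥0) : ℝ≥0∞) • μ from fun _ => rfl,
      ← withDensity_smul _ (by fun_prop)]
    refine withDensity_mono (.of_forall fun y => ?_)
    simp only [Pi.smul_apply, smul_eq_mul, ENNReal.coe_mul]
    gcongr
    exact tsub_le_self
  have e : lam.restrict {y | t < φ y}
      = lam.withDensity fun y => (({y | t < φ y}.indicator (1 : Y → ℝ≥0) y : ℝ≥0) : ℝ≥0∞) := by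
    rw [← withDensity_indicator_one hD]
    congr 1
    ext y
    by_cases hy : y ∈ {y | t < φ y} <;> simp [hy]
  rw [e]
  refine IsRigid.withDensity_of_monotone hS hT (by rw [← e]; infer_instance)
    (ψ := fun (j : ℕ) y => min 1 ((j : ℝ≥0) * (φ y - t))) (fun j => by fun_prop) ?_ ?_ key
  · intro y i j hij
    dsimp only
    gcongr
  · intro y
    by_cases hy : t < φ y
    · have hpos : 0 < φ y - t := tsub_pos_of_lt hy
      obtain ⟨j, hj⟩ := exists_nat_ge (1 / (φ y - t))
      filter_upwards [eventually_ge_atTop j] with i hi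
      have : 1 ≤ (i : ℝ≥0) * (φ y - t) := by
        rw [← div_le_iff₀ hpos]
        exact hj.trans (by exact_mod_cast hi)
      simp [hy, this]
    · simp [hy, tsub_eq_zero_of_le (not_lt.1 hy)]

/-- If `ν` has density `φ`, then `min φ (j * 1_A)` is a rigid density and increases to the density
of the restriction of `ν` to `A`. -/
theorem IsRigid.restrict {ν : Measure Y} [IsFiniteMeasure ν] (hν : IsRigid S T n ν) (hac : ν ≪ lam)
    {A : Set Y} (hA : MeasurableSet A) (h : IsRigid S T n (lam.restrict A)) :
    IsRigid S T n (ν.restrict A) := by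
  obtain ⟨φ, hφ, rfl⟩ := exists_withDensity_nnreal hac
  have e : ∀ ψ : Y → ℝ≥0, (lam.withDensity fun y => (ψ y : ℝ≥0∞)).restrict A
      = lam.withDensity fun y => ((A.indicator ψ y : ℝ≥0) : ℝ≥0∞) := fun ψ => by
    rw [restrict_withDensity hA, ← withDensity_indicator hA]
    congr 1
    ext y
    by_cases hy : y ∈ A <;> simp [hy]
  have e1 : lam.restrict A = lam.withDensity fun y => ((A.indicator (1 : Y → ℝ≥0) y : ℝ≥0) : ℝ≥0∞) := by
    rw [← withDensity_indicator_one hA]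
    congr 1
    ext y
    by_cases hy : y ∈ A <;> simp [hy]
  rw [e1] at h
  rw [e]
  have m1 : Measurable (A.indicator (1 : Y → ℝ≥0)) := measurable_one.indicator hA
  refine IsRigid.withDensity_of_monotone hS hT (by rw [← e]; infer_instance)
    (ψ := fun (j : ℕ) y => min (φ y) ((j : ℝ≥0) * A.indicator (1 : Y → ℝ≥0) y))
    (fun j => hφ.min (m1.const_mul _)) ?_ ?_ fun j => ?_
  · intro y i j hij
    dsimp only
    gcongr
  · intro y
    by_cases hy : y ∈ A
    · obtain ⟨j, hj⟩ := exists_nat_ge (φ y)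
      filter_upwards [eventually_ge_atTop j] with i hi
      simp [hy, hj.trans (by exact_mod_cast hi : (j : ℝ≥0) ≤ i)]
    · simp [hy]
  · refine IsRigid.withDensity_min hS hT hφ (m1.const_mul _) inferInstance ?_ hν
      (h.withDensity_const_mul hT m1 j)
    refine isFiniteMeasure_withDensity_of_le_const (c := j) fun y => ?_
    by_cases hy : y ∈ A <;> simp [hy]

theorem IsRigid.restrict_compl (hlam : IsRigid S T n lam) {A : Set Y} (hA : MeasurableSet A)
    (h : IsRigid S T n (lam.restrict A)) : IsRigid S T n (lam.restrict Aᶜ) := by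
  refine IsRigid.positive_part hS hT hlam h hA.compl ?_ ?_
  · rw [add_comm, Measure.restrict_add_restrict_compl hA]
  · rw [Measure.restrict_restrict hA.compl]; simp

theorem IsRigid.map {ν : Measure Y} [IsFiniteMeasure ν] (h : IsRigid S T n ν)
    (hc : ∀ᵐ y ∂ν, ContinuousAt T y) : IsRigid S T n (ν.map T) := by
  have h1 : ∀ k, (ν.map T).map T^[n k] = (ν.map T^[n k]).map T := fun k => by
    rw [Measure.map_map (hT.iterate _) hT, Measure.map_map hT (hT.iterate _),
      ← Function.iterate_succ, ← Function.iterate_succ']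
  intro g hg
  simp_rw [h1]
  exact WeakTendsto.map hS h hT hc g hg

/-- Take `χ` close to the indicator of `A` for `lam.map T` and test `lam` against `g * (χ ∘ T)`. The
part of `lam` outside `T ⁻¹' A` hardly contributes: its image under `T` is the restriction of
`lam.map T` to `Aᶜ`, which is rigid and so returns to where `χ` is small. The part inside `T ⁻¹' A`
therefore keeps its integral, up to `ε`. -/
theorem IsRigid.restrict_preimage (hlam : IsRigid S T n lam)
    (hc : ∀ᵐ y ∂lam, ContinuousAt T y) (hac : lam.map T ≪ lam) {A : Set Y} (hA : MeasurableSet A)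
    (h : IsRigid S T n (lam.restrict A)) : IsRigid S T n (lam.restrict (T ⁻¹' A)) := by
  have hB : MeasurableSet (T ⁻¹' A) := hT hA
  have hcompl : IsRigid S T n ((lam.map T).restrict Aᶜ) :=
    IsRigid.restrict hS hT (hlam.map hS hT hc) hac hA.compl (hlam.restrict_compl hS hT hA h)
  refine weakTendsto_of_eventually_lt hS (fun k => map_real_univ hT _ _) fun g hg ε hε => ?_
  obtain ⟨χ, hχ, hχA⟩ := hS.exists_approx (lam.map T) hA (ε := ε / 4) (by positivity)
  have hχm := hS.measurable hχ
  have hχA' : ∫ y, |χ (T y) - (T ⁻¹' A).indicator 1 y| ∂lam ≤ ε / 4 := by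
    have := integral_map (μ := lam) hT.aemeasurable (f := fun y => |χ y - A.indicator (1 : Y → ℝ) y|)
      ((hχm.sub (measurable_one.indicator hA)).abs).aestronglyMeasurable
    rw [this] at hχA
    exact hχA
  have hgm := hS.measurable hg
  have e1 := abs_le.1 (integral_indicator_sub_le hgm (hS.mem_Icc g hg) (hχm.comp hT)
    (fun y => hS.mem_Icc χ hχ (T y)) hB hχA')
  simp only [Function.comp_apply] at e1
  have e2 : ∫ y, χ y ∂(lam.map T).restrict Aᶜ ≤ ε / 4 := by
    refine le_trans ?_ hχA
    rw [← integral_indicator hA.compl]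
    refine integral_mono ((hS.integrable hχ _).indicator hA.compl)
      ((hS.integrable hχ _).sub ((integrable_const (1 : ℝ)).indicator hA)).abs fun y => ?_
    by_cases hy : y ∈ A
    · simp [hy]
    · simpa [hy] using le_abs_self (χ y)
  have hm : Measurable fun y => g y * χ (T y) := hgm.mul (hχm.comp hT)
  have hI : ∀ y, g y * χ (T y) ∈ Icc (0 : ℝ) 1 := fun y =>
    have h1 := hS.mem_Icc g hg y
    have h2 := hS.mem_Icc χ hχ (T y)
    ⟨mul_nonneg h1.1 h2.1, mul_le_one₀ h1.2 h2.1 h2.2⟩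
  have h1 : Tendsto (fun k => ∫ y, g y * χ (T y) ∂lam.map T^[n k]) atTop
      (𝓝 (∫ y, g y * χ (T y) ∂lam)) :=
    WeakTendsto.tendsto_integral_of_mem_Icc hS hlam hm hI (hc.mono fun y hy =>
      ((hS.continuous g hg).continuousAt).mul ((hS.continuous χ hχ).continuousAt.comp hy))
  filter_upwards [h1.eventually_const_lt (sub_lt_self _ (by positivity : 0 < ε / 4)),
    (hcompl χ hχ).eventually_lt_const (lt_add_of_pos_right _ (by positivity : 0 < ε / 4))] with k h2 h3
  have ii : ∀ (ν : Measure Y) [IsFiniteMeasure ν], Integrable (fun y => g y * χ (T y)) ν := fun ν _ =>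
    integrable_of_measurable_of_mem_Icc hm hI
  have h4 : ∫ y, g y * χ (T y) ∂lam.map T^[n k] = ∫ y, g y * χ (T y) ∂(lam.restrict (T ⁻¹' A)).map T^[n k]
      + ∫ y, g y * χ (T y) ∂(lam.restrict (T ⁻¹' A)ᶜ).map T^[n k] := by
    rw [← integral_add_measure (ii _) (ii _), ← Measure.map_add _ _ (hT.iterate _),
      Measure.restrict_add_restrict_compl hB]
  have h5 : ∫ y, g y * χ (T y) ∂(lam.restrict (T ⁻¹' A)).map T^[n k]
      ≤ ∫ y, g y ∂(lam.restrict (T ⁻¹' A)).map T^[n k] :=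
    integral_mono (ii _) (hS.integrable hg _) fun y =>
      mul_le_of_le_one_right (hS.mem_Icc g hg y).1 (hS.mem_Icc χ hχ (T y)).2
  have h6 : ∫ y, g y * χ (T y) ∂(lam.restrict (T ⁻¹' A)ᶜ).map T^[n k]
      ≤ ∫ y, χ y ∂((lam.map T).restrict Aᶜ).map T^[n k] := by
    have e : ((lam.map T).restrict Aᶜ).map T^[n k] = ((lam.restrict (T ⁻¹' A)ᶜ).map T^[n k]).map T := by
      rw [Measure.restrict_map hT hA.compl, Measure.map_map (hT.iterate _) hT,
        Measure.map_map hT (hT.iterate _), ← Function.iterate_succ, ← Function.iterate_succ',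
        preimage_compl]
    rw [e, integral_map hT.aemeasurable hχm.aestronglyMeasurable]
    exact integral_mono (ii _) (integrable_of_measurable_of_mem_Icc (hχm.comp hT)
      fun y => hS.mem_Icc χ hχ (T y)) fun y =>
        mul_le_of_le_one_left (hS.mem_Icc χ hχ (T y)).1 (hS.mem_Icc g hg y).2
  linarith [e1.1]

end

end Rigid

/-! ### Rigid atoms and their permutation by the map -/

section Atoms

variable {Y : Type*} [TopologicalSpace Y] [MeasurableSpace Y]
  [TopologicalSpace.PseudoMetrizableSpace Y] [BorelSpace Y]
  {S : Set (Y → ℝ)} {T : Y → Y} {n : ℕ → ℕ} {lam : Measure Y} [IsFiniteMeasure lam]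

/-- A family of pairwise disjoint sets of positive measure, to which the restrictions of `lam` are
rigid. -/
structure IsRigidFamily (S : Set (Y → ℝ)) (T : Y → Y) (n : ℕ → ℕ) (lam : Measure Y) {ι : Type*}
    (C : ι → Set Y) : Prop where
  measurableSet : ∀ i, MeasurableSet (C i)
  disjoint : Pairwise (Function.onFun Disjoint C)
  rigid : ∀ i, IsRigid S T n (lam.restrict (C i))
  ne_zero : ∀ i, lam (C i) ≠ 0

omit [IsFiniteMeasure lam] in
theorem IsRigidFamily.option {ι : Type*} {C : ι → Set Y} (h : IsRigidFamily S T n lam C) {A : Set Y}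
    (hA : MeasurableSet A) (hd : ∀ i, Disjoint A (C i)) (hr : IsRigid S T n (lam.restrict A))
    (h0 : lam A ≠ 0) : IsRigidFamily S T n lam (fun i : Option ι => i.elim A C) where
  measurableSet := by rintro (_ | i); exacts [hA, h.measurableSet i]
  disjoint := by
    rintro (_ | i) (_ | j) hij
    · exact absurd rfl hij
    · exact hd j
    · exact (hd i).symm
    · exact h.disjoint (fun e => hij (congrArg some e))
  rigid := by rintro (_ | i); exacts [hr, h.rigid i]
  ne_zero := by rintro (_ | i); exacts [h0, h.ne_zero i]

omit [IsFiniteMeasure lam] in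
theorem IsRigidFamily.comp_equiv {ι κ : Type*} {C : ι → Set Y} (h : IsRigidFamily S T n lam C)
    (e : κ ≃ ι) : IsRigidFamily S T n lam (C ∘ e) where
  measurableSet _ := h.measurableSet _
  disjoint _ _ hij := h.disjoint (e.injective.ne hij)
  rigid _ := h.rigid _
  ne_zero _ := h.ne_zero _

theorem IsRigid.restrict_inter (hS : IsTestClass S) (hT : Measurable T) {A B : Set Y}
    (hB : MeasurableSet B) (hrA : IsRigid S T n (lam.restrict A))
    (hrB : IsRigid S T n (lam.restrict B)) : IsRigid S T n (lam.restrict (A ∩ B)) := by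
  rw [inter_comm, ← Measure.restrict_restrict hB]
  exact IsRigid.restrict hS hT hrA Measure.restrict_le_self.absolutelyContinuous hB hrB

/-- Decomposition of `lam` into finitely many rigid atoms. -/
theorem exists_rigid_atoms (hS : IsTestClass S) (hT : Measurable T) (hlam : IsRigid S T n lam)
    {D : ℕ} (hD : ∀ (p : ℕ) (C : Fin p → Set Y), IsRigidFamily S T n lam C → p ≤ D) :
    ∃ (p : ℕ) (C : Fin p → Set Y), IsRigidFamily S T n lam C ∧ lam (⋃ i, C i)ᶜ = 0 ∧
      ∀ i, ∀ A, MeasurableSet A → IsRigid S T n (lam.restrict A) →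
        lam (C i ∩ A) = 0 ∨ lam (C i \ A) = 0 := by
  classical
  let P : ℕ → Prop := fun p => ∃ C : Fin p → Set Y, IsRigidFamily S T n lam C
  have hP0 : P 0 := ⟨fun i => i.elim0, ⟨fun i => i.elim0, fun i => i.elim0, fun i => i.elim0,
    fun i => i.elim0⟩⟩
  -- A rigid family of maximal cardinality works: a non-null rest could be added to it, and a set `C
  -- i` cut by a rigid `A` into two non-null pieces could be replaced by both pieces. Either would
  -- contradict maximality.
  set p := Nat.findGreatest P D with hp
  obtain ⟨C, hC⟩ : P p := Nat.findGreatest_spec (Nat.zero_le D) hP0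
  have hmax : ¬ P (p + 1) := fun h => by
    have h1 : p + 1 ≤ D := by obtain ⟨C', hC'⟩ := h; exact hD _ _ hC'
    have h2 := Nat.le_findGreatest h1 h
    omega
  have hopt : ∀ C' : Option (Fin p) → Set Y, ¬ IsRigidFamily S T n lam C' := fun C' h =>
    hmax ⟨_, h.comp_equiv (finSuccEquivLast (n := p))⟩
  refine ⟨p, C, hC, ?_, fun i A hA hr => ?_⟩
  · by_contra h0
    have hU : MeasurableSet (⋃ i, C i) := MeasurableSet.iUnion hC.measurableSet
    have hint : IsRigid S T n (lam.restrict (⋃ i, C i)ᶜ) := by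
      have : ∀ s : Finset (Fin p), IsRigid S T n (lam.restrict (⋃ i ∈ s, C i)ᶜ) := by
        intro s
        induction s using Finset.induction_on with
        | empty => simpa using hlam
        | insert i s his ih =>
          rw [Finset.set_biUnion_insert, compl_union]
          exact IsRigid.restrict_inter hS hT
            (s.measurableSet_biUnion fun i _ => hC.measurableSet i).compl
            (hlam.restrict_compl hS hT (hC.measurableSet i) (hC.rigid i)) ih
      simpa using this Finset.univ
    exact hopt _ (hC.option hU.compl
      (fun i => disjoint_compl_left.mono_right (subset_iUnion C i)) hint h0)
  · by_contra! hcon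
    have hcA := hlam.restrict_compl hS hT hA hr
    have h1 : IsRigidFamily S T n lam (Function.update C i (C i ∩ A)) := by
      refine ⟨fun j => ?_, fun j k hjk => ?_, fun j => ?_, fun j => ?_⟩
      · by_cases hj : j = i
        · subst hj; simpa using (hC.measurableSet j).inter hA
        · simpa [hj] using hC.measurableSet j
      · have hs : ∀ j, Function.update C i (C i ∩ A) j ⊆ C j := fun j => by
          by_cases hj : j = i
          · subst hj; simp
          · simp [hj]
        exact (hC.disjoint hjk).mono (hs j) (hs k)
      · by_cases hj : j = i
        · subst hj
          simpa using IsRigid.restrict_inter hS hT hA (hC.rigid j) hr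
        · simpa [hj] using hC.rigid j
      · by_cases hj : j = i
        · subst hj; simpa using hcon.1
        · simpa [hj] using hC.ne_zero j
    refine hopt _ (h1.option (A := C i \ A) ((hC.measurableSet i).diff hA) (fun j => ?_) ?_ hcon.2)
    · by_cases hj : j = i
      · subst hj
        simpa using (disjoint_sdiff_inter (s := C j) (t := A))
      · simpa [hj] using (hC.disjoint (Ne.symm hj)).mono_left sdiff_subset
    · rw [sdiff_eq]
      exact IsRigid.restrict_inter hS hT hA.compl (hC.rigid i) hcA

omit [TopologicalSpace Y] [TopologicalSpace.PseudoMetrizableSpace Y] [BorelSpace Y] in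
-- Each level `t` lies either above or below almost all values of `φ` on `C`; the constant is the
-- infimum of the levels that lie above.
theorem exists_ae_eq_const_of_superlevel {C : Set Y} (hC : MeasurableSet C) {φ : Y → ℝ≥0}
    (h : ∀ t : ℝ≥0, lam (C ∩ {y | t < φ y}) = 0 ∨ lam (C \ {y | t < φ y}) = 0) :
    ∃ c : ℝ≥0, ∀ᵐ y ∂lam.restrict C, φ y = c := by
  by_cases h0 : lam C = 0
  · exact ⟨0, by rw [Measure.restrict_eq_zero.2 h0]; simp⟩
  have hne : NeZero (lam.restrict C) := ⟨by simpa using h0⟩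
  have h' : ∀ t : ℝ≥0, (∀ᵐ y ∂lam.restrict C, φ y ≤ t) ∨ ∀ᵐ y ∂lam.restrict C, t < φ y := by
    intro t
    refine (h t).imp (fun h => ?_) fun h => ?_
    · rw [ae_restrict_iff' hC, ae_iff]
      refine measure_mono_null (fun y hy => ?_) h
      simpa using hy
    · rw [ae_restrict_iff' hC, ae_iff]
      refine measure_mono_null (fun y hy => ?_) h
      simpa using hy
  have hex : ∃ t : ℝ≥0, ∀ᵐ y ∂lam.restrict C, φ y ≤ t := by
    by_contra hcon
    have hall : ∀ᵐ y ∂lam.restrict C, ∀ j : ℕ, (j : ℝ≥0) < φ y :=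
      ae_all_iff.2 fun j => (h' j).resolve_left fun hc => hcon ⟨j, hc⟩
    obtain ⟨y, hy⟩ := hall.exists
    obtain ⟨j, hj⟩ := exists_nat_ge (φ y)
    exact absurd (hy j) (not_lt.2 hj)
  set s : Set ℝ≥0 := {t | ∀ᵐ y ∂lam.restrict C, φ y ≤ t} with hs
  refine ⟨sInf s, ?_⟩
  have hup : ∀ᵐ y ∂lam.restrict C, ∀ j : ℕ, φ y ≤ sInf s + 1 / ((j : ℝ≥0) + 1) := by
    refine ae_all_iff.2 fun j => ?_
    obtain ⟨t, ht, htl⟩ := exists_lt_of_csInf_lt hex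
      (lt_add_of_pos_right (sInf s) (show (0 : ℝ≥0) < 1 / ((j : ℝ≥0) + 1) by positivity))
    filter_upwards [ht] with y hy using hy.trans htl.le
  have hlow : ∀ᵐ y ∂lam.restrict C, ∀ j : ℕ, sInf s - 1 / ((j : ℝ≥0) + 1) ≤ φ y := by
    refine ae_all_iff.2 fun j => ?_
    by_cases hz : sInf s = 0
    · exact .of_forall fun y => by simp [hz]
    · have hlt : sInf s - 1 / ((j : ℝ≥0) + 1) < sInf s :=
        tsub_lt_self (pos_iff_ne_zero.2 hz) (by positivity)
      have := (h' (sInf s - 1 / ((j : ℝ≥0) + 1))).resolve_left fun hc =>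
        absurd (csInf_le (OrderBot.bddBelow s) hc) (not_le.2 hlt)
      filter_upwards [this] with y hy using hy.le
  filter_upwards [hup, hlow] with y h1 h2
  have hz : Tendsto (fun j : ℕ => 1 / ((j : ℝ≥0) + 1)) atTop (𝓝 0) := by
    rw [← NNReal.tendsto_coe]
    simpa using tendsto_one_div_add_atTop_nhds_zero_nat (𝕜 := ℝ)
  refine le_antisymm (ge_of_tendsto' (by simpa using hz.const_add (sInf s)) h1)
    (le_of_tendsto' (by simpa using (tendsto_const_nhds (x := sInf s)).sub hz) h2)

/-- A decomposition of `lam` into mutually singular parts, that are multiples of probability measures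
`q i`, that `T` permutes, and that span the rigid measures. -/
structure IsCyclicDecomposition (S : Set (Y → ℝ)) (T : Y → Y) (n : ℕ → ℕ) (lam : Measure Y) {p : ℕ}
    (C : Fin p → Set Y) (q : Fin p → Measure Y) (σ : Fin p → Fin p) (K : ℕ) : Prop where
  pos : 0 < K
  iterate_eq : σ^[K] = id
  measurableSet : ∀ i, MeasurableSet (C i)
  disjoint : Pairwise (Function.onFun Disjoint C)
  compl_eq_zero : lam (⋃ i, C i)ᶜ = 0
  isProbabilityMeasure : ∀ i, IsProbabilityMeasure (q i)
  apply_self : ∀ i, q i (C i) = 1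
  ne_zero : ∀ i, lam (C i) ≠ 0
  restrict_eq : ∀ i, lam.restrict (C i) = lam (C i) • q i
  map_eq : ∀ i, (q i).map T = q (σ i)
  exists_eq_sum : ∀ ν : Measure Y, IsFiniteMeasure ν → ν ≪ lam → IsRigid S T n ν →
    ∃ a : Fin p → ℝ≥0, ν = ∑ i, a i • q i

omit [TopologicalSpace Y] [TopologicalSpace.PseudoMetrizableSpace Y] [BorelSpace Y] in
theorem eq_sum_smul_of_ae_const {p : ℕ} {C : Fin p → Set Y} (hC : ∀ i, MeasurableSet (C i))
    (hd : Pairwise (Function.onFun Disjoint C)) (hcompl : lam (⋃ i, C i)ᶜ = 0) {φ : Y → ℝ≥0}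
    {c : Fin p → ℝ≥0} (hc : ∀ i, ∀ᵐ y ∂lam.restrict (C i), φ y = c i) :
    lam.withDensity (fun y => φ y) = ∑ i, c i • lam.restrict (C i) := by
  have h0 : ∀ᵐ y ∂lam.withDensity (fun y => (φ y : ℝ≥0∞)), y ∈ ⋃ i, C i :=
    (withDensity_absolutelyContinuous lam _).ae_le hcompl
  rw [← Measure.restrict_eq_self_of_ae_mem h0, Measure.restrict_iUnion hd hC, Measure.sum_fintype]
  refine Finset.sum_congr rfl fun i _ => ?_
  rw [restrict_withDensity (hC i), withDensity_congr_ae (g := fun _ => (c i : ℝ≥0∞))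
    ((hc i).mono fun y hy => by simp [hy]), withDensity_const]
  rfl

/-- Densities of rigid measures are constant on rigid atoms, so rigid measures are combinations of
the normalized atoms. The push-forward of an atom is rigid and, by the next argument, carried by one
atom, hence equal to it. -/
theorem exists_isCyclicDecomposition (hS : IsTestClass S) (hT : Measurable T)
    (hlam : IsRigid S T n lam) (hn : ∀ k, 0 < n k) (hc : ∀ᵐ y ∂lam, ContinuousAt T y)
    (hac : lam.map T ≪ lam)
    {D : ℕ} (hD : ∀ (p : ℕ) (C : Fin p → Set Y), IsRigidFamily S T n lam C → p ≤ D) :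
    ∃ (p : ℕ) (C : Fin p → Set Y) (q : Fin p → Measure Y) (σ : Fin p → Fin p) (K : ℕ),
      IsCyclicDecomposition S T n lam C q σ K := by
  obtain ⟨p, C, hC, hcompl, hatom⟩ := exists_rigid_atoms hS hT hlam hD
  set q : Fin p → Measure Y := fun i => (lam (C i))⁻¹ • lam.restrict (C i) with hq
  have hinv : ∀ i, lam (C i) * (lam (C i))⁻¹ = 1 := fun i =>
    ENNReal.mul_inv_cancel (hC.ne_zero i) (measure_ne_top _ _)
  have hqp : ∀ i, IsProbabilityMeasure (q i) := fun i =>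
    ⟨by simp [hq, mul_comm _ (lam (C i)), hinv]⟩
  have hqC : ∀ i, q i (C i) = 1 := fun i => by
    simp [hq, mul_comm _ (lam (C i)), hinv]
  have hqC' : ∀ i j, i ≠ j → q i (C j) = 0 := fun i j hij => by
    simp [hq, Measure.restrict_apply (hC.measurableSet j), (hC.disjoint hij.symm).inter_eq]
  have hres : ∀ i, lam.restrict (C i) = lam (C i) • q i := fun i => by
    rw [hq]; simp only; rw [smul_smul, hinv, one_smul]
  have hqac : ∀ i, q i ≪ lam := fun i =>
    (Measure.smul_absolutelyContinuous).trans Measure.restrict_le_self.absolutelyContinuous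
  have hspan : ∀ ν : Measure Y, IsFiniteMeasure ν → ν ≪ lam → IsRigid S T n ν →
      ∃ a : Fin p → ℝ≥0, ν = ∑ i, a i • q i := by
    intro ν hν hνac hr
    obtain ⟨φ, hφ, rfl⟩ := exists_withDensity_nnreal hνac
    have hcst : ∀ i, ∃ c : ℝ≥0, ∀ᵐ y ∂lam.restrict (C i), φ y = c := fun i =>
      exists_ae_eq_const_of_superlevel (hC.measurableSet i) fun t =>
        hatom i _ (measurableSet_lt measurable_const hφ) (hlam.restrict_superlevel hS hT hφ hν hr t)
    choose c hcc using hcst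
    refine ⟨fun i => c i * (lam (C i)).toNNReal, ?_⟩
    rw [eq_sum_smul_of_ae_const hC.measurableSet hC.disjoint hcompl hcc]
    refine Finset.sum_congr rfl fun i _ => ?_
    rw [hres i, mul_smul]
    congr 1
    conv_lhs => rw [← ENNReal.coe_toNNReal (measure_ne_top lam (C i))]
    rfl
  have hqr : ∀ i, IsRigid S T n (q i) := fun i => by
    have h1 := (hC.rigid i).smul hT (lam (C i))⁻¹.toNNReal
    have h2 : (lam (C i))⁻¹.toNNReal • lam.restrict (C i) = q i := by
      have : ((lam (C i))⁻¹.toNNReal : ℝ≥0∞) = (lam (C i))⁻¹ :=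
        ENNReal.coe_toNNReal (ENNReal.inv_ne_top.2 (hC.ne_zero i))
      rw [hq]; simp only; rw [← this]; rfl
    rwa [h2] at h1
  have hσ : ∀ i, ∃ j, (q i).map T = q j := by
    intro i
    -- The sets `T ⁻¹' C j` are rigid and cover almost everything. Since `C i` is an atom, it lies
    -- up to a null set in the one that it meets.
    have hex : ∃ j, lam (C i ∩ T ⁻¹' C j) ≠ 0 := by
      by_contra! hcon
      refine hC.ne_zero i (measure_mono_null (t := (⋃ j, C i ∩ T ⁻¹' C j) ∪ (T ⁻¹' (⋃ j, C j)ᶜ))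
        (fun y hy => ?_) (measure_union_null (measure_iUnion_null hcon) ?_))
      · by_cases h : T y ∈ ⋃ j, C j
        · obtain ⟨j, hj⟩ := mem_iUnion.1 h
          exact Or.inl (mem_iUnion.2 ⟨j, hy, hj⟩)
        · exact Or.inr h
      · rw [← Measure.map_apply hT (MeasurableSet.iUnion hC.measurableSet).compl]
        exact hac hcompl
    obtain ⟨j, hj⟩ := hex
    have hdiff : lam (C i \ T ⁻¹' C j) = 0 := (hatom i _ (hT (hC.measurableSet j))
      (IsRigid.restrict_preimage hS hT hlam hc hac (hC.measurableSet j) (hC.rigid j))).resolve_left hj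
    have hzero : ∀ l, l ≠ j → (q i).map T (C l) = 0 := by
      intro l hl
      rw [Measure.map_apply hT (hC.measurableSet l), hq]
      simp only [Measure.smul_apply, smul_eq_mul, mul_eq_zero]
      right
      rw [Measure.restrict_apply (hT (hC.measurableSet l))]
      refine measure_mono_null (fun y hy => ?_) hdiff
      exact ⟨hy.2, fun h => (hC.disjoint hl).le_bot ⟨hy.1, h⟩⟩
    have := hqp i
    have hpm : IsProbabilityMeasure ((q i).map T) := Measure.isProbabilityMeasure_map hT.aemeasurable
    obtain ⟨a, ha⟩ := hspan ((q i).map T) inferInstance (((hqac i).map hT).trans hac)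
      ((hqr i).map hS hT ((hqac i).ae_le hc))
    have hval : ∀ A, (q i).map T A = ∑ l, (a l : ℝ≥0∞) * q l A := fun A => by
      rw [ha, Measure.finsetSum_apply]; rfl
    have ha0 : ∀ l, l ≠ j → a l = 0 := fun l hl => by
      have h1 := hval (C l)
      rw [hzero l hl, Finset.sum_eq_single l (fun m _ hm => by rw [hqC' m l hm, mul_zero]) (by simp),
        hqC, mul_one] at h1
      exact_mod_cast h1.symm
    have haj : a j = 1 := by
      have h1 := hval univ
      rw [measure_univ, Finset.sum_eq_single j (fun m _ hm => by rw [ha0 m hm]; simp) (by simp)] at h1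
      have := hqp j
      rw [measure_univ, mul_one] at h1
      exact_mod_cast h1.symm
    exact ⟨j, by rw [ha, Finset.sum_eq_single j (fun m _ hm => by rw [ha0 m hm, zero_smul]) (by simp), haj,
      one_smul]⟩
  choose σ hσ using hσ
  have hiter : ∀ m i, (q i).map T^[m] = q (σ^[m] i) := by
    intro m
    induction m with
    | zero => intro i; simp
    | succ m ih =>
      intro i
      rw [Function.iterate_succ, Function.iterate_succ, ← Measure.map_map (hT.iterate m) hT, hσ, ih]
      rfl
  have hinj : ∀ i j, q i = q j → i = j := fun i j hij => by
    by_contra hne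
    have := hqC' i j hne
    rw [hij, hqC] at this
    exact one_ne_zero this
  have hper : ∀ i, ∃ N, 0 < N ∧ σ^[N] i = i := by
    intro i
    -- Recurrence of the indices comes from rigidity. The measures `q (σ^[n k] i)` converge to `q i`
    -- and take finitely many values, so a value taken infinitely often is `q i` itself. As `n k >
    -- 0`, the index `i` is periodic.
    have hfreq : ∃ j, ∃ᶠ k in atTop, σ^[n k] i = j := by
      by_contra! hcon
      have := (eventually_all.2 hcon).exists
      obtain ⟨k, hk⟩ := this
      exact hk _ rfl
    obtain ⟨j, hj⟩ := hfreq
    have hpi := hqp i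
    have hpj := hqp j
    have hij : q i = q j := hS.measure_ext fun g hg => by
      have h1 := hqr i g hg
      simp_rw [hiter] at h1
      by_contra hne
      obtain ⟨k, hk1, hk2⟩ := (hj.and_eventually (h1.eventually_ne hne)).exists
      exact hk2 (by rw [hk1])
    obtain ⟨k, hk⟩ := hj.exists
    exact ⟨n k, hn k, hk.trans (hinj _ _ hij).symm⟩
  choose N hN0 hN using hper
  refine ⟨p, C, q, σ, ∏ i, N i, Finset.prod_pos fun i _ => hN0 i, ?_, hC.measurableSet, hC.disjoint,
    hcompl, hqp, hqC, hC.ne_zero, hres, hσ, hspan⟩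
  ext1 i
  obtain ⟨m, hm⟩ := Finset.dvd_prod_of_mem N (Finset.mem_univ i)
  rw [hm]
  exact (show Function.IsPeriodicPt σ (N i) i from hN i).mul_const m

end Atoms

/-! ### Convergence of orbit averages under decorrelation -/

section Averages

theorem sum_pow_le {ρ : ℝ} (h0 : 0 ≤ ρ) (h1 : ρ < 1) (N : ℕ) :
    ∑ i ∈ Finset.range N, ρ ^ i ≤ (1 - ρ)⁻¹ := by
  rw [← tsum_geometric_of_lt_one h0 h1]
  exact (summable_geometric_of_lt_one h0 h1).sum_le_tsum _ fun i _ => pow_nonneg h0 i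

theorem sum_pow_dist_le {ρ : ℝ} (h0 : 0 ≤ ρ) (h1 : ρ < 1) (i N : ℕ) :
    ∑ j ∈ Finset.range N, ρ ^ Nat.dist i j ≤ 2 * (1 - ρ)⁻¹ := by
  have hle : ∑ j ∈ Finset.range N, ρ ^ Nat.dist i j
      ≤ ∑ j ∈ Finset.range ((i + 1) + N), ρ ^ Nat.dist i j :=
    Finset.sum_le_sum_of_subset_of_nonneg (Finset.range_subset_range.2 (by omega))
      fun j _ _ => pow_nonneg h0 _
  refine hle.trans ?_
  rw [Finset.sum_range_add, two_mul]
  refine add_le_add ?_ ?_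
  · rw [← Finset.sum_range_reflect]
    refine (Finset.sum_le_sum fun j hj => ?_).trans (sum_pow_le h0 h1 (i + 1))
    have : Nat.dist i (i + 1 - 1 - j) = j := by
      have := Finset.mem_range.1 hj
      unfold Nat.dist; omega
    rw [this]
  · refine (Finset.sum_le_sum fun j hj => ?_).trans (sum_pow_le h0 h1 N)
    refine pow_le_pow_of_le_one h0 h1.le ?_
    unfold Nat.dist; omega

/-- Among the `n * N` terms only those with `i`, `j` or `|i - j|` small matter, so the total error
is of order `N` and disappears after division by `n * N`. -/
theorem abs_sum_sum_le {ρ C : ℝ} (h0 : 0 ≤ ρ) (h1 : ρ < 1) (hC : 0 ≤ C) {e : ℕ → ℕ → ℝ}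
    (he : ∀ i j, |e i j| ≤ C * (ρ ^ i + ρ ^ j + ρ ^ Nat.dist i j)) {n N : ℕ} (hnN : n ≤ N) :
    |∑ i ∈ Finset.range n, ∑ j ∈ Finset.range N, e i j| ≤ 4 * C * (1 - ρ)⁻¹ * N := by
  have hR : 0 ≤ (1 - ρ)⁻¹ := inv_nonneg.2 (by linarith)
  have hnN' : (n : ℝ) ≤ N := by exact_mod_cast hnN
  calc |∑ i ∈ Finset.range n, ∑ j ∈ Finset.range N, e i j|
      ≤ ∑ i ∈ Finset.range n, ∑ j ∈ Finset.range N, C * (ρ ^ i + ρ ^ j + ρ ^ Nat.dist i j) :=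
        (Finset.abs_sum_le_sum_abs _ _).trans (Finset.sum_le_sum fun i _ =>
          (Finset.abs_sum_le_sum_abs _ _).trans (Finset.sum_le_sum fun j _ => he i j))
    _ ≤ ∑ i ∈ Finset.range n, C * (N * ρ ^ i + (1 - ρ)⁻¹ + 2 * (1 - ρ)⁻¹) := by
        refine Finset.sum_le_sum fun i _ => ?_
        rw [← Finset.mul_sum, Finset.sum_add_distrib, Finset.sum_add_distrib]
        gcongr
        · simp
        · exact sum_pow_le h0 h1 N
        · exact sum_pow_dist_le h0 h1 i N
    _ = C * (N * ∑ i ∈ Finset.range n, ρ ^ i + n * (3 * (1 - ρ)⁻¹)) := by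
        rw [← Finset.mul_sum, Finset.sum_add_distrib, Finset.sum_add_distrib, ← Finset.mul_sum]
        simp only [Finset.sum_const, Finset.card_range, nsmul_eq_mul]
        ring
    _ ≤ C * (N * (1 - ρ)⁻¹ + N * (3 * (1 - ρ)⁻¹)) := by
        gcongr
        exact sum_pow_le h0 h1 n
    _ = _ := by ring

variable {Y : Type*} [MeasurableSpace Y]

/-- The average of `g` along the first `n` points of the orbit of `x` under `F`. -/
def orbitAverage (F : Y → Y) (g : Y → ℝ) (n : ℕ) (x : Y) : ℝ :=
  (∑ i ∈ Finset.range n, g (F^[i] x)) / n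

theorem orbitAverage_mem_Icc {F : Y → Y} {g : Y → ℝ} (hg : ∀ y, g y ∈ Icc (0 : ℝ) 1) (n : ℕ) (x : Y) :
    orbitAverage F g n x ∈ Icc (0 : ℝ) 1 := by
  refine ⟨div_nonneg (Finset.sum_nonneg fun i _ => (hg _).1) (Nat.cast_nonneg n),
    div_le_one_of_le₀ ?_ (Nat.cast_nonneg n)⟩
  calc _ ≤ ∑ i ∈ Finset.range n, (1 : ℝ) := Finset.sum_le_sum fun i _ => (hg _).2
    _ = n := by simp

theorem measurable_orbitAverage {F : Y → Y} (hF : Measurable F) {g : Y → ℝ} (hg : Measurable g)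
    (n : ℕ) : Measurable (orbitAverage F g n) :=
  (Finset.measurable_fun_sum _ fun i _ => hg.comp (hF.iterate i)).div_const _

variable {ν : Measure Y} [IsFiniteMeasure ν]

/-- Asymptotic decorrelation of `g` along the orbits of `F`, with an exponential rate. -/
def HasDecorrelation (F : Y → Y) (g : Y → ℝ) (ν : Measure Y) (κ C ρ : ℝ) : Prop :=
  ∀ i m, |∫ x, g (F^[i] x) * g (F^[m + i] x) ∂ν - κ| ≤ C * (ρ ^ i + ρ ^ m)

variable {F : Y → Y} {g : Y → ℝ} {κ C ρ : ℝ}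

theorem HasDecorrelation.abs_sub_le (h : HasDecorrelation F g ν κ C ρ) (h0 : 0 ≤ ρ) (h1 : ρ < 1)
    (hC : 0 ≤ C) (m i j : ℕ) :
    |∫ x, g (F^[i + m] x) * g (F^[j + m] x) ∂ν - κ| ≤ C * (ρ ^ i + ρ ^ j + ρ ^ Nat.dist i j) := by
  have key : ∀ i j, i ≤ j → |∫ x, g (F^[i + m] x) * g (F^[j + m] x) ∂ν - κ|
      ≤ C * (ρ ^ i + ρ ^ j + ρ ^ Nat.dist i j) := fun i j hij => by
    have := h (i + m) (j - i)
    rw [show j - i + (i + m) = j + m by omega] at this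
    refine this.trans ?_
    have e : Nat.dist i j = j - i := Nat.dist_eq_sub_of_le hij
    have h2 : ρ ^ (i + m) ≤ ρ ^ i := pow_le_pow_of_le_one h0 h1.le (by omega)
    rw [e]
    gcongr
    linarith [pow_nonneg h0 j]
  rcases le_total i j with hij | hij
  · exact key i j hij
  · have := key j i hij
    rw [Nat.dist_comm, add_comm (ρ ^ i)]
    simpa only [mul_comm (g (F^[i + m] _))] using this

theorem integral_orbitAverage_mul (hF : Measurable F) (hgm : Measurable g)
    (hg : ∀ y, g y ∈ Icc (0 : ℝ) 1) (m n N : ℕ) :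
    ∫ x, orbitAverage F g n (F^[m] x) * orbitAverage F g N (F^[m] x) ∂ν
      = (∑ i ∈ Finset.range n, ∑ j ∈ Finset.range N, ∫ x, g (F^[i + m] x) * g (F^[j + m] x) ∂ν)
        / (n * N) := by
  have hi : ∀ i j, Integrable (fun x => g (F^[i + m] x) * g (F^[j + m] x)) ν := fun i j =>
    integrable_of_measurable_of_mem_Icc
      ((hgm.comp (hF.iterate _)).mul (hgm.comp (hF.iterate _))) fun y =>
      ⟨mul_nonneg (hg _).1 (hg _).1, mul_le_one₀ (hg _).2 (hg _).1 (hg _).2⟩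
  have e : ∀ x, orbitAverage F g n (F^[m] x) * orbitAverage F g N (F^[m] x)
      = (∑ i ∈ Finset.range n, ∑ j ∈ Finset.range N, g (F^[i + m] x) * g (F^[j + m] x)) / (n * N) := by
    intro x
    simp only [orbitAverage, ← Function.iterate_add_apply]
    rw [div_mul_div_comm, Finset.sum_mul_sum]
  simp_rw [e]
  rw [integral_div, integral_finsetSum _ fun i _ => integrable_finsetSum _ fun j _ => hi i j]
  congr 1
  exact Finset.sum_congr rfl fun i _ => integral_finsetSum _ fun j _ => hi i j

/-- Expanding the square, all three correlations are `κ` up to `4 * C * (1 - ρ)⁻¹ / n`, and `κ`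
cancels; the coefficients `1 + 2 + 1` give `16`. Invariance of `ν` plays no role, and the bound is
uniform in the shift `m`. -/
theorem HasDecorrelation.integral_sq_le (h : HasDecorrelation F g ν κ C ρ) (hF : Measurable F)
    (hgm : Measurable g) (hg : ∀ y, g y ∈ Icc (0 : ℝ) 1) (h0 : 0 ≤ ρ) (h1 : ρ < 1) (hC : 0 ≤ C)
    {n N : ℕ} (hn : 0 < n) (hnN : n ≤ N) (m : ℕ) :
    ∫ x, (orbitAverage F g n (F^[m] x) - orbitAverage F g N (F^[m] x)) ^ 2 ∂ν
      ≤ 16 * C * (1 - ρ)⁻¹ / n := by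
  have hR : 0 ≤ (1 - ρ)⁻¹ := inv_nonneg.2 (by linarith)
  have ha : ∀ n N, Integrable (fun x => orbitAverage F g n (F^[m] x) * orbitAverage F g N (F^[m] x)) ν :=
    fun n N => integrable_of_measurable_of_mem_Icc
      (((measurable_orbitAverage hF hgm _).comp (hF.iterate _)).mul
        ((measurable_orbitAverage hF hgm _).comp (hF.iterate _))) fun y =>
      have a := orbitAverage_mem_Icc (F := F) hg n (F^[m] y)
      have b := orbitAverage_mem_Icc (F := F) hg N (F^[m] y)
      ⟨mul_nonneg a.1 b.1, mul_le_one₀ a.2 b.1 b.2⟩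
  have hN : 0 < N := hn.trans_le hnN
  have hnr : (0 : ℝ) < n := by exact_mod_cast hn
  have hNr : (0 : ℝ) < N := by exact_mod_cast hN
  have hb : ∀ a b : ℕ, 0 < a → a ≤ b → n ≤ a →
      |∫ x, orbitAverage F g a (F^[m] x) * orbitAverage F g b (F^[m] x) ∂ν - κ|
        ≤ 4 * C * (1 - ρ)⁻¹ / n := by
    intro a b ha0 hab hna
    have ha' : (0 : ℝ) < a := by exact_mod_cast ha0
    have hb' : (0 : ℝ) < b := by exact_mod_cast ha0.trans_le hab
    have := abs_sum_sum_le h0 h1 hC (h.abs_sub_le h0 h1 hC m) hab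
    rw [integral_orbitAverage_mul hF hgm hg]
    have e : (∑ i ∈ Finset.range a, ∑ j ∈ Finset.range b, ∫ x, g (F^[i + m] x) * g (F^[j + m] x) ∂ν)
        / (a * b) - κ = (∑ i ∈ Finset.range a, ∑ j ∈ Finset.range b,
          (∫ x, g (F^[i + m] x) * g (F^[j + m] x) ∂ν - κ)) / (a * b) := by
      simp only [Finset.sum_sub_distrib, Finset.sum_const, Finset.card_range, nsmul_eq_mul]
      field_simp
    rw [e, abs_div, abs_of_pos (mul_pos ha' hb'), div_le_iff₀ (mul_pos ha' hb')]
    refine this.trans ?_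
    rw [div_mul_eq_mul_div, le_div_iff₀ hnr]
    have : (n : ℝ) ≤ a := by exact_mod_cast hna
    calc _ = 4 * C * (1 - ρ)⁻¹ * (n * b) := by ring
      _ ≤ _ := by gcongr
  have e : ∀ x, (orbitAverage F g n (F^[m] x) - orbitAverage F g N (F^[m] x)) ^ 2
      = orbitAverage F g n (F^[m] x) * orbitAverage F g n (F^[m] x)
        - 2 * (orbitAverage F g n (F^[m] x) * orbitAverage F g N (F^[m] x))
        + orbitAverage F g N (F^[m] x) * orbitAverage F g N (F^[m] x) := fun x => by ring
  simp_rw [e]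
  have i1 : Integrable (fun x => orbitAverage F g n (F^[m] x) * orbitAverage F g n (F^[m] x)
        - 2 * (orbitAverage F g n (F^[m] x) * orbitAverage F g N (F^[m] x))) ν :=
    (ha n n).sub ((ha n N).const_mul 2)
  rw [integral_add i1 (ha N N), integral_sub (ha n n) ((ha n N).const_mul 2), integral_const_mul]
  have b1 := (abs_le.1 (hb n n hn le_rfl le_rfl)).2
  have b2 := (abs_le.1 (hb n N hn hnN le_rfl)).1
  have b3 := (abs_le.1 (hb N N hN le_rfl hnN)).2
  have : 16 * C * (1 - ρ)⁻¹ / n = 4 * (4 * C * (1 - ρ)⁻¹ / n) := by ring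
  rw [this]
  linarith

theorem HasDecorrelation.integral_abs_le (h : HasDecorrelation F g ν κ C ρ) (hF : Measurable F)
    (hgm : Measurable g) (hg : ∀ y, g y ∈ Icc (0 : ℝ) 1) (h0 : 0 ≤ ρ) (h1 : ρ < 1) (hC : 0 ≤ C)
    {r n N : ℕ} (hr : 0 < r) (hn : r ^ 2 ≤ n) (hnN : n ≤ N) (m : ℕ) :
    ∫ x, |orbitAverage F g n (F^[m] x) - orbitAverage F g N (F^[m] x)| ∂ν
      ≤ (ν.real univ + 16 * C * (1 - ρ)⁻¹) / r := by
  have hn0 : 0 < n := (pow_pos hr 2).trans_le hn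
  have hR : 0 ≤ (1 - ρ)⁻¹ := inv_nonneg.2 (by linarith)
  have hrr : (0 : ℝ) < r := by exact_mod_cast hr
  have hnr : (r : ℝ) ^ 2 ≤ n := by exact_mod_cast hn
  set f : Y → ℝ := fun x => orbitAverage F g n (F^[m] x) - orbitAverage F g N (F^[m] x) with hf
  have hfm : Measurable f := ((measurable_orbitAverage hF hgm _).comp (hF.iterate _)).sub
        ((measurable_orbitAverage hF hgm _).comp (hF.iterate _))
  have hf1 : ∀ x, |f x| ≤ 1 := fun x => by
    have a := orbitAverage_mem_Icc (F := F) hg n (F^[m] x)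
    have b := orbitAverage_mem_Icc (F := F) hg N (F^[m] x)
    rw [abs_le]; constructor <;> simp only [hf] <;> linarith [a.1, a.2, b.1, b.2]
  have i1 : Integrable (fun x => |f x|) ν := integrable_of_measurable_of_mem_Icc hfm.abs fun x =>
    ⟨abs_nonneg _, hf1 x⟩
  have i2 : Integrable (fun x => f x ^ 2) ν := integrable_of_measurable_of_mem_Icc (hfm.pow_const 2)
    fun x => ⟨sq_nonneg _, by rw [sq_le_one_iff_abs_le_one]; exact hf1 x⟩
  have hsq := h.integral_sq_le hF hgm hg h0 h1 hC hn0 hnN m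
  -- A pointwise substitute for Cauchy–Schwarz, balanced by `r` so that `r ^ 2 ≤ n` yields a bound
  -- of order `1 / r`.
  have hpt : ∀ x, |f x| ≤ 1 / r + r * f x ^ 2 := fun x => by
    have : 0 ≤ (r * |f x| - 1) ^ 2 := sq_nonneg _
    have h2 : r * |f x| ≤ 1 + (r * |f x|) ^ 2 := by nlinarith [abs_nonneg (f x)]
    rw [← sq_abs (f x)]
    have h3 : |f x| = (r * |f x|) / r := by field_simp
    calc |f x| = (r * |f x|) / r := h3
      _ ≤ (1 + (r * |f x|) ^ 2) / r := by gcongr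
      _ = _ := by field_simp
  calc ∫ x, |f x| ∂ν ≤ ∫ x, (1 / r + r * f x ^ 2) ∂ν :=
        integral_mono i1 ((integrable_const _).add (i2.const_mul _)) hpt
    _ = ν.real univ * (1 / r) + r * ∫ x, f x ^ 2 ∂ν := by
        rw [integral_add (integrable_const _) (i2.const_mul _), integral_const_mul]; simp
    _ ≤ ν.real univ * (1 / r) + r * (16 * C * (1 - ρ)⁻¹ / (r : ℝ) ^ 2) := by
        gcongr
        exact hsq.trans (by gcongr)
    _ = _ := by field_simp

theorem HasDecorrelation.ae_tendsto (h : HasDecorrelation F g ν κ C ρ) (hF : Measurable F)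
    (hgm : Measurable g) (hg : ∀ y, g y ∈ Icc (0 : ℝ) 1) (h0 : 0 ≤ ρ) (h1 : ρ < 1) (hC : 0 ≤ C) :
    ∀ᵐ x ∂ν, ∃ b, Tendsto (fun n => orbitAverage F g n x) atTop (𝓝 b) := by
  have hR : 0 ≤ (1 - ρ)⁻¹ := inv_nonneg.2 (by linarith)
  -- Along fourth powers the `L¹` norms of the increments are of order `(j + 1)⁻²`, hence summable,
  -- while consecutive times have ratio tending to one. Since `g ≥ 0` the orbit sums are monotone in
  -- time, and convergence at these times extends to all times.
  set f : ℕ → Y → ℝ := fun j x => orbitAverage F g ((j + 1) ^ 4) x - orbitAverage F g ((j + 2) ^ 4) x with hf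
  have hfm : ∀ j, Measurable (f j) := fun j => (measurable_orbitAverage hF hgm _).sub
        (measurable_orbitAverage hF hgm _)
  have hf1 : ∀ j x, |f j x| ≤ 1 := fun j x => by
    have a := orbitAverage_mem_Icc (F := F) hg ((j + 1) ^ 4) x
    have b := orbitAverage_mem_Icc (F := F) hg ((j + 2) ^ 4) x
    rw [abs_le]; constructor <;> simp only [hf] <;> linarith [a.1, a.2, b.1, b.2]
  have hint : ∀ j, Integrable (fun x => |f j x|) ν := fun j =>
    integrable_of_measurable_of_mem_Icc (hfm j).abs fun x => ⟨abs_nonneg _, hf1 j x⟩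
  set M := ν.real univ + 16 * C * (1 - ρ)⁻¹ with hM
  have hM0 : 0 ≤ M := by positivity
  have hbound : ∀ j, ∫ x, |f j x| ∂ν ≤ M / ((j + 1 : ℕ) : ℝ) ^ 2 := fun j => by
    have := h.integral_abs_le hF hgm hg h0 h1 hC (r := (j + 1) ^ 2) (n := (j + 1) ^ 4)
      (N := (j + 2) ^ 4) (by positivity) (by rw [← pow_mul]) (by gcongr; omega) 0
    simpa [hf] using this
  have hsum : Summable fun j : ℕ => M / ((j + 1 : ℕ) : ℝ) ^ 2 :=
    (((summable_nat_add_iff 1).2 (Real.summable_nat_pow_inv.2 one_lt_two)).mul_left M).congr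
      fun j => by rw [div_eq_mul_inv]
  have hfin : ∑' j, ∫⁻ x, ENNReal.ofReal |f j x| ∂ν ≠ ⊤ := by
    refine ne_top_of_le_ne_top hsum.tsum_ofReal_ne_top (ENNReal.tsum_le_tsum fun j => ?_)
    rw [← ofReal_integral_eq_lintegral_ofReal (hint j) (.of_forall fun x => abs_nonneg _)]
    exact ENNReal.ofReal_le_ofReal (hbound j)
  rw [← lintegral_tsum fun j => (hfm j).abs.ennreal_ofReal.aemeasurable] at hfin
  filter_upwards [ae_lt_top (Measurable.tsum fun j => (hfm j).abs.ennreal_ofReal) hfin] with x hx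
  have hs : Summable fun j => dist (orbitAverage F g ((j + 1) ^ 4) x)
      (orbitAverage F g ((j.succ + 1) ^ 4) x) := by
    have := ENNReal.summable_toReal hx.ne
    refine this.congr fun j => ?_
    rw [ENNReal.toReal_ofReal (abs_nonneg _), Real.dist_eq]
  obtain ⟨b, hb⟩ := cauchySeq_tendsto_of_complete (cauchySeq_of_summable_dist hs)
  refine ⟨b, ?_⟩
  refine tendsto_div_of_monotone_of_exists_subseq_tendsto_div
    (fun n => ∑ i ∈ Finset.range n, g (F^[i] x)) b ?_ fun a ha => ⟨fun j => (j + 1) ^ 4, ?_, ?_, ?_⟩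
  · exact monotone_nat_of_le_succ fun n => by
      rw [Finset.sum_range_succ]; linarith [(hg (F^[n] x)).1]
  · have hlim : Tendsto (fun j : ℕ => (1 + 1 / ((j : ℝ) + 1)) ^ 4) atTop (𝓝 ((1 + 0) ^ 4)) :=
      (tendsto_one_div_add_atTop_nhds_zero_nat.const_add 1).pow 4
    filter_upwards [hlim.eventually_lt_const (show ((1 : ℝ) + 0) ^ 4 < a by simpa using ha)] with j hj
    push_cast
    have e : ((j : ℝ) + 1 + 1) ^ 4 = (1 + 1 / ((j : ℝ) + 1)) ^ 4 * ((j : ℝ) + 1) ^ 4 := by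
      rw [← mul_pow]; congr 1; field_simp
    rw [e]
    gcongr
  · exact (tendsto_pow_atTop (by norm_num)).comp (tendsto_add_atTop_nat 1)
  · exact hb

/-- The upper limit of the averages of `g` along the orbits of `F`. -/
def orbitLimit (F : Y → Y) (g : Y → ℝ) (x : Y) : ℝ := limsup (fun n => orbitAverage F g n x) atTop

theorem measurable_orbitLimit (hF : Measurable F) (hgm : Measurable g) :
    Measurable (orbitLimit F g) :=
  Measurable.limsup fun n => measurable_orbitAverage hF hgm n

theorem tendsto_orbitAverage_apply_iff (hg : ∀ y, g y ∈ Icc (0 : ℝ) 1) {x : Y} {b : ℝ} :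
    Tendsto (fun n => orbitAverage F g n (F x)) atTop (𝓝 b)
      ↔ Tendsto (fun n => orbitAverage F g n x) atTop (𝓝 b) := by
  have hd : Tendsto (fun n => orbitAverage F g n (F x) - orbitAverage F g n x) atTop (𝓝 0) := by
    have h2 : Tendsto (fun n : ℕ => 1 / (n : ℝ)) atTop (𝓝 0) := tendsto_one_div_atTop_nhds_zero_nat
    refine squeeze_zero_norm (fun n => ?_) h2
    have e : orbitAverage F g n (F x) - orbitAverage F g n x = (g (F^[n] x) - g x) / n := by
      unfold orbitAverage
      simp only [← Function.iterate_succ_apply]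
      rw [← sub_div]
      congr 1
      have := Finset.sum_range_succ (fun i => g (F^[i] x)) n
      rw [Finset.sum_range_succ'] at this
      simp only [Function.iterate_zero, id_eq] at this
      linarith
    rw [e, norm_div, Real.norm_natCast]
    gcongr
    rw [Real.norm_eq_abs, abs_le]
    constructor <;> linarith [(hg (F^[n] x)).1, (hg (F^[n] x)).2, (hg x).1, (hg x).2]
  constructor
  · intro h; simpa using h.sub hd
  · intro h; simpa using h.add hd

theorem tendsto_orbitAverage_iterate_iff (hg : ∀ y, g y ∈ Icc (0 : ℝ) 1) {x : Y} {b : ℝ} (m : ℕ) :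
    Tendsto (fun n => orbitAverage F g n (F^[m] x)) atTop (𝓝 b)
      ↔ Tendsto (fun n => orbitAverage F g n x) atTop (𝓝 b) := by
  induction m with
  | zero => rfl
  | succ m ih => rw [Function.iterate_succ_apply', tendsto_orbitAverage_apply_iff hg, ih]

theorem HasDecorrelation.ae_tendsto_orbitLimit (h : HasDecorrelation F g ν κ C ρ) (hF : Measurable F)
    (hgm : Measurable g) (hg : ∀ y, g y ∈ Icc (0 : ℝ) 1) (h0 : 0 ≤ ρ) (h1 : ρ < 1) (hC : 0 ≤ C) :
    ∀ᵐ x ∂ν, Tendsto (fun n => orbitAverage F g n x) atTop (𝓝 (orbitLimit F g x)) := by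
  filter_upwards [h.ae_tendsto hF hgm hg h0 h1 hC] with x ⟨b, hb⟩
  rwa [orbitLimit, hb.limsup_eq]

/-- Dropping the first `m` iterates does not change the limiting average, and the rate does not
depend on `m`. This uniformity allows `m` to tend to infinity with `n` fixed. -/
theorem HasDecorrelation.integral_abs_orbitLimit_sub_le (h : HasDecorrelation F g ν κ C ρ)
    (hF : Measurable F) (hgm : Measurable g) (hg : ∀ y, g y ∈ Icc (0 : ℝ) 1) (h0 : 0 ≤ ρ)
    (h1 : ρ < 1) (hC : 0 ≤ C) {r n : ℕ} (hr : 0 < r) (hn : r ^ 2 ≤ n) (m : ℕ) :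
    ∫ x, |orbitAverage F g n (F^[m] x) - orbitLimit F g x| ∂ν
      ≤ (ν.real univ + 16 * C * (1 - ρ)⁻¹) / r := by
  have hlim : Tendsto (fun N => ∫ x, |orbitAverage F g n (F^[m] x) - orbitAverage F g N (F^[m] x)| ∂ν)
      atTop (𝓝 (∫ x, |orbitAverage F g n (F^[m] x) - orbitLimit F g x| ∂ν)) := by
    refine tendsto_integral_of_dominated_convergence (fun _ => 1) (fun N => ?_) (integrable_const _)
      (fun N => .of_forall fun x => ?_) ?_
    · exact (((measurable_orbitAverage hF hgm _).comp (hF.iterate _)).sub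
        ((measurable_orbitAverage hF hgm _).comp (hF.iterate _))).abs.aestronglyMeasurable
    · have a := orbitAverage_mem_Icc (F := F) hg n (F^[m] x)
      have b := orbitAverage_mem_Icc (F := F) hg N (F^[m] x)
      rw [Real.norm_eq_abs, abs_abs, abs_le]; constructor <;> linarith [a.1, a.2, b.1, b.2]
    · filter_upwards [h.ae_tendsto_orbitLimit hF hgm hg h0 h1 hC] with x hx
      exact (((tendsto_orbitAverage_iterate_iff hg m).2 hx).const_sub _).abs
  refine le_of_tendsto hlim ?_
  filter_upwards [eventually_ge_atTop n] with N hN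
  exact h.integral_abs_le hF hgm hg h0 h1 hC hr hn hN m

end Averages

/-! ### Transfer operator acting on measures -/

section Model

variable {Y : Type*} [TopologicalSpace Y] [MeasurableSpace Y]

/-- A Banach space `H` with a transfer operator `L`, and a closed cone of positive elements, that are
represented by finite measures on `Y` giving no mass to the discontinuities of `T`. -/
structure TransferModel (T : Y → Y) (S : Set (Y → ℝ)) (H : Type*) [NormedAddCommGroup H]
    [NormedSpace ℂ H] where
  /-- the transfer operator -/
  L : H →L[ℂ] H
  /-- the multiplication by a test function -/
  mul : (Y → ℝ) → H →L[ℂ] H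
  /-- the integral against a test function -/
  pair : (Y → ℝ) → H →L[ℂ] ℂ
  /-- the cone of positive elements -/
  cone : Set H
  /-- the measure that represents a positive element -/
  meas : H → Measure Y
  isClosed_cone : IsClosed cone
  add_mem : ∀ v ∈ cone, ∀ w ∈ cone, v + w ∈ cone
  smul_mem : ∀ (c : ℝ≥0), ∀ w ∈ cone, ((c : ℝ) : ℂ) • w ∈ cone
  L_mem : ∀ w ∈ cone, L w ∈ cone
  mul_mem : ∀ g ∈ S, ∀ w ∈ cone, mul g w ∈ cone
  isFiniteMeasure : ∀ w, IsFiniteMeasure (meas w)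
  pair_eq : ∀ g ∈ S, ∀ w ∈ cone, pair g w = ((∫ y, g y ∂meas w : ℝ) : ℂ)
  ae_continuousAt : ∀ w ∈ cone, ∀ᵐ y ∂meas w, ContinuousAt T y
  meas_L : ∀ w ∈ cone, meas (L w) = (meas w).map T
  pair_mul : ∀ g ∈ S, ∀ h ∈ S, ∀ w ∈ cone, pair h (mul g w) = pair (fun y => g y * h y) w

attribute [instance] TransferModel.isFiniteMeasure

namespace TransferModel

variable [TopologicalSpace.PseudoMetrizableSpace Y] [BorelSpace Y]
  {H : Type*} [NormedAddCommGroup H] [NormedSpace ℂ H]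
  {T : Y → Y} {S : Set (Y → ℝ)} (D : TransferModel T S H)

theorem pair_re {g : Y → ℝ} (hg : g ∈ S) {w : H} (hw : w ∈ D.cone) :
    (D.pair g w).re = ∫ y, g y ∂D.meas w := by rw [D.pair_eq g hg w hw]; simp

theorem pow_mem {w : H} (hw : w ∈ D.cone) (m : ℕ) : (D.L ^ m) w ∈ D.cone := by
  induction m with
  | zero => simpa using hw
  | succ m ih => rw [pow_succ']; exact D.L_mem _ ih

theorem meas_pow (hT : Measurable T) {w : H} (hw : w ∈ D.cone) (m : ℕ) :
    D.meas ((D.L ^ m) w) = (D.meas w).map T^[m] := by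
  induction m with
  | zero => simp
  | succ m ih =>
    rw [pow_succ', mul_apply_eq_comp, D.meas_L _ (D.pow_mem hw m), ih,
      Measure.map_map hT (hT.iterate m), ← Function.iterate_succ']

theorem ae_continuousAt_iterate (hT : Measurable T) (m : ℕ) :
    ∀ w ∈ D.cone, ∀ᵐ y ∂D.meas w, ContinuousAt T^[m] y := by
  induction m with
  | zero => exact fun w _ => .of_forall fun y => continuousAt_id
  | succ m ih =>
    intro w hw
    have h1 := ih _ (D.L_mem w hw)
    rw [D.meas_L w hw] at h1
    filter_upwards [D.ae_continuousAt w hw, ae_of_ae_map hT.aemeasurable h1] with y hy1 hy2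
    rw [Function.iterate_succ]
    exact ContinuousAt.comp hy2 hy1

theorem weakTendsto_meas {w : ℕ → H} {w₀ : H} (hw : ∀ k, w k ∈ D.cone) (hw₀ : w₀ ∈ D.cone)
    (h : Tendsto w atTop (𝓝 w₀)) : WeakTendsto S (fun k => D.meas (w k)) (D.meas w₀) := by
  intro g hg
  have := (Complex.continuous_re.tendsto _).comp (((D.pair g).continuous.tendsto w₀).comp h)
  simpa only [Function.comp_def, D.pair_re hg hw₀, D.pair_re hg (hw _)] using this

variable (hS : IsTestClass S) (hT : Measurable T)
include hS

theorem meas_add {v w : H} (hv : v ∈ D.cone) (hw : w ∈ D.cone) :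
    D.meas (v + w) = D.meas v + D.meas w :=
  hS.measure_ext fun g hg => by
    rw [integral_add_measure (hS.integrable hg _) (hS.integrable hg _),
      ← D.pair_re hg (D.add_mem v hv w hw), map_add, Complex.add_re, D.pair_re hg hv, D.pair_re hg hw]

theorem meas_smul (c : ℝ≥0) {w : H} (hw : w ∈ D.cone) :
    D.meas (((c : ℝ) : ℂ) • w) = c • D.meas w :=
  hS.measure_ext fun g hg => by
    rw [integral_smul_nnreal_measure, ← D.pair_re hg (D.smul_mem c w hw), map_smul, D.pair_eq g hg w hw,
      smul_eq_mul, ← Complex.ofReal_mul, Complex.ofReal_re, NNReal.smul_def, smul_eq_mul]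

theorem meas_mul {g : Y → ℝ} (hg : g ∈ S) {w : H} (hw : w ∈ D.cone) :
    D.meas (D.mul g w) = (D.meas w).withDensity fun y => ENNReal.ofReal (g y) := by
  have hfin : IsFiniteMeasure ((D.meas w).withDensity fun y => ENNReal.ofReal (g y)) :=
    isFiniteMeasure_withDensity_ofReal (hS.integrable hg _).2
  refine hS.measure_ext fun h hh => ?_
  rw [← D.pair_re hh (D.mul_mem g hg w hw), D.pair_mul g hg h hh w hw,
    D.pair_re (hS.mul_mem g hg h hh) hw,
    integral_withDensity_eq_integral_toReal_smul (hS.measurable hg).ennreal_ofReal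
      (.of_forall fun y => ENNReal.ofReal_lt_top)]
  refine integral_congr_ae (.of_forall fun y => ?_)
  simp [ENNReal.toReal_ofReal (hS.mem_Icc g hg y).1]

theorem integral_meas_mul {g : Y → ℝ} (hg : g ∈ S) {w : H} (hw : w ∈ D.cone) (f : Y → ℝ) :
    ∫ y, f y ∂D.meas (D.mul g w) = ∫ y, g y * f y ∂D.meas w := by
  rw [D.meas_mul hS hg hw, integral_withDensity_eq_integral_toReal_smul
    (hS.measurable hg).ennreal_ofReal (.of_forall fun y => ENNReal.ofReal_lt_top)]
  refine integral_congr_ae (.of_forall fun y => ?_)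
  simp [ENNReal.toReal_ofReal (hS.mem_Icc g hg y).1]

omit hS
variable {P : H →L[ℂ] H} {n : ℕ → ℕ} {B C ρ : ℝ} (hP : IsPeripheralProjection D.L P n B C ρ)
include hP

theorem tendsto_pow_apply (w : H) : Tendsto (fun k => (D.L ^ n k) w) atTop (𝓝 (P w)) :=
  ((ContinuousLinearMap.apply ℂ H w).continuous.tendsto P).comp hP.tendsto

theorem proj_mem {w : H} (hw : w ∈ D.cone) : P w ∈ D.cone :=
  D.isClosed_cone.mem_of_tendsto (D.tendsto_pow_apply hP w) (.of_forall fun _ => D.pow_mem hw _)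

theorem proj_proj (w : H) : P (P w) = P w := congrArg (fun A : H →L[ℂ] H => A w) hP.mul_self

theorem proj_pow (m : ℕ) (w : H) : P ((D.L ^ m) w) = (D.L ^ m) (P w) :=
  congrArg (fun A : H →L[ℂ] H => A w) ((show Commute P D.L from hP.comm).pow_right m).eq

include hT in
theorem weakTendsto_map_proj {w : H} (hw : w ∈ D.cone) :
    WeakTendsto S (fun k => (D.meas w).map T^[n k]) (D.meas (P w)) := by
  have := D.weakTendsto_meas (fun k => D.pow_mem hw (n k)) (D.proj_mem hP hw) (D.tendsto_pow_apply hP w)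
  simpa only [D.meas_pow hT hw] using this

include hT in
theorem isRigid_meas {w : H} (hw : w ∈ D.cone) (hPw : P w = w) : IsRigid S T n (D.meas w) := by
  have := D.weakTendsto_map_proj hT hP hw
  rwa [hPw] at this

include hS hT in
-- The representing measure need not determine the element of `H`. It does determine the measure of
-- the projection, as the weak limit of its images under `T^[n k]`.
theorem meas_proj_congr {v w : H} (hv : v ∈ D.cone) (hw : w ∈ D.cone) (h : D.meas v = D.meas w) :
    D.meas (P v) = D.meas (P w) := by
  have h1 := D.weakTendsto_map_proj hT hP hv
  rw [h] at h1
  exact h1.unique hS (D.weakTendsto_map_proj hT hP hw)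

include hS hT in
theorem meas_proj_mul_le {g : Y → ℝ} (hg : g ∈ S) {w : H} (hw : w ∈ D.cone) :
    D.meas (P (D.mul g w)) ≤ D.meas (P w) := by
  refine hS.measure_le_of_forall_integral_le fun h hh => ?_
  refine le_of_tendsto_of_tendsto' (D.weakTendsto_map_proj hT hP (D.mul_mem g hg w hw) h hh)
    (D.weakTendsto_map_proj hT hP hw h hh) fun k => ?_
  refine integral_mono_measure (Measure.map_mono ?_ (hT.iterate _))
    (.of_forall fun y => (hS.mem_Icc h hh y).1) (hS.integrable hh _)
  rw [D.meas_mul hS hg hw]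
  conv_rhs => rw [← withDensity_one (μ := D.meas w)]
  exact withDensity_mono (.of_forall fun y => ENNReal.ofReal_le_one.2 (hS.mem_Icc g hg y).2)

/-- The reference element: an average of the images of `w₀`, dominating its image and `w₀`. -/
theorem exists_reference [CompleteSpace H] {w₀ : H} (hw₀ : w₀ ∈ D.cone) (hPw₀ : P w₀ = w₀) :
    ∃ w ∈ D.cone, P w = w ∧ w = ((2⁻¹ : ℝ≥0) : ℂ) • w₀ + ((2⁻¹ : ℝ≥0) : ℂ) • D.L w := by
  -- The sum of these terms is a geometric average of the images of `w₀`. It is still fixed by `P`,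
  -- and shifting the index gives the announced identity, which makes both the measure of `w₀` and
  -- the `T`-image of the reference measure absolutely continuous with respect to the reference
  -- measure.
  set a : ℕ → H := fun j => (((2⁻¹ : ℝ≥0) ^ (j + 1) : ℝ≥0) : ℂ) • (D.L ^ j) w₀ with ha
  have hsum : Summable a := by
    refine Summable.of_norm_bounded (g := fun j : ℕ => (1 / 2 : ℝ) ^ j * (B * ‖w₀‖))
      (summable_geometric_two.mul_right _) fun j => ?_
    rw [ha, norm_smul]
    have h1 : ‖((((2⁻¹ : ℝ≥0) ^ (j + 1) : ℝ≥0) : ℝ) : ℂ)‖ ≤ (1 / 2 : ℝ) ^ j := by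
      rw [Complex.norm_real, Real.norm_of_nonneg (NNReal.coe_nonneg _)]
      push_cast
      rw [pow_succ, one_div]
      have : (0 : ℝ) ≤ (2⁻¹ : ℝ) ^ j := by positivity
      linarith
    have h2 : ‖(D.L ^ j) w₀‖ ≤ B * ‖w₀‖ :=
      ((D.L ^ j).le_opNorm w₀).trans (by gcongr; exact hP.norm_pow_le j)
    exact mul_le_mul h1 h2 (norm_nonneg _) (by positivity)
  refine ⟨∑' j, a j, ?_, ?_, ?_⟩
  · refine D.isClosed_cone.mem_of_tendsto hsum.hasSum.tendsto_sum_nat (.of_forall fun N => ?_)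
    have h0 : (0 : H) ∈ D.cone := by simpa using D.smul_mem 0 w₀ hw₀
    induction N with
    | zero => simpa using h0
    | succ N ih =>
      rw [Finset.sum_range_succ]
      exact D.add_mem _ ih _ (D.smul_mem _ _ (D.pow_mem hw₀ N))
  · rw [P.map_tsum hsum]
    refine tsum_congr fun j => ?_
    rw [ha]
    simp only [map_smul, D.proj_pow hP, hPw₀]
  · conv_lhs => rw [hsum.tsum_eq_zero_add]
    congr 1
    · simp [ha]
    · rw [D.L.map_tsum hsum, ← tsum_const_smul'' _]
      refine tsum_congr fun j => ?_
      rw [ha]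
      simp only [map_smul, smul_smul]
      rw [pow_succ' D.L, mul_apply_eq_comp, pow_succ' _ (j + 1)]
      push_cast
      rfl

end TransferModel

end Model

/-! ### The rank of the projection bounds the number of disjoint rigid sets -/

section

variable {Y : Type*} [TopologicalSpace Y] [MeasurableSpace Y]
  [TopologicalSpace.PseudoMetrizableSpace Y] [BorelSpace Y]
  {H : Type*} [NormedAddCommGroup H] [NormedSpace ℂ H]
  {T : Y → Y} {S : Set (Y → ℝ)}

theorem IsTestClass.abs_integral_mul_sub_le (hS : IsTestClass S) {ν : Measure Y} [IsFiniteMeasure ν]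
    {g f : Y → ℝ} (hg : g ∈ S) (hfm : Measurable f) (hf : ∀ y, f y ∈ Icc (0 : ℝ) 1) {A : Set Y}
    (hA : MeasurableSet A) {ε : ℝ} (h : ∫ y, |g y - A.indicator 1 y| ∂ν ≤ ε) :
    |∫ y, g y * f y ∂ν - ∫ y in A, f y ∂ν| ≤ ε := by
  have := integral_indicator_sub_le hfm hf (hS.measurable hg) (hS.mem_Icc g hg) hA h
  simpa only [mul_comm] using this

namespace TransferModel

variable (D : TransferModel T S H) (hS : IsTestClass S) (hT : Measurable T)
  {P : H →L[ℂ] H} {n : ℕ → ℕ} {B C ρ : ℝ} (hP : IsPeripheralProjection D.L P n B C ρ)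
include hS hT hP

/-- Replacing `g` by the indicator of `A` changes the integrals after any number of iterates by at
most `ε`. Along `n k`, one side tends to the measure of the projection and the other, by rigidity,
to the restriction to `A`. -/
theorem abs_integral_meas_proj_sub_le {g h : Y → ℝ} (hg : g ∈ S) (hh : h ∈ S) {w : H}
    (hw : w ∈ D.cone) {A : Set Y} (hA : MeasurableSet A)
    (hr : IsRigid S T n ((D.meas w).restrict A)) {ε : ℝ}
    (hε : ∫ y, |g y - A.indicator 1 y| ∂D.meas w ≤ ε) :
    |∫ y, h y ∂D.meas (P (D.mul g w)) - ∫ y in A, h y ∂D.meas w| ≤ ε := by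
  have h1 := D.weakTendsto_map_proj hT hP (D.mul_mem g hg w hw) h hh
  refine le_of_tendsto ((h1.sub (hr h hh)).abs) (.of_forall fun k => ?_)
  rw [hS.integral_map_iterate hT hh, hS.integral_map_iterate hT hh, D.integral_meas_mul hS hg hw]
  exact hS.abs_integral_mul_sub_le hg ((hS.measurable hh).comp (hT.iterate _))
    (fun y => hS.mem_Icc h hh _) hA hε

/-- With `g i` close to the indicator of `A i`, the vectors `P (D.mul (g i) w)` have pairings with
`g j` close to the measure of `A j ∩ A i`. This matrix is strictly diagonally dominant, so the
vectors are independent in the range of `P`. -/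
theorem card_rigidFamily_le {w : H} (hw : w ∈ D.cone) {p : ℕ} {A : Fin p → Set Y}
    (hA : IsRigidFamily S T n (D.meas w) A) :
    p ≤ Module.finrank ℂ (LinearMap.range (P : H →ₗ[ℂ] H)) := by
  rcases Nat.eq_zero_or_pos p with rfl | hp
  · exact Nat.zero_le _
  have : Nonempty (Fin p) := ⟨⟨0, hp⟩⟩
  have hpos : ∀ i, 0 < (D.meas w).real (A i) := fun i =>
    ENNReal.toReal_pos (hA.ne_zero i) (measure_ne_top _ _)
  obtain ⟨i₀, hi₀⟩ := Finite.exists_min fun i => (D.meas w).real (A i)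
  -- With this choice the at most `p` off-diagonal entries of a row, each at most `2 * ε`, add up to
  -- less than the diagonal entry, which is at least `(4 * (p + 1) - 2) * ε`.
  set ε : ℝ := (D.meas w).real (A i₀) / (4 * (p + 1)) with hε
  have hε0 : 0 < ε := div_pos (hpos i₀) (by positivity)
  have happ : ∀ i, ∃ g ∈ S, ∫ y, |g y - (A i).indicator 1 y| ∂D.meas w ≤ ε := fun i =>
    hS.exists_approx (D.meas w) (hA.measurableSet i) hε0
  choose g hg hgA using happ
  have hest : ∀ i j, |∫ y, g j y ∂D.meas (P (D.mul (g i) w)) - (D.meas w).real (A j ∩ A i)| ≤ 2 * ε := by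
    intro i j
    have h1 := abs_le.1 (D.abs_integral_meas_proj_sub_le hS hT hP (hg i) (hg j) hw (hA.measurableSet i)
      (hA.rigid i) (hgA i))
    have h2 : |∫ y in A i, g j y ∂D.meas w - (D.meas w).real (A j ∩ A i)| ≤ ε := by
      have i1 : Integrable ((A j).indicator (1 : Y → ℝ)) (D.meas w) :=
        (integrable_const (1 : ℝ)).indicator (hA.measurableSet j)
      have ii : Integrable (fun y => g j y - (A j).indicator (1 : Y → ℝ) y) (D.meas w) :=
        (hS.integrable (hg j) _).sub i1
      have e : (D.meas w).real (A j ∩ A i) = ∫ y in A i, (A j).indicator (1 : Y → ℝ) y ∂D.meas w := by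
        rw [integral_indicator_one (hA.measurableSet j), measureReal_restrict_apply (hA.measurableSet j)]
      rw [e, ← integral_sub (hS.integrable (hg j) _) i1.restrict]
      refine abs_integral_le_integral_abs.trans (le_trans ?_ (hgA j))
      exact integral_mono_measure Measure.restrict_le_self (.of_forall fun y => abs_nonneg _) ii.abs
    rw [abs_le] at h2 ⊢
    constructor <;> linarith [h1.1, h1.2, h2.1, h2.2]
  set M : Matrix (Fin p) (Fin p) ℝ := fun i j => ∫ y, g j y ∂D.meas (P (D.mul (g i) w)) with hM
  have hdet : M.det ≠ 0 := by
    refine det_ne_zero_of_sum_row_lt_diag fun i => ?_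
    have hoff : ∀ j ∈ Finset.univ.erase i, ‖M i j‖ ≤ 2 * ε := fun j hj => by
      have := hest i j
      rw [(hA.disjoint (Finset.ne_of_mem_erase hj)).inter_eq] at this
      simpa [hM] using this
    have hdiag : (D.meas w).real (A i₀) - 2 * ε ≤ ‖M i i‖ := by
      have := (abs_le.1 (hest i i)).1
      rw [inter_self] at this
      refine le_trans ?_ (Real.le_norm_self _)
      linarith [hi₀ i]
    refine (Finset.sum_le_card_nsmul _ _ _ hoff).trans_lt (lt_of_lt_of_le ?_ hdiag)
    rw [Finset.card_erase_of_mem (Finset.mem_univ i), Finset.card_univ, Fintype.card_fin, nsmul_eq_mul]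
    have e : (D.meas w).real (A i₀) = ε * (4 * (p + 1)) := by rw [hε]; field_simp
    have hp1 : ((p - 1 : ℕ) : ℝ) ≤ p := by exact_mod_cast Nat.sub_le p 1
    rw [e]
    nlinarith
  have hdetC : (M.map (fun x : ℝ => (x : ℂ))).det ≠ 0 := by
    have : (M.map (fun x : ℝ => (x : ℂ))).det = ((M.det : ℝ) : ℂ) :=
      (RingHom.map_det Complex.ofRealHom M).symm
    rw [this]
    exact_mod_cast hdet
  have := hP.finiteDimensional
  have hli : LinearIndependent ℂ (fun i => (⟨P (D.mul (g i) w), ⟨_, rfl⟩⟩ :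
      LinearMap.range (P : H →ₗ[ℂ] H))) := by
    rw [Fintype.linearIndependent_iff]
    intro c hc i
    have hc' : ∑ i, c i • P (D.mul (g i) w) = 0 := by
      have := congrArg Subtype.val hc
      simpa using this
    have hv : Matrix.vecMul c (M.map (fun x : ℝ => (x : ℂ))) = 0 := by
      ext j
      have := congrArg (D.pair (g j)) hc'
      rw [map_sum, map_zero] at this
      rw [Pi.zero_apply, ← this]
      simp only [Matrix.vecMul, dotProduct, Matrix.map_apply, map_smul, smul_eq_mul]
      refine Finset.sum_congr rfl fun i _ => ?_
      rw [D.pair_eq (g j) (hg j) _ (D.proj_mem hP (D.mul_mem _ (hg i) w hw))]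
    exact congrFun (Matrix.eq_zero_of_vecMul_eq_zero hdetC hv) i
  simpa using hli.fintype_card_le_finrank

end TransferModel

end

/-! ### Convergence along multiples of the period -/

section

variable {Y : Type*} [TopologicalSpace Y] [MeasurableSpace Y]
  [TopologicalSpace.PseudoMetrizableSpace Y] [BorelSpace Y]
  {H : Type*} [NormedAddCommGroup H] [NormedSpace ℂ H]
  {T : Y → Y} {S : Set (Y → ℝ)}

namespace IsCyclicDecomposition

variable {n : ℕ → ℕ} {lam : Measure Y} [IsFiniteMeasure lam] {p : ℕ} {A : Fin p → Set Y}
  {q : Fin p → Measure Y} {σ : Fin p → Fin p} {K : ℕ} (hc : IsCyclicDecomposition S T n lam A q σ K)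
include hc

theorem map_iterate_eq (hT : Measurable T) (m : ℕ) (i : Fin p) : (q i).map T^[m] = q (σ^[m] i) := by
  induction m generalizing i with
  | zero => simp
  | succ m ih =>
    rw [Function.iterate_succ, Function.iterate_succ, ← Measure.map_map (hT.iterate m) hT, hc.map_eq, ih]
    rfl

theorem iterate_mul_eq (m : ℕ) : σ^[K * m] = id := by
  rw [Function.iterate_mul, hc.iterate_eq, Function.iterate_id]

theorem map_iterate_mul_eq (hT : Measurable T) (m : ℕ) (i : Fin p) : (q i).map T^[K * m] = q i := by
  rw [hc.map_iterate_eq hT, hc.iterate_mul_eq]; rfl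

theorem apply_eq_zero {i j : Fin p} (hij : i ≠ j) : q i (A j) = 0 := by
  have := hc.isProbabilityMeasure i
  refine measure_mono_null (t := (A i)ᶜ) (fun y hy hy' => (hc.disjoint hij).le_bot ⟨hy', hy⟩) ?_
  rw [prob_compl_eq_zero_iff (hc.measurableSet i), hc.apply_self]

theorem absolutelyContinuous (i : Fin p) : q i ≪ lam := by
  refine Measure.AbsolutelyContinuous.mk fun s hs h0 => ?_
  have h1 : lam.restrict (A i) s = 0 := Measure.restrict_le_self.absolutelyContinuous h0
  rw [hc.restrict_eq, Measure.smul_apply, smul_eq_mul, mul_eq_zero] at h1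
  exact h1.resolve_left (hc.ne_zero i)

theorem map_iterate_mul_eq_of_isRigid (hT : Measurable T) {ν : Measure Y} [IsFiniteMeasure ν]
    (hν : ν ≪ lam) (hr : IsRigid S T n ν) (m : ℕ) : ν.map T^[K * m] = ν := by
  obtain ⟨a, rfl⟩ := hc.exists_eq_sum ν inferInstance hν hr
  have : ∀ s : Finset (Fin p), (∑ i ∈ s, a i • q i).map T^[K * m] = ∑ i ∈ s, a i • q i := by
    intro s
    induction s using Finset.induction_on with
    | empty => simp
    | insert i s hi ih =>
      rw [Finset.sum_insert hi, Measure.map_add _ _ (hT.iterate _), ih, Measure.map_smul,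
        hc.map_iterate_mul_eq hT]
  exact this _

theorem integral_sum (hS : IsTestClass S) (a : Fin p → ℝ≥0) {h : Y → ℝ} (hh : h ∈ S) :
    ∫ y, h y ∂(∑ i, a i • q i) = ∑ i, (a i : ℝ) * ∫ y, h y ∂q i := by
  have := hc.isProbabilityMeasure
  rw [integral_finsetSum_measure fun i _ => hS.integrable hh _]
  refine Finset.sum_congr rfl fun i _ => ?_
  rw [integral_smul_nnreal_measure, NNReal.smul_def, smul_eq_mul]

end IsCyclicDecomposition

namespace TransferModel

variable (D : TransferModel T S H) (hS : IsTestClass S) (hT : Measurable T)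
  {P : H →L[ℂ] H} {n : ℕ → ℕ} {B C ρ : ℝ} (hP : IsPeripheralProjection D.L P n B C ρ)
  {w : H} (hw : w ∈ D.cone) (hPw : P w = w)
  {p : ℕ} {A : Fin p → Set Y}
  {q : Fin p → Measure Y} {σ : Fin p → Fin p} {K : ℕ}
  (hc : IsCyclicDecomposition S T n (D.meas w) A q σ K)

include hS hT hP hc in
theorem meas_pow_mul_proj {v : H} (hv : v ∈ D.cone) (hac : D.meas (P v) ≪ D.meas w) (m : ℕ) :
    D.meas ((D.L ^ (K * m)) (P v)) = D.meas (P v) := by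
  rw [D.meas_pow hT (D.proj_mem hP hv)]
  exact hc.map_iterate_mul_eq_of_isRigid hT hac
    (D.isRigid_meas hT hP (D.proj_mem hP hv) (D.proj_proj hP v)) m

omit [TopologicalSpace.PseudoMetrizableSpace Y] [BorelSpace Y] in
include hP in
theorem norm_pow_sub_proj_le (v : H) (m : ℕ) :
    ‖(D.L ^ m) v - (D.L ^ m) (P v)‖ ≤ C * ρ ^ m * ‖v‖ := by
  have : (D.L ^ m) v - (D.L ^ m) (P v) = (D.L ^ m * (1 - P)) v := by
    simp
  rw [this]
  exact ((D.L ^ m * (1 - P)).le_opNorm v).trans (by gcongr; exact hP.norm_le m)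

include hS hT hP hc in
-- The `P`-component of `v` gives a rigid measure, fixed by `T^[K * m]`, and the remainder decays in
-- norm. Convergence therefore holds along all multiples of `K`, beyond the sequence `n`.
theorem weakTendsto_meas_pow_mul {v : H} (hv : v ∈ D.cone) (hac : D.meas (P v) ≪ D.meas w) :
    WeakTendsto S (fun m => (D.meas v).map T^[K * m]) (D.meas (P v)) := by
  intro h hh
  have hpv := D.proj_mem hP hv
  have e : ∀ m, ∫ y, h y ∂(D.meas v).map T^[K * m]
      = (D.pair h ((D.L ^ (K * m)) v - (D.L ^ (K * m)) (P v))).re + ∫ y, h y ∂D.meas (P v) := fun m => by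
    rw [map_sub, Complex.sub_re, D.pair_re hh (D.pow_mem hv _), D.pair_re hh (D.pow_mem hpv _),
      D.meas_pow_mul_proj hS hT hP hc hv hac, D.meas_pow hT hv]
    ring
  simp_rw [e]
  have hz : Tendsto (fun m => (D.L ^ (K * m)) v - (D.L ^ (K * m)) (P v)) atTop (𝓝 0) := by
    refine squeeze_zero_norm (fun m => D.norm_pow_sub_proj_le hP v (K * m)) ?_
    have h1 : Tendsto (fun m : ℕ => ρ ^ (K * m)) atTop (𝓝 0) :=
      (tendsto_pow_atTop_nhds_zero_of_lt_one hP.rate_nonneg hP.rate_lt_one).comp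
        (tendsto_id.const_mul_atTop' hc.pos)
    simpa using (h1.const_mul C).mul_const ‖v‖
  have h2 := (Complex.continuous_re.tendsto _).comp (((D.pair h).continuous.tendsto 0).comp hz)
  simpa [Function.comp_def] using h2.add_const (∫ y, h y ∂D.meas (P v))

include hS hT hP hw hPw hc in
-- Indicators are approximated in `L¹` by test functions, uniformly in the number of iterates. The
-- limits for the approximations have coefficients bounded by the total mass, so a subsequence of
-- coefficients converges.
theorem exists_weakTendsto_restrict {E : Set Y} (hE : MeasurableSet E) :
    ∃ a : Fin p → ℝ≥0, WeakTendsto S (fun m => ((D.meas w).restrict E).map T^[K * m]) (∑ i, a i • q i) := by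
  have hqp := hc.isProbabilityMeasure
  have happ : ∀ j : ℕ, ∃ g ∈ S, ∫ y, |g y - E.indicator 1 y| ∂D.meas w ≤ 1 / ((j : ℝ) + 1) := fun j =>
    hS.exists_approx (D.meas w) hE (by positivity)
  choose g hg hgE using happ
  have hgw : ∀ j, D.mul (g j) w ∈ D.cone := fun j => D.mul_mem _ (hg j) w hw
  have hle : ∀ j, D.meas (P (D.mul (g j) w)) ≤ D.meas w := fun j => by
    have := D.meas_proj_mul_le hS hT hP (hg j) hw
    rwa [hPw] at this
  have hex : ∀ j, ∃ a : Fin p → ℝ≥0, D.meas (P (D.mul (g j) w)) = ∑ i, a i • q i := fun j =>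
    hc.exists_eq_sum _ inferInstance (hle j).absolutelyContinuous
      (D.isRigid_meas hT hP (D.proj_mem hP (hgw j)) (D.proj_proj hP _))
  choose a ha using hex
  set M : ℝ≥0 := (D.meas w univ).toNNReal with hM
  have hbd : ∀ j, a j ∈ Icc (0 : Fin p → ℝ≥0) (fun _ => M) := fun j => by
    refine ⟨fun i => (a j i).2, fun i => ?_⟩
    have h1 : ((a j i : ℝ≥0) : ℝ≥0∞) ≤ D.meas w univ := by
      calc ((a j i : ℝ≥0) : ℝ≥0∞) = (a j i • q i) univ := by
            rw [Measure.smul_apply, measure_univ]; simp [ENNReal.smul_def]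
        _ ≤ (∑ i, a j i • q i) univ := by
            rw [Measure.finsetSum_apply]
            exact Finset.single_le_sum (f := fun i => (a j i • q i) univ) (fun i _ => zero_le) (Finset.mem_univ i)
        _ = D.meas (P (D.mul (g j) w)) univ := by rw [ha]
        _ ≤ _ := hle j univ
    rw [← ENNReal.coe_le_coe, hM, ENNReal.coe_toNNReal (measure_ne_top _ _)]
    exact h1
  obtain ⟨b, -, φ, hφ, hb⟩ := isCompact_Icc.tendsto_subseq hbd
  refine ⟨b, fun h hh => ?_⟩
  rw [hc.integral_sum hS b hh]
  have hlim : Tendsto (fun j => ∑ i, (a (φ j) i : ℝ) * ∫ y, h y ∂q i) atTop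
      (𝓝 (∑ i, (b i : ℝ) * ∫ y, h y ∂q i)) :=
    tendsto_finsetSum _ fun i _ =>
      ((NNReal.tendsto_coe.2 ((tendsto_pi_nhds.1 hb) i)).mul_const _)
  rw [Metric.tendsto_nhds]
  intro ε hε
  have h3 : ∀ᶠ j : ℕ in atTop, 1 / ((φ j : ℝ) + 1) < ε / 3 :=
    (tendsto_one_div_add_atTop_nhds_zero_nat.comp hφ.tendsto_atTop).eventually_lt_const (by positivity)
  obtain ⟨j, hj1, hj2⟩ := (h3.and ((Metric.tendsto_nhds.1 hlim) (ε / 3) (by positivity))).exists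
  have h4 := D.weakTendsto_meas_pow_mul hS hT hP hc (hgw (φ j)) (hle (φ j)).absolutelyContinuous h hh
  rw [ha, hc.integral_sum hS _ hh] at h4
  filter_upwards [(Metric.tendsto_nhds.1 h4) (ε / 3) (by positivity)] with m hm
  have h5 : dist (∫ y, h y ∂((D.meas w).restrict E).map T^[K * m])
      (∫ y, h y ∂(D.meas (D.mul (g (φ j)) w)).map T^[K * m]) ≤ 1 / ((φ j : ℝ) + 1) := by
    rw [dist_comm, Real.dist_eq, hS.integral_map_iterate hT hh, hS.integral_map_iterate hT hh,
      D.integral_meas_mul hS (hg _) hw]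
    exact hS.abs_integral_mul_sub_le (hg _) ((hS.measurable hh).comp (hT.iterate _))
      (fun y => hS.mem_Icc h hh _) hE (hgE _)
  calc _ ≤ _ := dist_triangle4 _ _ _ _
    _ < ε / 3 + ε / 3 + ε / 3 := by
        refine add_lt_add (add_lt_add_of_le_of_lt (h5.trans hj1.le) hm) hj2
    _ = ε := by ring

include hS hT hP hw hPw hc in
-- Since the restriction of the reference measure to `A i` is invariant under `T^[K]`, it dominates
-- the limit obtained from `E ∩ A i`. The limit is thus a multiple of `q i`, and conservation of
-- mass fixes the factor.
theorem tendsto_integral_restrict (i : Fin p) {E : Set Y} (hE : MeasurableSet E) {h : Y → ℝ} (hh : h ∈ S) :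
    Tendsto (fun m => ∫ y in E, h (T^[K * m] y) ∂q i) atTop (𝓝 ((q i).real E * ∫ y, h y ∂q i)) := by
  have hqp := hc.isProbabilityMeasure
  set lam := D.meas w with hlam
  have hEA := hE.inter (hc.measurableSet i)
  obtain ⟨a, ha⟩ := D.exists_weakTendsto_restrict hS hT hP hw hPw hc hEA
  have hle : ∑ j, a j • q j ≤ lam.restrict (A i) := by
    refine hS.measure_le_of_forall_integral_le fun g hg => le_of_tendsto (ha g hg) (.of_forall fun m => ?_)
    have e : (lam.restrict (A i)).map T^[K * m] = lam.restrict (A i) := by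
      rw [hc.restrict_eq, Measure.map_smul, hc.map_iterate_mul_eq hT]
    rw [← e]
    exact integral_mono_measure (Measure.map_mono (Measure.restrict_mono_set _ inter_subset_right)
      (hT.iterate _)) (.of_forall fun y => (hS.mem_Icc g hg y).1) (hS.integrable hg _)
  have ha0 : ∀ j, j ≠ i → a j = 0 := fun j hj => by
    have h1 := hle (A j)
    rw [hc.restrict_eq, Measure.smul_apply, hc.apply_eq_zero hj.symm, smul_zero, Measure.finsetSum_apply] at h1
    have h2 := (Finset.sum_eq_zero_iff.1 (le_antisymm h1 zero_le)) j (Finset.mem_univ j)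
    rw [Measure.smul_apply, hc.apply_self, ENNReal.smul_def, smul_eq_mul, mul_one] at h2
    exact ENNReal.coe_eq_zero.1 h2
  have hsum : ∑ j, a j • q j = a i • q i :=
    Finset.sum_eq_single i (fun j _ hj => by rw [ha0 j hj, zero_smul]) (by simp)
  rw [hsum] at ha
  have hmass : (a i : ℝ) = lam.real (E ∩ A i) := by
    have h1 := ha.tendsto_real_univ hS
    simp only [map_real_univ hT] at h1
    have h2 := tendsto_nhds_unique h1 tendsto_const_nhds
    rw [measureReal_restrict_apply MeasurableSet.univ, univ_inter] at h2
    rw [← h2, measureReal_nnreal_smul_apply]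
    simp
  have hpos : 0 < lam.real (A i) := ENNReal.toReal_pos (hc.ne_zero i) (measure_ne_top _ _)
  have hq : ∀ F : Set Y, MeasurableSet F → (lam.restrict (E ∩ A i)) F
      = lam (A i) * (q i).restrict E F := fun F hF => by
    rw [Measure.restrict_apply hF, Measure.restrict_apply hF, ← smul_eq_mul, ← Measure.smul_apply,
      ← hc.restrict_eq, Measure.restrict_apply (hF.inter hE), inter_assoc]
  have hq' : lam.restrict (E ∩ A i) = lam (A i) • (q i).restrict E := by
    ext F hF
    rw [hq F hF]; rfl
  have hqE : lam.real (E ∩ A i) = lam.real (A i) * (q i).real E := by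
    have := congrArg ENNReal.toReal (hq univ MeasurableSet.univ)
    rw [ENNReal.toReal_mul, Measure.restrict_apply_univ, Measure.restrict_apply_univ] at this
    exact this
  have h1 := (ha h hh).const_mul (lam.real (A i))⁻¹
  have e1 : ∀ m, (lam.real (A i))⁻¹ * ∫ y, h y ∂(lam.restrict (E ∩ A i)).map T^[K * m]
      = ∫ y in E, h (T^[K * m] y) ∂q i := fun m => by
    rw [hS.integral_map_iterate hT hh, hq', integral_smul_measure, smul_eq_mul]
    exact inv_mul_cancel_left₀ hpos.ne' _
  have e2 : (lam.real (A i))⁻¹ * ∫ y, h y ∂(a i • q i) = (q i).real E * ∫ y, h y ∂q i := by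
    rw [integral_smul_nnreal_measure, NNReal.smul_def, smul_eq_mul, hmass, hqE, mul_assoc,
      inv_mul_cancel_left₀ hpos.ne']
  rw [e2] at h1
  exact h1.congr e1

end TransferModel

end

/-! ### Mixing from test functions -/

section Mixing

theorem IsMixing.ergodic {Y : Type*} [MeasurableSpace Y] {F : Y → Y} {ν : Measure Y}
    [IsProbabilityMeasure ν] (h : IsMixing F ν) : Ergodic F ν where
  toMeasurePreserving := h.1
  aeconst_set := fun B hB hFB => by
    have h1 : ∀ m : ℕ, F^[m] ⁻¹' B = B := fun m => by
      rw [preimage_iterate_eq]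
      exact Function.iterate_fixed hFB m
    have h2 := h.2 B B hB hB
    simp only [h1, inter_self] at h2
    have h3 : ν B = ν B * ν B := tendsto_nhds_unique tendsto_const_nhds h2
    rw [eventuallyConst_set']
    rcases eq_or_ne (ν B) 0 with h0 | h0
    · exact Or.inl (ae_eq_empty.2 h0)
    · refine Or.inr ?_
      have h4 : ν B = 1 := by
        have := (ENNReal.mul_right_inj h0 (measure_ne_top _ _) (b := 1) (c := ν B)).1 (by rw [mul_one]; exact h3)
        exact this.symm
      exact eventuallyEq_univ.2 ((mem_ae_iff_prob_eq_one hB).2 h4)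

variable {Y : Type*} [TopologicalSpace Y] [MeasurableSpace Y]
  [TopologicalSpace.PseudoMetrizableSpace Y] [BorelSpace Y] {S : Set (Y → ℝ)} (hS : IsTestClass S)
include hS

theorem IsTestClass.isMixing {F : Y → Y} {ν : Measure Y} [IsProbabilityMeasure ν]
    (hF : MeasurePreserving F ν ν)
    (h : ∀ E, MeasurableSet E → ∀ g ∈ S,
      Tendsto (fun m => ∫ y in E, g (F^[m] y) ∂ν) atTop (𝓝 (ν.real E * ∫ y, g y ∂ν))) :
    IsMixing F ν := by
  refine ⟨hF, fun A B hA hB => ?_⟩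
  have key : Tendsto (fun m : ℕ => ν.real (A ∩ F^[m] ⁻¹' B)) atTop (𝓝 (ν.real A * ν.real B)) := by
    rw [Metric.tendsto_nhds]
    intro ε hε
    obtain ⟨g, hg, hgB⟩ := hS.exists_approx ν hB (ε := ε / 4) (by positivity)
    have hgm := hS.measurable hg
    have i1 : Integrable (B.indicator (1 : Y → ℝ)) ν := (integrable_const (1 : ℝ)).indicator hB
    have ii : Integrable (fun y => |g y - B.indicator (1 : Y → ℝ) y|) ν :=
      ((hS.integrable hg _).sub i1).abs
    have h1 : ∀ m, |∫ y in A, g (F^[m] y) ∂ν - ν.real (A ∩ F^[m] ⁻¹' B)| ≤ ε / 4 := fun m => by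
      have hFm := hF.iterate m
      have e : ν.real (A ∩ F^[m] ⁻¹' B) = ∫ y in A, B.indicator (1 : Y → ℝ) (F^[m] y) ∂ν := by
        have : (fun y => B.indicator (1 : Y → ℝ) (F^[m] y)) = (F^[m] ⁻¹' B).indicator 1 := rfl
        rw [this, integral_indicator_one (hFm.measurable hB),
          measureReal_restrict_apply (hFm.measurable hB), inter_comm]
      have j1 : Integrable (fun y => g (F^[m] y)) ν := hFm.integrable_comp_of_integrable (hS.integrable hg _)
      have j2 : Integrable (fun y => B.indicator (1 : Y → ℝ) (F^[m] y)) ν :=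
        hFm.integrable_comp_of_integrable i1
      rw [e, ← integral_sub j1.restrict j2.restrict]
      refine abs_integral_le_integral_abs.trans (le_trans ?_ hgB)
      refine (integral_mono_measure Measure.restrict_le_self (.of_forall fun y => abs_nonneg _)
        (j1.sub j2).abs).trans (le_of_eq ?_)
      have := integral_map (μ := ν) hFm.measurable.aemeasurable
        (f := fun y => |g y - B.indicator (1 : Y → ℝ) y|) (by rw [hFm.map_eq]; exact ii.1)
      rw [hFm.map_eq] at this
      exact this.symm
    have h2 : |ν.real A * ∫ y, g y ∂ν - ν.real A * ν.real B| ≤ ε / 4 := by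
      have e : |∫ y, g y ∂ν - ν.real B| ≤ ε / 4 := by
        rw [← integral_indicator_one hB, ← integral_sub (hS.integrable hg _) i1]
        exact abs_integral_le_integral_abs.trans hgB
      rw [← mul_sub, abs_mul, abs_of_nonneg measureReal_nonneg]
      exact (mul_le_of_le_one_left (abs_nonneg _) measureReal_le_one).trans e
    filter_upwards [(Metric.tendsto_nhds.1 (h A hA g hg)) (ε / 4) (by positivity)] with m hm
    rw [Real.dist_eq] at hm ⊢
    have h1' := abs_le.1 (h1 m)
    have h2' := abs_le.1 h2
    have hm' := abs_lt.1 hm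
    rw [abs_lt]
    constructor <;> linarith [h1'.1, h1'.2, h2'.1, h2'.2, hm'.1, hm'.2]
  rw [← ENNReal.tendsto_toReal_iff (fun _ => measure_ne_top _ _)
    (ENNReal.mul_ne_top (measure_ne_top _ _) (measure_ne_top _ _)), ENNReal.toReal_mul]
  exact key

end Mixing

/-! ### Basins of attraction -/

section Basin

variable {Y : Type*} [MeasurableSpace Y]

/-- The points along whose orbits the averages of the functions of `S` converge to their integrals
with respect to `ν`. -/
def basin (S : Set (Y → ℝ)) (F : Y → Y) (ν : Measure Y) : Set Y :=
  {x | ∀ g ∈ S, Tendsto (fun n => orbitAverage F g n x) atTop (𝓝 (∫ y, g y ∂ν))}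

/-- The empirical measure of the first `n` points of the orbit of `x`. -/
def empiricalMeasure (F : Y → Y) (x : Y) (n : ℕ) : Measure Y :=
  (n : ℝ≥0)⁻¹ • ∑ i ∈ Finset.range n, Measure.dirac (F^[i] x)

instance (F : Y → Y) (x : Y) (n : ℕ) : IsFiniteMeasure (empiricalMeasure F x n) := by
  unfold empiricalMeasure; infer_instance

theorem integral_empiricalMeasure (F : Y → Y) (x : Y) (n : ℕ) {f : Y → ℝ} (hf : Measurable f) :
    ∫ y, f y ∂empiricalMeasure F x n = orbitAverage F f n x := by
  have hi : ∀ z, Integrable f (Measure.dirac z) := fun z =>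
    integrable_dirac' hf.stronglyMeasurable (by simp)
  rw [empiricalMeasure, integral_smul_nnreal_measure, integral_finsetSum_measure fun i _ => hi _,
    orbitAverage, NNReal.smul_def, smul_eq_mul, div_eq_inv_mul]
  simp only [integral_dirac' _ _ hf.stronglyMeasurable]
  simp

/-- The orbit of `F` splits into `K` orbits of `F^[K]`. The incomplete last block has at most `K`
terms and is negligible after division by `N`. -/
theorem tendsto_orbitAverage_of_residues {F : Y → Y} {f : Y → ℝ} (hf : ∀ y, f y ∈ Icc (0 : ℝ) 1) {K : ℕ}
    (hK : 0 < K) {x : Y} {a : ℕ → ℝ}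
    (h : ∀ r < K, Tendsto (fun n => orbitAverage F^[K] (fun y => f (F^[r] y)) n x) atTop (𝓝 (a r))) :
    Tendsto (fun n => orbitAverage F f n x) atTop (𝓝 ((K : ℝ)⁻¹ * ∑ r ∈ Finset.range K, a r)) := by
  have hKR : (0 : ℝ) < K := by exact_mod_cast hK
  have hdiv : Tendsto (fun N : ℕ => N / K) atTop atTop := Nat.tendsto_div_const_atTop hK.ne'
  have hsum : ∀ n, ∑ i ∈ Finset.range (K * n), f (F^[i] x)
      = n * ∑ r ∈ Finset.range K, orbitAverage F^[K] (fun y => f (F^[r] y)) n x := by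
    intro n
    have e : ∑ i ∈ Finset.range (K * n), f (F^[i] x)
        = ∑ i ∈ Finset.range n, ∑ r ∈ Finset.range K, f (F^[K * i + r] x) := by
      induction n with
      | zero => simp
      | succ n ih => rw [Nat.mul_succ, Finset.sum_range_add, ih, Finset.sum_range_succ]
    rw [e, Finset.sum_comm, Finset.mul_sum]
    refine Finset.sum_congr rfl fun r _ => ?_
    rcases Nat.eq_zero_or_pos n with rfl | hn
    · simp
    · have : (n : ℝ) ≠ 0 := by exact_mod_cast hn.ne'
      rw [orbitAverage, mul_div_cancel₀ _ this]
      refine Finset.sum_congr rfl fun i _ => ?_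
      rw [← Function.iterate_mul, ← Function.iterate_add_apply, add_comm]
  have hratio : Tendsto (fun N : ℕ => ((N / K : ℕ) : ℝ) / N) atTop (𝓝 (K : ℝ)⁻¹) := by
    have h1 : Tendsto (fun N : ℕ => (K : ℝ)⁻¹ - 1 / (N : ℝ)) atTop (𝓝 (K : ℝ)⁻¹) := by
      simpa using (tendsto_const_nhds (x := (K : ℝ)⁻¹)).sub (tendsto_one_div_atTop_nhds_zero_nat (𝕜 := ℝ))
    refine tendsto_of_tendsto_of_tendsto_of_le_of_le' h1 tendsto_const_nhds ?_ ?_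
    · filter_upwards [eventually_gt_atTop 0] with N hN
      have hNR : (0 : ℝ) < N := by exact_mod_cast hN
      have h2 : (N : ℝ) ≤ K * ((N / K : ℕ) : ℝ) + K := by
        have := Nat.div_add_mod N K
        have h3 := (Nat.mod_lt N hK).le
        exact_mod_cast (by omega : N ≤ K * (N / K) + K)
      rw [le_div_iff₀ hNR, sub_mul, one_div_mul_cancel hNR.ne', inv_mul_eq_div, sub_le_iff_le_add,
        div_le_iff₀ hKR]
      linarith
    · filter_upwards [eventually_gt_atTop 0] with N hN
      have hNR : (0 : ℝ) < N := by exact_mod_cast hN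
      rw [div_le_iff₀ hNR, inv_mul_eq_div, le_div_iff₀ hKR]
      exact_mod_cast Nat.div_mul_le_self N K
  have hmain : Tendsto (fun N : ℕ => ((N / K : ℕ) : ℝ) / N *
      ∑ r ∈ Finset.range K, orbitAverage F^[K] (fun y => f (F^[r] y)) (N / K) x) atTop
      (𝓝 ((K : ℝ)⁻¹ * ∑ r ∈ Finset.range K, a r)) :=
    hratio.mul (tendsto_finsetSum _ fun r hr => (h r (Finset.mem_range.1 hr)).comp hdiv)
  have herr : Tendsto (fun N : ℕ => orbitAverage F f N x - ((N / K : ℕ) : ℝ) / N *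
      ∑ r ∈ Finset.range K, orbitAverage F^[K] (fun y => f (F^[r] y)) (N / K) x) atTop (𝓝 0) := by
    have h2 : Tendsto (fun n : ℕ => (K : ℝ) / (n : ℝ)) atTop (𝓝 0) := tendsto_const_div_atTop_nhds_zero_nat _
    refine squeeze_zero_norm (fun N => ?_) h2
    have e : orbitAverage F f N x - ((N / K : ℕ) : ℝ) / N *
        ∑ r ∈ Finset.range K, orbitAverage F^[K] (fun y => f (F^[r] y)) (N / K) x
        = (∑ i ∈ Finset.range (N % K), f (F^[K * (N / K) + i] x)) / N := by
      rw [div_mul_eq_mul_div, ← hsum, orbitAverage, ← sub_div]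
      congr 1
      conv_lhs => rw [← Nat.div_add_mod N K, Finset.sum_range_add]
      simp [Nat.mul_add_div hK, Nat.div_eq_of_lt (Nat.mod_lt N hK)]
    rw [e, Real.norm_eq_abs, abs_div, Nat.abs_cast]
    gcongr
    rw [abs_of_nonneg (Finset.sum_nonneg fun i _ => (hf _).1)]
    calc _ ≤ ∑ i ∈ Finset.range (N % K), (1 : ℝ) := Finset.sum_le_sum fun i _ => (hf _).2
      _ = (N % K : ℕ) := by simp
      _ ≤ K := by exact_mod_cast (Nat.mod_lt N hK).le
  simpa using hmain.add herr

variable [TopologicalSpace Y] [TopologicalSpace.PseudoMetrizableSpace Y] [BorelSpace Y]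
  {S : Set (Y → ℝ)} (hS : IsTestClass S) {F : Y → Y} {ν : Measure Y}
include hS

theorem mem_basin_of_dense [IsProbabilityMeasure ν] {S' : Set (Y → ℝ)} (hS' : S' ⊆ S)
    (hd : ∀ g ∈ S, ∀ ε > 0, ∃ g' ∈ S', ∀ y, |g y - g' y| ≤ ε) {x : Y}
    (h : ∀ g ∈ S', Tendsto (fun n => orbitAverage F g n x) atTop (𝓝 (∫ y, g y ∂ν))) :
    x ∈ basin S F ν := by
  intro g hg
  rw [Metric.tendsto_nhds]
  intro ε hε
  obtain ⟨g', hg', hgg⟩ := hd g hg (ε / 4) (by positivity)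
  have h1 : ∀ n, |orbitAverage F g n x - orbitAverage F g' n x| ≤ ε / 4 := fun n => by
    rw [orbitAverage, orbitAverage, ← sub_div, ← Finset.sum_sub_distrib, abs_div, Nat.abs_cast]
    rcases Nat.eq_zero_or_pos n with rfl | hn
    · simp; positivity
    · rw [div_le_iff₀ (by exact_mod_cast hn)]
      calc _ ≤ ∑ i ∈ Finset.range n, ε / 4 :=
            (Finset.abs_sum_le_sum_abs _ _).trans (Finset.sum_le_sum fun i _ => hgg _)
        _ = ε / 4 * n := by simp [mul_comm]
  have h2 : |∫ y, g y ∂ν - ∫ y, g' y ∂ν| ≤ ε / 4 := by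
    rw [← integral_sub (hS.integrable hg _) (hS.integrable (hS' hg') _)]
    refine abs_integral_le_integral_abs.trans ?_
    calc _ ≤ ∫ y, ε / 4 ∂ν := integral_mono
            ((hS.integrable hg _).sub (hS.integrable (hS' hg') _)).abs (integrable_const _) hgg
      _ = ε / 4 := by simp
  filter_upwards [(Metric.tendsto_nhds.1 (h g' hg')) (ε / 4) (by positivity)] with n hn
  rw [Real.dist_eq] at hn ⊢
  have h1' := abs_le.1 (h1 n)
  have h2' := abs_le.1 h2
  have hn' := abs_lt.1 hn
  rw [abs_lt]
  constructor <;> linarith [h1'.1, h1'.2, h2'.1, h2'.2, hn'.1, hn'.2]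

theorem measurableSet_basin [IsProbabilityMeasure ν] (hF : Measurable F) :
    MeasurableSet (basin S F ν) := by
  obtain ⟨S', hS', hc, hd⟩ := hS.exists_countable
  have : basin S F ν
      = ⋂ g ∈ S', {x | Tendsto (fun n => orbitAverage F g n x) atTop (𝓝 (∫ y, g y ∂ν))} := by
    ext x
    simp only [mem_iInter, mem_ofPred_eq]
    exact ⟨fun h g hg => h g (hS' hg), fun h => mem_basin_of_dense hS hS' hd h⟩
  rw [this]
  exact MeasurableSet.biInter hc fun g hg =>
    measurableSet_tendsto _ fun n => measurable_orbitAverage hF (hS.measurable (hS' hg)) n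

theorem preimage_basin : F ⁻¹' basin S F ν = basin S F ν := by
  ext x
  exact forall₂_congr fun g hg => tendsto_orbitAverage_apply_iff (hS.mem_Icc g hg)

theorem disjoint_basin {ν' : Measure Y} [IsFiniteMeasure ν] [IsFiniteMeasure ν'] (h : ν ≠ ν') :
    Disjoint (basin S F ν) (basin S F ν') :=
  Set.disjoint_left.2 fun _ hx hx' =>
    h (hS.measure_ext fun g hg => tendsto_nhds_unique (hx g hg) (hx' g hg))

/-- For a point of the basin the empirical measures converge weakly to `ν`, so the averages converge
for every bounded measurable function that is continuous almost everywhere. -/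
theorem tendsto_orbitAverage_of_mem_basin [IsFiniteMeasure ν] {x : Y} (hx : x ∈ basin S F ν)
    {f : Y → ℝ} (hfm : Measurable f) {M : ℝ} (hf : ∀ y, |f y| ≤ M) (hc : ∀ᵐ y ∂ν, ContinuousAt f y) :
    Tendsto (fun n => orbitAverage F f n x) atTop (𝓝 (∫ y, f y ∂ν)) := by
  have h : WeakTendsto S (empiricalMeasure F x) ν := fun g hg => by
    simpa only [integral_empiricalMeasure F x _ (hS.measurable hg)] using hx g hg
  simpa only [integral_empiricalMeasure F x _ hfm] using h.tendsto_integral hS hfm hf hc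

/-- An ergodic measure is carried by its basin as soon as the averages converge. -/
theorem measure_compl_basin [IsProbabilityMeasure ν] (hF : Ergodic F ν)
    (h : ∀ g ∈ S, ∀ᵐ x ∂ν, Tendsto (fun n => orbitAverage F g n x) atTop (𝓝 (orbitLimit F g x))) :
    ν (basin S F ν)ᶜ = 0 := by
  obtain ⟨S', hS', hc, hd⟩ := hS.exists_countable
  have hFm := hF.measurable
  have key : ∀ g ∈ S, ∀ᵐ x ∂ν, Tendsto (fun n => orbitAverage F g n x) atTop (𝓝 (∫ y, g y ∂ν)) := by
    intro g hg
    have hgm := hS.measurable hg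
    -- The limiting average is invariant, hence constant by ergodicity. Dominated convergence and
    -- invariance of `ν` identify the constant with the integral of `g`.
    have hinv : orbitLimit F g ∘ F =ᵐ[ν] orbitLimit F g := by
      filter_upwards [h g hg, hF.toMeasurePreserving.quasiMeasurePreserving.ae (h g hg)] with x hx hx'
      exact tendsto_nhds_unique ((tendsto_orbitAverage_apply_iff (hS.mem_Icc g hg)).1 hx') hx
    obtain ⟨c, hcx⟩ := hF.ae_eq_const_of_ae_eq_comp_ae
      (measurable_orbitLimit hFm hgm).aestronglyMeasurable hinv
    have hlim : Tendsto (fun n => ∫ x, orbitAverage F g n x ∂ν) atTop (𝓝 (∫ x, c ∂ν)) := by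
      refine tendsto_integral_of_dominated_convergence (fun _ => 1)
        (fun n => (measurable_orbitAverage hFm hgm n).aestronglyMeasurable) (integrable_const _)
        (fun n => .of_forall fun x => ?_) ?_
      · have := orbitAverage_mem_Icc (F := F) (hS.mem_Icc g hg) n x
        rw [Real.norm_eq_abs, abs_of_nonneg this.1]
        exact this.2
      · filter_upwards [h g hg, hcx] with x hx hx'
        rw [hx'] at hx
        exact hx
    have hconst : ∀ᶠ n : ℕ in atTop, ∫ x, orbitAverage F g n x ∂ν = ∫ y, g y ∂ν := by
      filter_upwards [eventually_gt_atTop 0] with n hn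
      have hn' : (n : ℝ) ≠ 0 := by exact_mod_cast hn.ne'
      simp only [orbitAverage]
      have hi : ∀ i ∈ Finset.range n, Integrable (fun x => g (F^[i] x)) ν := fun i _ =>
        (hF.iterate i).integrable_comp_of_integrable (hS.integrable hg _)
      rw [integral_div, integral_finsetSum _ hi]
      have : ∀ i, ∫ x, g (F^[i] x) ∂ν = ∫ y, g y ∂ν := fun i => by
        rw [← hS.integral_map_iterate hFm hg, (hF.iterate i).map_eq]
      simp only [this, Finset.sum_const, Finset.card_range, nsmul_eq_mul]
      exact mul_div_cancel_left₀ _ hn'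
    have hc' : c = ∫ y, g y ∂ν := by
      have := tendsto_nhds_unique (hlim.congr' hconst) tendsto_const_nhds
      simpa using this
    filter_upwards [h g hg, hcx] with x hx hx'
    rw [hx'] at hx
    rw [← hc']
    exact hx
  have : ∀ᵐ x ∂ν, x ∈ basin S F ν := by
    have h2 := (ae_ball_iff hc).2 fun g hg => key g (hS' hg)
    filter_upwards [h2] with x hx
    exact mem_basin_of_dense hS hS' hd hx
  exact this

end Basin

/-! ### From mixing cycles to physical measures -/

section Cycles

variable {Y : Type*} [MeasurableSpace Y]

/-- Finitely many probability measures, permuted by `T`, that are mixing for `T^[K]`. -/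
structure IsMixingCycle (T : Y → Y) {p : ℕ} (q : Fin p → Measure Y) (σ : Fin p → Fin p) (K : ℕ) :
    Prop where
  measurable : Measurable T
  pos : 0 < K
  iterate_eq : σ^[K] = id
  isProbabilityMeasure : ∀ i, IsProbabilityMeasure (q i)
  map_eq : ∀ i, (q i).map T = q (σ i)
  isMixing : ∀ i, IsMixing T^[K] (q i)

/-- The average of the measures `q i` along the cycle of `j`. -/
def cyclicMean {p : ℕ} (q : Fin p → Measure Y) (σ : Fin p → Fin p) (K : ℕ) (j : Fin p) : Measure Y :=
  Measure.sum fun s : ZMod K => (K : ℝ≥0∞)⁻¹ • q (σ^[s.val] j)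

namespace IsMixingCycle

variable {T : Y → Y} {p : ℕ} {q : Fin p → Measure Y} {σ : Fin p → Fin p} {K : ℕ}
  (hq : IsMixingCycle T q σ K)
include hq

theorem map_iterate_eq (m : ℕ) (i : Fin p) : (q i).map T^[m] = q (σ^[m] i) := by
  induction m generalizing i with
  | zero => simp
  | succ m ih =>
    rw [Function.iterate_succ, Function.iterate_succ,
      ← Measure.map_map (hq.measurable.iterate m) hq.measurable, hq.map_eq, ih]
    rfl

theorem iterate_mod (m : ℕ) : σ^[m % K] = σ^[m] := by
  conv_rhs => rw [← Nat.mod_add_div m K, Function.iterate_add, Function.iterate_mul, hq.iterate_eq,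
    Function.iterate_id, Function.comp_id]

theorem sum_zmod {M : Type*} [AddCommMonoid M] (f : ℕ → M) [NeZero K] :
    ∑ s : ZMod K, f s.val = ∑ r ∈ Finset.range K, f r := by
  refine Finset.sum_bij (fun s _ => s.val) (fun s _ => Finset.mem_range.2 (ZMod.val_lt s))
    (fun s _ t _ h => ZMod.val_injective K h)
    (fun r hr => ⟨(r : ZMod K), Finset.mem_univ _, ZMod.val_cast_of_lt (Finset.mem_range.1 hr)⟩)
    fun s _ => rfl

theorem cyclicMean_eq (j : Fin p) :
    cyclicMean q σ K j = (K : ℝ≥0∞)⁻¹ • ∑ r ∈ Finset.range K, q (σ^[r] j) := by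
  have : NeZero K := ⟨hq.pos.ne'⟩
  rw [cyclicMean, Measure.sum_fintype, ← Finset.smul_sum, hq.sum_zmod fun r => q (σ^[r] j)]

theorem cyclicMean_apply_of_forall {B : Set Y} {j : Fin p} {b : ℝ≥0∞} (h : ∀ r, q (σ^[r] j) B = b) :
    cyclicMean q σ K j B = b := by
  rw [hq.cyclicMean_eq, Measure.smul_apply, Measure.finsetSum_apply]
  simp only [h, Finset.sum_const, Finset.card_range, nsmul_eq_mul, smul_eq_mul]
  rw [← mul_assoc, ENNReal.inv_mul_cancel (by exact_mod_cast hq.pos.ne') (ENNReal.natCast_ne_top K),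
    one_mul]

theorem apply_iterate_of_preimage_eq {B : Set Y} (hB : MeasurableSet B) (h : T ⁻¹' B = B) (j : Fin p)
    (r : ℕ) : q (σ^[r] j) B = q j B := by
  rw [← hq.map_iterate_eq, Measure.map_apply (hq.measurable.iterate r) hB, preimage_iterate_eq,
    Function.iterate_fixed h]

theorem cyclicMean_apply {B : Set Y} (hB : MeasurableSet B) (h : T ⁻¹' B = B) (j : Fin p) :
    cyclicMean q σ K j B = q j B :=
  hq.cyclicMean_apply_of_forall fun r => hq.apply_iterate_of_preimage_eq hB h j r

theorem isProbabilityMeasure_cyclicMean (j : Fin p) : IsProbabilityMeasure (cyclicMean q σ K j) := by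
  have := hq.isProbabilityMeasure
  exact ⟨hq.cyclicMean_apply_of_forall fun r => measure_univ⟩

theorem map_smul_eq (j : Fin p) (s : ZMod K) :
    ((K : ℝ≥0∞)⁻¹ • q (σ^[s.val] j)).map T = (K : ℝ≥0∞)⁻¹ • q (σ^[(s + 1).val] j) := by
  have : NeZero K := ⟨hq.pos.ne'⟩
  rw [Measure.map_smul, hq.map_eq, ZMod.val_add, hq.iterate_mod, ZMod.val_one_eq_one_mod,
    ← Function.iterate_succ_apply' σ]
  congr 2
  have h1 : (s.val + 1 % K) % K = (s.val + 1) % K := by simp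
  have h2 := congrFun (hq.iterate_mod (s.val + 1 % K)) j
  rw [h1, hq.iterate_mod] at h2
  exact h2

theorem map_cyclicMean (j : Fin p) : (cyclicMean q σ K j).map T = cyclicMean q σ K j := by
  rw [cyclicMean, Measure.map_sum hq.measurable.aemeasurable]
  simp only [hq.map_smul_eq]
  exact Measure.sum_comp_equiv (Equiv.addRight (1 : ZMod K))
    fun s : ZMod K => (K : ℝ≥0∞)⁻¹ • q (σ^[s.val] j)

/-- A `T`-invariant set has the same measure for all members of the cycle, and this measure is zero
or one because `q j` is ergodic for `T^[K]`. -/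
theorem ergodic_cyclicMean (j : Fin p) : Ergodic T (cyclicMean q σ K j) where
  measurable := hq.measurable
  map_eq := hq.map_cyclicMean j
  aeconst_set := fun B hB hTB => by
    have := hq.isProbabilityMeasure
    have := hq.isProbabilityMeasure_cyclicMean j
    have h1 : T^[K] ⁻¹' B = B := by rw [preimage_iterate_eq, Function.iterate_fixed hTB]
    rw [eventuallyConst_set']
    rcases eventuallyConst_set'.1 ((hq.isMixing j).ergodic.aeconst_set hB h1) with h2 | h2
    · exact Or.inl (ae_eq_empty.2 (by rw [hq.cyclicMean_apply hB hTB, ae_eq_empty.1 h2]))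
    · refine Or.inr (ae_eq_univ.2 ?_)
      rw [hq.cyclicMean_apply hB.compl (by rw [preimage_compl, hTB]), ae_eq_univ.1 h2]

variable [TopologicalSpace Y] [TopologicalSpace.PseudoMetrizableSpace Y] [BorelSpace Y]
  {S : Set (Y → ℝ)} (hS : IsTestClass S) (hc : ∀ i, ∀ᵐ y ∂q i, ContinuousAt T y)
include hS hc

theorem ae_continuousAt_iterate (m : ℕ) : ∀ i, ∀ᵐ y ∂q i, ContinuousAt T^[m] y := by
  induction m with
  | zero => exact fun i => .of_forall fun y => continuousAt_id
  | succ m ih =>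
    intro i
    have h1 := ih (σ i)
    rw [← hq.map_eq] at h1
    filter_upwards [hc i, ae_of_ae_map hq.measurable.aemeasurable h1] with y hy1 hy2
    rw [Function.iterate_succ]
    exact ContinuousAt.comp hy2 hy1

theorem integral_cyclicMean (j : Fin p) {g : Y → ℝ} (hg : g ∈ S) :
    ∫ y, g y ∂cyclicMean q σ K j = (K : ℝ)⁻¹ * ∑ r ∈ Finset.range K, ∫ y, g y ∂q (σ^[r] j) := by
  have := hq.isProbabilityMeasure
  rw [hq.cyclicMean_eq, integral_smul_measure,
    integral_finsetSum_measure fun i _ => hS.integrable hg _]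
  simp

/-- Averages of `g` under `T` are means of averages of the functions `g ∘ T^[r]` under `T^[K]`.
These are continuous `q j`-almost everywhere, so the basin property for `q j` applies to them. -/
theorem basin_subset (j : Fin p) : basin S T^[K] (q j) ⊆ basin S T (cyclicMean q σ K j) := by
  intro x hx g hg
  have := hq.isProbabilityMeasure
  rw [hq.integral_cyclicMean hS hc j hg]
  refine tendsto_orbitAverage_of_residues (hS.mem_Icc g hg) hq.pos fun r _ => ?_
  rw [← hq.map_iterate_eq, hS.integral_map_iterate hq.measurable hg]
  refine tendsto_orbitAverage_of_mem_basin hS hx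
    ((hS.measurable hg).comp (hq.measurable.iterate r)) (M := 1) (fun y => ?_) ?_
  · have := hS.mem_Icc g hg (T^[r] y)
    rw [abs_of_nonneg this.1]
    exact this.2
  · filter_upwards [hq.ae_continuousAt_iterate hS hc r j] with y hy
    exact (hS.continuous g hg).continuousAt.comp hy

theorem apply_basin (hb : ∀ i, q i (basin S T^[K] (q i))ᶜ = 0) (j : Fin p) :
    q j (basin S T (cyclicMean q σ K j)) = 1 := by
  have := hq.isProbabilityMeasure j
  have := hq.isProbabilityMeasure_cyclicMean j
  rw [← prob_compl_eq_zero_iff (measurableSet_basin hS hq.measurable)]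
  exact measure_mono_null (compl_subset_compl.2 (hq.basin_subset hS hc j)) (hb j)

/-- The ergodic averages of the measures of the cycles give a physical description. -/
theorem hasPhysicalDescription (hb : ∀ i, q i (basin S T^[K] (q i))ᶜ = 0) {m : Measure Y}
    (hm : m (⋃ j, basin S T (cyclicMean q σ K j))ᶜ = 0)
    (hpos : ∀ j, m (basin S T (cyclicMean q σ K j)) ≠ 0) : HasPhysicalDescription T m := by
  have hqp := hq.isProbabilityMeasure
  have hcp := hq.isProbabilityMeasure_cyclicMean
  -- Indices in the same cycle share their mean; indexing by the set of distinct means makes the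
  -- basins disjoint.
  obtain ⟨l, ⟨e⟩⟩ := Finite.exists_equiv_fin (range (cyclicMean q σ K))
  choose j hj using fun i => (e.symm i).2
  have hinj : ∀ i i', i ≠ i' → cyclicMean q σ K (j i) ≠ cyclicMean q σ K (j i') := fun i i' hi h =>
    hi (e.symm.injective (Subtype.ext (by rw [← hj i, ← hj i', h])))
  refine ⟨l, fun i => cyclicMean q σ K (j i), fun i => basin S T (cyclicMean q σ K (j i)),
    fun i => hcp _, fun i => (hq.ergodic_cyclicMean _).toMeasurePreserving,
    fun i => hq.ergodic_cyclicMean _, fun i => measurableSet_basin hS hq.measurable,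
    fun i i' hi => disjoint_basin hS (hinj i i' hi), fun i => ?_, fun i => pos_iff_ne_zero.2 (hpos _),
    ?_, fun i x hx f => ?_, fun i => ⟨K, hq.pos, fun s => (K : ℝ≥0∞)⁻¹ • q (σ^[s.val] (j i)), rfl,
      hq.map_smul_eq (j i), fun s => ?_⟩⟩
  · rw [hq.cyclicMean_apply (measurableSet_basin hS hq.measurable) (preimage_basin hS)]
    exact hq.apply_basin hS hc hb _
  · refine measure_mono_null (compl_subset_compl.2 (iUnion_subset fun j' => ?_)) hm
    have : cyclicMean q σ K j' = cyclicMean q σ K (j (e ⟨_, mem_range_self j'⟩)) := by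
      rw [hj, e.symm_apply_apply]
    rw [this]
    exact subset_iUnion (fun i => basin S T (cyclicMean q σ K (j i))) _
  · have := tendsto_orbitAverage_of_mem_basin hS hx f.continuous.measurable (M := ‖f‖)
      (fun y => f.norm_coe_le_norm y) (.of_forall fun y => f.continuous.continuousAt)
    simpa only [orbitAverage, div_eq_inv_mul, mul_one, one_div] using this
  · have h1 : (K : ℝ≥0∞) • (K : ℝ≥0∞)⁻¹ • q (σ^[s.val] (j i)) = q (σ^[s.val] (j i)) := by
      rw [smul_smul, ENNReal.mul_inv_cancel (by exact_mod_cast hq.pos.ne') (ENNReal.natCast_ne_top K),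
        one_smul]
    simp only [h1]
    exact ⟨hqp _, hq.isMixing _⟩

end IsMixingCycle

end Cycles

/-! ### Decorrelation and almost sure membership in a basin -/

section

theorem abs_prod_sub_prod_le {ι : Type*} (s : Finset ι) {a b : ι → ℝ} (ha : ∀ i, a i ∈ Icc (0 : ℝ) 1)
    (hb : ∀ i, b i ∈ Icc (0 : ℝ) 1) : |∏ i ∈ s, a i - ∏ i ∈ s, b i| ≤ ∑ i ∈ s, |a i - b i| := by
  classical
  induction s using Finset.induction_on with
  | empty => simp
  | insert i s hi ih =>
    rw [Finset.prod_insert hi, Finset.prod_insert hi, Finset.sum_insert hi]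
    have e : a i * ∏ i ∈ s, a i - b i * ∏ i ∈ s, b i
        = (a i - b i) * ∏ i ∈ s, a i + b i * (∏ i ∈ s, a i - ∏ i ∈ s, b i) := by ring
    rw [e]
    have h0 : 0 ≤ ∏ i ∈ s, a i := Finset.prod_nonneg fun i _ => (ha i).1
    have h1 : ∏ i ∈ s, a i ≤ 1 := Finset.prod_le_one (fun i _ => (ha i).1) fun i _ => (ha i).2
    refine (abs_add_le _ _).trans (add_le_add ?_ ?_)
    · rw [abs_mul, abs_of_nonneg h0]
      exact mul_le_of_le_one_right (abs_nonneg _) h1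
    · rw [abs_mul, abs_of_nonneg (hb i).1]
      exact (mul_le_of_le_one_left (abs_nonneg _) (hb i).2).trans ih

variable {Y : Type*} [TopologicalSpace Y] [MeasurableSpace Y]
  [TopologicalSpace.PseudoMetrizableSpace Y] [BorelSpace Y]
  {H : Type*} [NormedAddCommGroup H] [NormedSpace ℂ H]
  {T : Y → Y} {S : Set (Y → ℝ)}

namespace TransferModel

variable (D : TransferModel T S H) (hS : IsTestClass S) (hT : Measurable T)
  {P : H →L[ℂ] H} {n : ℕ → ℕ} {B C ρ : ℝ} (hP : IsPeripheralProjection D.L P n B C ρ)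
  {w : H} (hw : w ∈ D.cone) (hPw : P w = w)
  {p : ℕ} {A : Fin p → Set Y}
  {q : Fin p → Measure Y} {σ : Fin p → Fin p} {K : ℕ}
  (hc : IsCyclicDecomposition S T n (D.meas w) A q σ K)
  {v : H} (hv : v ∈ D.cone) (hac : D.meas (P v) ≪ D.meas w)

include hS hT hP hw hPw hc in
theorem isMixingCycle : IsMixingCycle T q σ K where
  measurable := hT
  pos := hc.pos
  iterate_eq := hc.iterate_eq
  isProbabilityMeasure := hc.isProbabilityMeasure
  map_eq := hc.map_eq
  isMixing i := by
    have := hc.isProbabilityMeasure i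
    refine hS.isMixing ⟨hT.iterate K, ?_⟩ fun E hE h hh => ?_
    · simpa using hc.map_iterate_mul_eq hT 1 i
    · have := D.tendsto_integral_restrict hS hT hP hw hPw hc i hE hh
      simpa only [Function.iterate_mul] using this

include hS hT hP hc hv hac in
-- The correlation is the pairing of `g` with `L ^ (K * m)` applied to `g` times `L ^ (K * i) v`.
-- Inserting `P` before each of the two powers costs errors of order `ρ ^ i` and `ρ ^ m`. By
-- periodicity, the measures that remain depend on neither `i` nor `m`.
theorem hasDecorrelation {g : Y → ℝ} (hg : g ∈ S) :
    ∃ κ C', 0 ≤ C' ∧ HasDecorrelation T^[K] g (D.meas v) κ C' ρ := by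
  have hgm := hS.measurable hg
  have hpv := D.proj_mem hP hv
  have hB : 0 ≤ B := (norm_nonneg _).trans (hP.norm_pow_le 0)
  have hC := hP.nonneg
  have hρ := hP.rate_nonneg
  set G : ℝ := ‖D.pair g‖ with hG
  set N : ℝ := ‖D.mul g‖ with hN
  refine ⟨∫ y, g y ∂D.meas (P (D.mul g (P v))), G * B * N * C * ‖v‖ + G * C * N * B * ‖P v‖,
    by positivity, fun i m => ?_⟩
  have hKp : ∀ m, ρ ^ (K * m) ≤ ρ ^ m := fun m =>
    pow_le_pow_of_le_one hρ hP.rate_lt_one.le (Nat.le_mul_of_pos_left m hc.pos)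
  set a := (D.L ^ (K * i)) v with ha
  set b := (D.L ^ (K * i)) (P v) with hb
  have haC : a ∈ D.cone := D.pow_mem hv _
  have hbC : b ∈ D.cone := D.pow_mem hpv _
  have hmb : D.meas b = D.meas (P v) := D.meas_pow_mul_proj hS hT hP hc hv hac i
  have hPb : P b = b := by rw [hb, D.proj_pow hP, D.proj_proj hP]
  have e1 : ∫ x, g ((T^[K])^[i] x) * g ((T^[K])^[m + i] x) ∂D.meas v
      = (D.pair g ((D.L ^ (K * m)) (D.mul g a))).re := by
    have hgg : Measurable fun y => g y * g (T^[K * m] y) := hgm.mul (hgm.comp (hT.iterate _))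
    rw [D.pair_re hg (D.pow_mem (D.mul_mem g hg a haC) _), D.meas_pow hT (D.mul_mem g hg a haC),
      hS.integral_map_iterate hT hg, D.integral_meas_mul hS hg haC, D.meas_pow hT hv,
      integral_map (hT.iterate _).aemeasurable hgg.aestronglyMeasurable]
    refine integral_congr_ae (.of_forall fun x => ?_)
    simp only [← Function.iterate_mul, ← Function.iterate_add_apply, Nat.mul_add]
  have e2 : ∫ y, g y ∂D.meas (P (D.mul g (P v)))
      = (D.pair g ((D.L ^ (K * m)) (P (D.mul g b)))).re := by
    have hmul : D.mul g b ∈ D.cone := D.mul_mem g hg b hbC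
    have hle : D.meas (P (D.mul g b)) ≤ D.meas (P v) := by
      have := D.meas_proj_mul_le hS hT hP hg hbC
      rwa [hPb, hmb] at this
    rw [D.pair_re hg (D.pow_mem (D.proj_mem hP hmul) _),
      D.meas_pow_mul_proj hS hT hP hc hmul (hle.absolutelyContinuous.trans hac),
      D.meas_proj_congr hS hT hP hmul (D.mul_mem g hg _ hpv)
        (by rw [D.meas_mul hS hg hbC, D.meas_mul hS hg hpv, hmb])]
  have h1 : ‖D.pair g ((D.L ^ (K * m)) (D.mul g (a - b)))‖ ≤ G * (B * (N * (C * ρ ^ (K * i) * ‖v‖))) := by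
    refine ((D.pair g).le_opNorm _).trans (mul_le_mul_of_nonneg_left ?_ (norm_nonneg _))
    refine ((D.L ^ (K * m)).le_opNorm _).trans
      (mul_le_mul (hP.norm_pow_le _) ?_ (norm_nonneg _) hB)
    exact ((D.mul g).le_opNorm _).trans
      (mul_le_mul_of_nonneg_left (D.norm_pow_sub_proj_le hP v _) (norm_nonneg _))
  have h2 : ‖D.pair g ((D.L ^ (K * m)) (D.mul g b) - (D.L ^ (K * m)) (P (D.mul g b)))‖
      ≤ G * (C * ρ ^ (K * m) * (N * (B * ‖P v‖))) := by
    refine ((D.pair g).le_opNorm _).trans (mul_le_mul_of_nonneg_left ?_ (norm_nonneg _))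
    refine (D.norm_pow_sub_proj_le hP _ _).trans (mul_le_mul_of_nonneg_left ?_ (by positivity))
    refine ((D.mul g).le_opNorm _).trans (mul_le_mul_of_nonneg_left ?_ (norm_nonneg _))
    exact ((D.L ^ (K * i)).le_opNorm _).trans
      (mul_le_mul_of_nonneg_right (hP.norm_pow_le _) (norm_nonneg _))
  rw [e1, e2, ← Complex.sub_re, ← map_sub]
  refine (Complex.abs_re_le_norm _).trans ?_
  have e3 : (D.L ^ (K * m)) (D.mul g a) - (D.L ^ (K * m)) (P (D.mul g b))
      = (D.L ^ (K * m)) (D.mul g (a - b))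
        + ((D.L ^ (K * m)) (D.mul g b) - (D.L ^ (K * m)) (P (D.mul g b))) := by
    rw [map_sub (D.mul g), map_sub (D.L ^ (K * m))]; abel
  rw [e3, map_add]
  refine (norm_add_le _ _).trans ((add_le_add h1 h2).trans ?_)
  have hi := hKp i
  have hm := hKp m
  have p1 : 0 ≤ G * B * N * C * ‖v‖ := by positivity
  have p2 : 0 ≤ G * C * N * B * ‖P v‖ := by positivity
  have q1 : G * (B * (N * (C * ρ ^ (K * i) * ‖v‖))) ≤ G * B * N * C * ‖v‖ * ρ ^ i := by
    calc _ = G * B * N * C * ‖v‖ * ρ ^ (K * i) := by ring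
      _ ≤ _ := mul_le_mul_of_nonneg_left hi p1
  have q2 : G * (C * ρ ^ (K * m) * (N * (B * ‖P v‖))) ≤ G * C * N * B * ‖P v‖ * ρ ^ m := by
    calc _ = G * C * N * B * ‖P v‖ * ρ ^ (K * m) := by ring
      _ ≤ _ := mul_le_mul_of_nonneg_left hm p2
  have r1 := mul_nonneg p1 (pow_nonneg hρ m)
  have r2 := mul_nonneg p2 (pow_nonneg hρ i)
  linarith

include hS hT hP hc hv hac in
theorem ae_tendsto_orbitLimit {g : Y → ℝ} (hg : g ∈ S) : ∀ᵐ x ∂D.meas v,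
    Tendsto (fun n => orbitAverage T^[K] g n x) atTop (𝓝 (orbitLimit T^[K] g x)) := by
  obtain ⟨κ, C', hC', h⟩ := D.hasDecorrelation hS hT hP hc hv hac hg
  exact h.ae_tendsto_orbitLimit (hT.iterate K) (hS.measurable hg) (hS.mem_Icc g hg) hP.rate_nonneg
    hP.rate_lt_one hC'

include hS hT hP hw hPw hc in
theorem apply_compl_basin (i : Fin p) : q i (basin S T^[K] (q i))ᶜ = 0 := by
  have := hc.isProbabilityMeasure i
  refine measure_compl_basin hS ((D.isMixingCycle hS hT hP hw hPw hc).isMixing i).ergodic fun g hg => ?_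
  exact (hc.absolutelyContinuous i).ae_le (D.ae_tendsto_orbitLimit hS hT hP hc hw (by rw [hPw]) hg)

include hS hT hP hw hPw hc hv hac in
/-- Almost every point for a positive element belongs to one of the basins. -/
theorem ae_exists_mem_basin : ∀ᵐ x ∂D.meas v, ∃ i, x ∈ basin S T^[K] (q i) := by
  have hqp := hc.isProbabilityMeasure
  have hF : Measurable T^[K] := hT.iterate K
  have hpv := D.proj_mem hP hv
  obtain ⟨S', hS', hcount, hd⟩ := hS.exists_countable
  have hdev : ∀ (g : Y → ℝ), g ∈ S → ∀ i, ∀ b ∈ Icc (0 : ℝ) 1, |b - ∫ y, g y ∂q i| ∈ Icc (0 : ℝ) 1 := by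
    intro g hg i b hb
    have h0 : 0 ≤ ∫ y, g y ∂q i := integral_nonneg fun y => (hS.mem_Icc g hg y).1
    have h1 : ∫ y, g y ∂q i ≤ 1 := by
      calc _ ≤ ∫ y, (1 : ℝ) ∂q i :=
            integral_mono (hS.integrable hg _) (integrable_const _) fun y => (hS.mem_Icc g hg y).2
        _ = 1 := by simp
    exact ⟨abs_nonneg _, abs_le.2 ⟨by linarith [hb.1], by linarith [hb.2]⟩⟩
  -- One test function is allotted to each candidate `q i`. The product of the deviations vanishes
  -- exactly when some candidate passes its test.
  have key : ∀ G : Fin p → Y → ℝ, (∀ i, G i ∈ S) →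
      ∀ᵐ x ∂D.meas v, ∃ i, orbitLimit T^[K] (G i) x = ∫ y, G i y ∂q i := by
    intro G hG
    have hGm := fun i => hS.measurable (hG i)
    have hGI := fun i => hS.mem_Icc (G i) (hG i)
    set Q : ℕ → Y → ℝ := fun k x => ∏ i, |orbitAverage T^[K] (G i) k x - ∫ y, G i y ∂q i| with hQ
    set R : Y → ℝ := fun x => ∏ i, |orbitLimit T^[K] (G i) x - ∫ y, G i y ∂q i| with hR
    have hlim : ∀ i, ∀ᵐ x ∂D.meas v,
        Tendsto (fun k => orbitAverage T^[K] (G i) k x) atTop (𝓝 (orbitLimit T^[K] (G i) x)) := fun i =>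
      D.ae_tendsto_orbitLimit hS hT hP hc hv hac (hG i)
    have hlimI : ∀ᵐ x ∂D.meas v, ∀ i, orbitLimit T^[K] (G i) x ∈ Icc (0 : ℝ) 1 :=
      ae_all_iff.2 fun i => (hlim i).mono fun x hx =>
        isClosed_Icc.mem_of_tendsto hx (.of_forall fun k => orbitAverage_mem_Icc (hGI i) k x)
    have hQI : ∀ k x, Q k x ∈ Icc (0 : ℝ) 1 := fun k x =>
      ⟨Finset.prod_nonneg fun i _ => abs_nonneg _, Finset.prod_le_one (fun i _ => abs_nonneg _) fun i _ =>
        (hdev _ (hG i) i _ (orbitAverage_mem_Icc (hGI i) k x)).2⟩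
    have hQm : ∀ k, Measurable (Q k) := fun k => Finset.measurable_fun_prod _ fun i _ =>
      ((measurable_orbitAverage hF (hGm i) k).sub_const _).abs
    have hRm : Measurable R := Finset.measurable_fun_prod _ fun i _ =>
      ((measurable_orbitLimit hF (hGm i)).sub_const _).abs
    have hR0 : ∀ x, 0 ≤ R x := fun x => Finset.prod_nonneg fun i _ => abs_nonneg _
    have hRI : ∀ᵐ x ∂D.meas v, R x ≤ 1 := hlimI.mono fun x hx =>
      Finset.prod_le_one (fun i _ => abs_nonneg _) fun i _ => (hdev _ (hG i) i _ (hx i)).2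
    have hRint : Integrable R (D.meas v) := Integrable.of_bound hRm.aestronglyMeasurable 1
      (hRI.mono fun x hx => by rwa [Real.norm_eq_abs, abs_of_nonneg (hR0 x)])
    -- The limit deviation `R` is compared with the finite-time deviation `Q k` evaluated after `m`
    -- further iterates, with an error independent of `m`.
    have hbound : ∃ M : ℝ, ∀ (r k m : ℕ), 0 < r → r ^ 2 ≤ k →
        ∫ x, R x ∂D.meas v ≤ ∫ x, Q k ((T^[K])^[m] x) ∂D.meas v + M / r := by
      choose κ C' hC' hdec using fun i => D.hasDecorrelation hS hT hP hc hv hac (hG i)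
      refine ⟨∑ i, ((D.meas v).real univ + 16 * C' i * (1 - ρ)⁻¹), fun r k m hr hk => ?_⟩
      rw [Finset.sum_div]
      have hai : ∀ i, Integrable (fun x => |orbitAverage T^[K] (G i) k ((T^[K])^[m] x)
          - orbitLimit T^[K] (G i) x|) (D.meas v) := fun i => by
        refine Integrable.of_bound (((measurable_orbitAverage hF (hGm i) k).comp (hF.iterate m)).sub
          (measurable_orbitLimit hF (hGm i))).abs.aestronglyMeasurable 1 ?_
        filter_upwards [hlimI] with x hx
        have h1 := orbitAverage_mem_Icc (F := T^[K]) (hGI i) k ((T^[K])^[m] x)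
        have h2 := hx i
        rw [Real.norm_eq_abs, abs_abs, abs_le]
        exact ⟨by linarith [h1.1, h2.2], by linarith [h1.2, h2.1]⟩
      have hsum : ∫ x, ∑ i, |orbitAverage T^[K] (G i) k ((T^[K])^[m] x) - orbitLimit T^[K] (G i) x|
          ∂D.meas v ≤ ∑ i, ((D.meas v).real univ + 16 * C' i * (1 - ρ)⁻¹) / r := by
        rw [integral_finsetSum _ fun i _ => hai i]
        exact Finset.sum_le_sum fun i _ => (hdec i).integral_abs_orbitLimit_sub_le hF (hGm i) (hGI i)
          hP.rate_nonneg hP.rate_lt_one (hC' i) hr hk m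
      have hQint : Integrable (fun x => Q k ((T^[K])^[m] x)) (D.meas v) :=
        integrable_of_measurable_of_mem_Icc ((hQm k).comp (hF.iterate m)) fun x => hQI k _
      have hsint := integrable_finsetSum Finset.univ fun i _ => hai i
      refine le_trans ?_ (add_le_add le_rfl hsum)
      rw [← integral_add hQint hsint]
      refine integral_mono_ae hRint (hQint.add hsint) ?_
      filter_upwards [hlimI] with x hx
      have h1 := abs_prod_sub_prod_le Finset.univ
        (fun i => hdev _ (hG i) i _ (orbitAverage_mem_Icc (F := T^[K]) (hGI i) k ((T^[K])^[m] x)))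
        (fun i => hdev _ (hG i) i _ (hx i))
      have h2 : ∀ i, |(|orbitAverage T^[K] (G i) k ((T^[K])^[m] x) - ∫ y, G i y ∂q i|
          - |orbitLimit T^[K] (G i) x - ∫ y, G i y ∂q i|)|
          ≤ |orbitAverage T^[K] (G i) k ((T^[K])^[m] x) - orbitLimit T^[K] (G i) x| := fun i => by
        refine (abs_abs_sub_abs_le_abs_sub _ _).trans (le_of_eq ?_)
        congr 1; ring
      have h3 := (abs_le.1 (h1.trans (Finset.sum_le_sum fun i _ => h2 i))).1
      simp only [hQ, hR]
      linarith
    obtain ⟨M, hM⟩ := hbound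
    -- `Q k` involves iterates of `T`, so it need not be continuous; it is so almost everywhere for
    -- the measure of `P v`, which is enough for the passage `m → ∞`.
    have hQcont : ∀ k, ∀ᵐ y ∂D.meas (P v), ContinuousAt (Q k) y := by
      intro k
      have h1 : ∀ i : ℕ, ∀ᵐ y ∂D.meas (P v), ContinuousAt ((T^[K])^[i]) y := fun i => by
        have := D.ae_continuousAt_iterate hT (K * i) _ hpv
        rwa [Function.iterate_mul] at this
      filter_upwards [ae_all_iff.2 h1] with y hy
      refine tendsto_finsetProd _ fun i _ => ((ContinuousAt.div_const ?_ _).sub continuousAt_const).abs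
      exact tendsto_finsetSum _ fun j _ => (hS.continuous _ (hG i)).continuousAt.comp (hy j)
    have hlim1 : ∀ r k : ℕ, 0 < r → r ^ 2 ≤ k →
        ∫ x, R x ∂D.meas v ≤ ∫ x, Q k x ∂D.meas (P v) + M / r := by
      intro r k hr hk
      have h1 := (D.weakTendsto_meas_pow_mul hS hT hP hc hv hac).tendsto_integral_of_mem_Icc hS (hQm k)
        (hQI k) (hQcont k)
      refine ge_of_tendsto (h1.add_const (M / r)) (.of_forall fun m => ?_)
      rw [integral_map (hT.iterate _).aemeasurable (hQm k).aestronglyMeasurable]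
      have := hM r k m hr hk
      rwa [← Function.iterate_mul] at this
    -- The measure of `P v` is a combination of the `q i`. For `q i`-almost every point the `i`-th
    -- factor tends to zero and the other factors are at most one.
    have hlim2 : Tendsto (fun k => ∫ x, Q k x ∂D.meas (P v)) atTop (𝓝 0) := by
      obtain ⟨a, ha⟩ := hc.exists_eq_sum _ inferInstance hac
        (D.isRigid_meas hT hP hpv (D.proj_proj hP v))
      have hQint : ∀ k i, Integrable (Q k) (a i • q i) := fun k i =>
        integrable_of_measurable_of_mem_Icc (hQm k) (hQI k)
      have e : ∀ k, ∫ x, Q k x ∂D.meas (P v) = ∑ i, (a i : ℝ) * ∫ x, Q k x ∂q i := fun k => by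
        rw [ha, integral_finsetSum_measure fun i _ => hQint k i]
        simp only [integral_smul_nnreal_measure, NNReal.smul_def, smul_eq_mul]
      simp_rw [e]
      have h0 : (0 : ℝ) = ∑ i, (a i : ℝ) * ∫ x, (0 : ℝ) ∂q i := by simp
      rw [h0]
      refine tendsto_finsetSum _ fun i _ => Tendsto.const_mul _ ?_
      refine tendsto_integral_of_dominated_convergence (fun _ => 1)
        (fun k => (hQm k).aestronglyMeasurable) (integrable_const _)
        (fun k => .of_forall fun x => by
          rw [Real.norm_eq_abs, abs_of_nonneg (hQI k x).1]; exact (hQI k x).2) ?_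
      have hb : ∀ᵐ x ∂q i, x ∈ basin S T^[K] (q i) := D.apply_compl_basin hS hT hP hw hPw hc i
      filter_upwards [hb] with x hx
      have h1 : Tendsto (fun k => |orbitAverage T^[K] (G i) k x - ∫ y, G i y ∂q i|) atTop (𝓝 0) := by
        simpa using ((hx _ (hG i)).sub_const (∫ y, G i y ∂q i)).abs
      refine squeeze_zero (fun k => (hQI k x).1) (fun k => ?_) h1
      rw [hQ]
      simp only
      rw [← Finset.mul_prod_erase _ _ (Finset.mem_univ i)]
      exact mul_le_of_le_one_right (abs_nonneg _) (Finset.prod_le_one (fun i _ => abs_nonneg _)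
        fun i _ => (hdev _ (hG i) i _ (orbitAverage_mem_Icc (hGI i) k x)).2)
    have hRzero : ∫ x, R x ∂D.meas v = 0 := by
      refine le_antisymm ?_ (integral_nonneg hR0)
      have h1 : Tendsto (fun r : ℕ => ∫ x, Q (r ^ 2) x ∂D.meas (P v) + M / r) atTop (𝓝 (0 + 0)) :=
        (hlim2.comp (tendsto_pow_atTop (two_ne_zero))).add (tendsto_const_div_atTop_nhds_zero_nat M)
      rw [add_zero] at h1
      refine ge_of_tendsto h1 ?_
      filter_upwards [eventually_gt_atTop 0] with r hr
      exact hlim1 r _ hr le_rfl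
    filter_upwards [(integral_eq_zero_iff_of_nonneg hR0 hRint).1 hRzero] with x hx
    obtain ⟨i, -, hi⟩ := Finset.prod_eq_zero_iff.1 (show R x = 0 from hx)
    exact ⟨i, sub_eq_zero.1 (abs_eq_zero.1 hi)⟩
  have := hcount.to_subtype
  have hall : ∀ᵐ x ∂D.meas v, ∀ G : Fin p → S', ∃ i,
      orbitLimit T^[K] (G i) x = ∫ y, (G i : Y → ℝ) y ∂q i :=
    ae_all_iff.2 fun G => key (fun i => G i) fun i => hS' (G i).2
  have hlim : ∀ᵐ x ∂D.meas v, ∀ g ∈ S',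
      Tendsto (fun k => orbitAverage T^[K] g k x) atTop (𝓝 (orbitLimit T^[K] g x)) :=
    (ae_ball_iff hcount).2 fun g hg => D.ae_tendsto_orbitLimit hS hT hP hc hv hac (hS' hg)
  filter_upwards [hall, hlim] with x hx hlx
  by_contra! hcon
  -- A point in no basin would fail a countably chosen test for every `i`, and these failures
  -- together form a tuple excluded by `hall`.
  have hex : ∀ i, ∃ g ∈ S', orbitLimit T^[K] g x ≠ ∫ y, g y ∂q i := by
    intro i
    by_contra! h
    exact hcon i (mem_basin_of_dense hS hS' hd fun g hg => h g hg ▸ hlx g hg)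
  choose G hG hGne using hex
  obtain ⟨i, hi⟩ := hx fun i => ⟨G i, hG i⟩
  exact hGne i hi

end TransferModel

end

/-! ### Physical description in the abstract setting -/

section

variable {Y : Type*} [TopologicalSpace Y] [MeasurableSpace Y]
  [TopologicalSpace.PseudoMetrizableSpace Y] [BorelSpace Y]
  {H : Type*} [NormedAddCommGroup H] [NormedSpace ℂ H]
  {T : Y → Y} {S : Set (Y → ℝ)}

namespace TransferModel

variable (D : TransferModel T S H) (hS : IsTestClass S) (hT : Measurable T)
  {P : H →L[ℂ] H} {n : ℕ → ℕ} {B C ρ : ℝ} (hP : IsPeripheralProjection D.L P n B C ρ)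
  {w : H} (hw : w ∈ D.cone) (hPw : P w = w)
  {p : ℕ} {A : Fin p → Set Y}
  {q : Fin p → Measure Y} {σ : Fin p → Fin p} {K : ℕ}
  (hc : IsCyclicDecomposition S T n (D.meas w) A q σ K)
  {v : H} (hv : v ∈ D.cone) (hac : D.meas (P v) ≪ D.meas w)

include hS hT hP hw hPw hc hv hac in
-- Integrals of the orbit averages for `D.meas v` have two limits: Cesàro means of the iterates give
-- the measure of `P v`, while pointwise convergence on the basins gives the sum.
theorem meas_proj_eq_sum : D.meas (P v)
    = ∑ i, ((D.meas v) (basin S T^[K] (q i))).toNNReal • q i := by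
  have hqp := hc.isProbabilityMeasure
  have hF : Measurable T^[K] := hT.iterate K
  have hinj : ∀ i j, i ≠ j → q i ≠ q j := fun i j hij h => by
    have h1 := hc.apply_eq_zero hij
    rw [h, hc.apply_self] at h1
    exact one_ne_zero h1
  have hbm : ∀ i, MeasurableSet (basin S T^[K] (q i)) := fun i => measurableSet_basin hS hF
  refine hS.measure_ext fun g hg => ?_
  have hgm := hS.measurable hg
  set G : Y → ℝ := fun x => ∑ i, (basin S T^[K] (q i)).indicator (fun _ => ∫ y, g y ∂q i) x with hG
  have h1 : Tendsto (fun k => ∫ x, orbitAverage T^[K] g k x ∂D.meas v) atTop (𝓝 (∫ x, G x ∂D.meas v)) := by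
    refine tendsto_integral_of_dominated_convergence (fun _ => 1)
      (fun k => (measurable_orbitAverage hF hgm k).aestronglyMeasurable) (integrable_const _)
      (fun k => .of_forall fun x => ?_) ?_
    · have := orbitAverage_mem_Icc (F := T^[K]) (hS.mem_Icc g hg) k x
      rw [Real.norm_eq_abs, abs_of_nonneg this.1]
      exact this.2
    · filter_upwards [D.ae_exists_mem_basin hS hT hP hw hPw hc hv hac] with x ⟨i, hi⟩
      have : G x = ∫ y, g y ∂q i := by
        rw [hG]
        refine (Finset.sum_eq_single i (fun j _ hj => indicator_of_notMem (fun hx => ?_) _)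
          (by simp)).trans (indicator_of_mem hi _)
        exact (disjoint_basin hS (hinj _ _ hj)).le_bot ⟨hx, hi⟩
      rw [this]
      exact hi g hg
  have h2 : Tendsto (fun k => ∫ x, orbitAverage T^[K] g k x ∂D.meas v) atTop
      (𝓝 (∫ y, g y ∂D.meas (P v))) := by
    have := (D.weakTendsto_meas_pow_mul hS hT hP hc hv hac g hg).cesaro
    refine this.congr fun k => ?_
    have hi : ∀ i ∈ Finset.range k, Integrable (fun x => g (T^[K * i] x)) (D.meas v) := fun i _ =>
      integrable_of_measurable_of_mem_Icc (hgm.comp (hT.iterate _)) fun y => hS.mem_Icc g hg _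
    simp only [orbitAverage, hS.integral_map_iterate hT hg, ← Function.iterate_mul]
    rw [integral_div, integral_finsetSum _ hi, div_eq_inv_mul]
  rw [tendsto_nhds_unique h2 h1, hG, integral_finsetSum _ fun i _ => (integrable_const _).indicator (hbm i),
    hc.integral_sum hS _ hg]
  refine Finset.sum_congr rfl fun i _ => ?_
  rw [integral_indicator (hbm i), integral_const, smul_eq_mul, measureReal_restrict_apply_univ]
  rfl

include hS in
theorem hasPhysicalDescription [CompleteSpace H] (hpow : ∃ C : ℝ, ∀ n : ℕ, ‖D.L ^ n‖ ≤ C)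
    (hess : essentialSpectralRadius D.L < 1) {m : Measure Y}
    (hTm : Measure.QuasiMeasurePreserving T m m) {f₀ : H} (hf₀ : f₀ ∈ D.cone) {φ : Y → ℝ≥0∞}
    (hφ : AEMeasurable φ m) (hmeas : D.meas f₀ = m.withDensity φ) {N₀ : ℕ}
    (hN₀ : ∀ᵐ x ∂m, x ∈ range T^[N₀] → φ x ≠ 0) : HasPhysicalDescription T m := by
  have hT := hTm.measurable
  obtain ⟨B, hB⟩ := hpow
  obtain ⟨P, n, C, ρ, hP⟩ := exists_isPeripheralProjection hB hess
  have hPf := D.proj_mem hP hf₀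
  obtain ⟨w, hw, hPw, hwe⟩ := D.exists_reference hP hPf (D.proj_proj hP f₀)
  have hlam : D.meas w = (2⁻¹ : ℝ≥0) • D.meas (P f₀) + (2⁻¹ : ℝ≥0) • (D.meas w).map T := by
    conv_lhs => rw [hwe]
    rw [D.meas_add hS (D.smul_mem _ _ hPf) (D.smul_mem _ _ (D.L_mem w hw)), D.meas_smul hS _ hPf,
      D.meas_smul hS _ (D.L_mem w hw), D.meas_L w hw]
  have hlam' : ∀ s, D.meas w s = (2⁻¹ : ℝ≥0) * D.meas (P f₀) s + (2⁻¹ : ℝ≥0) * (D.meas w).map T s :=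
    fun s => by
      conv_lhs => rw [hlam]
      rfl
  have h2 : ((2⁻¹ : ℝ≥0) : ℝ≥0∞) ≠ 0 := by simp
  have hac : D.meas (P f₀) ≪ D.meas w := fun s hs => by
    rw [hlam', add_eq_zero, mul_eq_zero] at hs
    exact hs.1.resolve_left h2
  have hacT : (D.meas w).map T ≪ D.meas w := fun s hs => by
    rw [hlam', add_eq_zero, mul_eq_zero, mul_eq_zero] at hs
    exact hs.2.resolve_left h2
  obtain ⟨p, A, q, σ, K, hc⟩ := exists_isCyclicDecomposition hS hT (D.isRigid_meas hT hP hw hPw) hP.pos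
    (D.ae_continuousAt w hw) hacT fun p C h => D.card_rigidFamily_le hS hT hP hw h
  have hq := D.isMixingCycle hS hT hP hw hPw hc
  have hqp := hc.isProbabilityMeasure
  have hcp := hq.isProbabilityMeasure_cyclicMean
  have hcont : ∀ i, ∀ᵐ y ∂q i, ContinuousAt T y := fun i =>
    (hc.absolutelyContinuous i).ae_le (D.ae_continuousAt w hw)
  have hb := D.apply_compl_basin hS hT hP hw hPw hc
  have hae := D.ae_exists_mem_basin hS hT hP hw hPw hc hf₀ hac
  have hbm : ∀ j, MeasurableSet (basin S T (cyclicMean q σ K j)) := fun j => measurableSet_basin hS hT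
  refine hq.hasPhysicalDescription hS hcont hb ?_ fun j hj => ?_
  · have h1 : ∀ᵐ x ∂m, φ x ≠ 0 → x ∈ ⋃ j, basin S T (cyclicMean q σ K j) := by
      rw [hmeas] at hae
      refine (ae_withDensity_iff' hφ).1 (hae.mono fun x ⟨i, hi⟩ => mem_iUnion.2 ⟨i, ?_⟩)
      exact hq.basin_subset hS hcont i hi
    have h3 : ∀ᵐ x ∂m, x ∈ range T^[N₀] → x ∈ ⋃ j, basin S T (cyclicMean q σ K j) := by
      filter_upwards [h1, hN₀] with x hx hx' hr
      exact hx (hx' hr)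
    -- Nonsingularity pulls the statement on `range T^[N₀]` back to almost every point, and the
    -- union of the basins is invariant.
    have h4 : ∀ᵐ x ∂m, x ∈ ⋃ j, basin S T (cyclicMean q σ K j) := by
      filter_upwards [(hTm.iterate N₀).ae h3] with x hx
      have h5 := hx (mem_range_self x)
      have h6 : T^[N₀] ⁻¹' (⋃ j, basin S T (cyclicMean q σ K j)) = ⋃ j, basin S T (cyclicMean q σ K j) := by
        rw [preimage_iterate_eq, Function.iterate_fixed]
        rw [preimage_iUnion]
        simp only [preimage_basin hS]
      rw [← h6]
      exact h5
    exact h4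
  -- If the basin `U` were null, the formula for the measure of `P f₀` would make `U` null for it.
  -- By invariance of `U` the relation defining the reference measure then reads `x = x / 2`, so `U`
  -- would be null for the reference measure, although `q j` is carried by `U`.
  · set U := basin S T (cyclicMean q σ K j) with hU
    have hUm : MeasurableSet U := hbm j
    have hUinv : T ⁻¹' U = U := preimage_basin hS
    have h0 : D.meas f₀ U = 0 := by
      rw [hmeas]; exact withDensity_absolutelyContinuous m φ hj
    have h1 : D.meas (P f₀) U = 0 := by
      rw [D.meas_proj_eq_sum hS hT hP hw hPw hc hf₀ hac, Measure.finsetSum_apply]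
      refine Finset.sum_eq_zero fun i _ => ?_
      by_cases hij : cyclicMean q σ K i = cyclicMean q σ K j
      · have : D.meas f₀ (basin S T^[K] (q i)) = 0 :=
          measure_mono_null ((hq.basin_subset hS hcont i).trans (by rw [hij])) h0
        rw [this]
        simp
      · have : q i U = 0 := by
          refine measure_mono_null (t := (basin S T (cyclicMean q σ K i))ᶜ)
            (disjoint_left.1 (disjoint_basin hS (Ne.symm hij))) ?_
          rw [prob_compl_eq_zero_iff (hbm i)]
          exact hq.apply_basin hS hcont hb i
        rw [Measure.smul_apply, this, smul_zero]
    have h3 : D.meas w U = 0 := by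
      have h4 := hlam' U
      rw [h1, Measure.map_apply hT hUm, hUinv, mul_zero, zero_add] at h4
      have h5 := congrArg ENNReal.toReal h4
      rw [ENNReal.toReal_mul] at h5
      have h6 : (D.meas w U).toReal = 0 := by
        have : ((2⁻¹ : ℝ≥0) : ℝ≥0∞).toReal = 2⁻¹ := by simp
        rw [this] at h5
        linarith
      exact ((ENNReal.toReal_eq_zero_iff _).1 h6).resolve_right (measure_ne_top _ _)
    have h4 := hc.absolutelyContinuous j h3
    rw [hq.apply_basin hS hcont hb j] at h4
    exact one_ne_zero h4

end TransferModel

end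

/-! ### Multipliers, integration and positivity on the completion -/

section Completion

open UniformSpace

theorem ContinuousLinearMap.norm_completion_le {E : Type*} [NormedAddCommGroup E] [NormedSpace ℂ E]
    (L : E →L[ℂ] E) : ‖L.completion‖ ≤ ‖L‖ := by
  refine ContinuousLinearMap.opNorm_le_bound _ (norm_nonneg _) fun x => ?_
  induction x using Completion.induction_on with
  | hp => exact isClosed_le (by fun_prop) (by fun_prop)
  | ih x =>
    rw [ContinuousLinearMap.completion_apply_coe, Completion.norm_coe, Completion.norm_coe]
    exact L.le_opNorm x

theorem ContinuousLinearMap.completion_pow {E : Type*} [NormedAddCommGroup E] [NormedSpace ℂ E]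
    (L : E →L[ℂ] E) (n : ℕ) : L.completion ^ n = (L ^ n).completion := by
  ext x
  induction x using Completion.induction_on with
  | hp => exact isClosed_eq (by fun_prop) (by fun_prop)
  | ih x =>
    rw [ContinuousLinearMap.completion_apply_coe]
    induction n generalizing x with
    | zero => rfl
    | succ n ih =>
      rw [pow_succ, pow_succ]
      change (L.completion ^ n) (L.completion x) = (((L ^ n) (L x) : E) : Completion E)
      rw [ContinuousLinearMap.completion_apply_coe, ih]

variable {Y : Type*} [MeasurableSpace Y] {m : Measure Y} [IsFiniteMeasure m]
  {H₀ : Type*} [NormedAddCommGroup H₀] [NormedSpace ℂ H₀] (ι : H₀ →ₗ[ℂ] Lp ℂ (⊤ : ℝ≥0∞) m)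

/-- Multiplication by `g` defines a bounded operator of `H₀`. -/
def IsMultiplier (g : Y → ℝ) : Prop :=
  ∃ M : H₀ →L[ℂ] H₀, ∀ u, ∀ᵐ x ∂m, ι (M u) x = g x * ι u x

/-- Integration against `g` defines a bounded functional on `H₀`. -/
def IsFunctional (g : Y → ℝ) : Prop :=
  ∃ φ : H₀ →L[ℂ] ℂ, ∀ u, φ u = ∫ x, g x * ι u x ∂m

open Classical in
/-- The multiplication by `g` on the completion of `H₀`. -/
def multiplication (g : Y → ℝ) : Completion H₀ →L[ℂ] Completion H₀ :=
  if h : IsMultiplier ι g then h.choose.completion else 0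

open Classical in
/-- The integration against `g` on the completion of `H₀`. -/
def integration (g : Y → ℝ) : Completion H₀ →L[ℂ] ℂ :=
  if h : IsFunctional ι g then h.choose.extend Completion.toComplL else 0

/-- The elements of `H₀` that are nonnegative functions. -/
def IsNonneg (u : H₀) : Prop := ∀ᵐ x ∂m, ∃ r : ℝ, 0 ≤ r ∧ ι u x = (r : ℂ)

/-- The closure in the completion of the set of nonnegative elements of `H₀`. -/
def positiveCone : Set (Completion H₀) := closure ((↑) '' {u : H₀ | IsNonneg ι u})

variable {ι}

/-- Injectivity of `ι` makes the product unique in `H₀`, so an arbitrary choice of products is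
linear. -/
theorem IsMultiplier.of_bound (hι : Function.Injective ι) {g : Y → ℝ} {C : ℝ}
    (h : ∀ u, ∃ w, (∀ᵐ x ∂m, ι w x = g x * ι u x) ∧ ‖w‖ ≤ C * ‖u‖) : IsMultiplier ι g := by
  choose M hM hC using h
  have huniq : ∀ w w' : H₀, ι w =ᵐ[m] ι w' → w = w' := fun w w' h => hι (Lp.ext h)
  refine ⟨LinearMap.mkContinuous
    { toFun := M
      map_add' := fun u v => huniq _ _ ?_
      map_smul' := fun c u => huniq _ _ ?_ } C hC, hM⟩
  · rw [map_add]
    have h1 := Lp.coeFn_add (ι (M u)) (ι (M v))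
    have h2 := Lp.coeFn_add (ι u) (ι v)
    rw [← map_add] at h2
    filter_upwards [h1, h2, hM (u + v), hM u, hM v] with x h1 h2 h3 h4 h5
    rw [h1, h3, h2, Pi.add_apply, Pi.add_apply, h4, h5]
    ring
  · rw [map_smul]
    have h1 := Lp.coeFn_smul c (ι (M u))
    have h2 := Lp.coeFn_smul c (ι u)
    rw [← map_smul] at h2
    filter_upwards [h1, h2, hM (c • u), hM u] with x h1 h2 h3 h4
    rw [RingHom.id_apply, h1, h3, h2, Pi.smul_apply, Pi.smul_apply, h4, smul_eq_mul, smul_eq_mul]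
    ring

theorem integrable_coe_Lp_top (f : Lp ℂ (⊤ : ℝ≥0∞) m) : Integrable f m :=
  (Lp.memLp f).integrable le_top

theorem isFunctional_one (h : ∃ C : ℝ, ∀ u : H₀, ‖∫ x, ι u x ∂m‖ ≤ C * ‖u‖) :
    ∃ φ : H₀ →L[ℂ] ℂ, ∀ u, φ u = ∫ x, ι u x ∂m := by
  obtain ⟨C, hC⟩ := h
  refine ⟨LinearMap.mkContinuous
    { toFun := fun u => ∫ x, ι u x ∂m
      map_add' := fun u v => ?_
      map_smul' := fun c u => ?_ } C hC, fun u => rfl⟩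
  · rw [map_add, integral_congr_ae (Lp.coeFn_add _ _)]
    exact integral_add (integrable_coe_Lp_top _) (integrable_coe_Lp_top _)
  · rw [map_smul, integral_congr_ae (Lp.coeFn_smul _ _)]
    exact integral_smul c fun x => ι u x

theorem IsMultiplier.isFunctional {g : Y → ℝ} (hg : IsMultiplier ι g)
    (h : ∃ C : ℝ, ∀ u : H₀, ‖∫ x, ι u x ∂m‖ ≤ C * ‖u‖) : IsFunctional ι g := by
  obtain ⟨φ, hφ⟩ := isFunctional_one h
  obtain ⟨M, hM⟩ := hg
  exact ⟨φ ∘L M, fun u => (hφ _).trans (integral_congr_ae (hM u))⟩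

theorem IsMultiplier.multiplication_coe {g : Y → ℝ} (hg : IsMultiplier ι g) (u : H₀) :
    ∃ w : H₀, multiplication ι g u = w ∧ ∀ᵐ x ∂m, ι w x = g x * ι u x := by
  rw [multiplication, dif_pos hg]
  exact ⟨_, ContinuousLinearMap.completion_apply_coe _ u, hg.choose_spec u⟩

theorem IsFunctional.integration_coe {g : Y → ℝ} (hg : IsFunctional ι g) (u : H₀) :
    integration ι g u = ∫ x, g x * ι u x ∂m := by
  rw [integration, dif_pos hg, ← hg.choose_spec u]
  exact ContinuousLinearMap.extend_eq _ Completion.denseRange_coe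
    (Completion.isUniformInducing_coe H₀) u

theorem integration_multiplication {g h : Y → ℝ} (hg : IsMultiplier ι g) (hh : IsFunctional ι h)
    (hgh : IsFunctional ι fun x => g x * h x) (w : Completion H₀) :
    integration ι h (multiplication ι g w) = integration ι (fun x => g x * h x) w := by
  induction w using Completion.induction_on with
  | hp => exact isClosed_eq (by fun_prop) (by fun_prop)
  | ih u =>
    obtain ⟨v, hv, hv'⟩ := hg.multiplication_coe u
    rw [hv, hh.integration_coe, hgh.integration_coe]
    refine integral_congr_ae ?_
    filter_upwards [hv'] with x hx
    rw [hx]; push_cast; ring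

theorem isClosed_positiveCone : IsClosed (positiveCone ι) := isClosed_closure

theorem coe_mem_positiveCone {u : H₀} (hu : IsNonneg ι u) : (u : Completion H₀) ∈ positiveCone ι :=
  subset_closure (mem_image_of_mem _ hu)

theorem add_mem_positiveCone {v w : Completion H₀} (hv : v ∈ positiveCone ι) (hw : w ∈ positiveCone ι) :
    v + w ∈ positiveCone ι := by
  refine map_mem_closure₂ continuous_add hv hw ?_
  rintro _ ⟨a, ha, rfl⟩ _ ⟨b, hb, rfl⟩
  refine ⟨a + b, show IsNonneg ι _ from ?_, Completion.coe_add a b⟩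
  have h1 := Lp.coeFn_add (ι a) (ι b)
  rw [← map_add] at h1
  filter_upwards [h1, ha, hb] with x hx ⟨r, hr, hr'⟩ ⟨s, hs, hs'⟩
  exact ⟨r + s, add_nonneg hr hs, by rw [hx, Pi.add_apply, hr', hs']; push_cast; rfl⟩

theorem smul_mem_positiveCone (c : ℝ≥0) {w : Completion H₀} (hw : w ∈ positiveCone ι) :
    ((c : ℝ) : ℂ) • w ∈ positiveCone ι := by
  refine map_mem_closure (continuous_const_smul _) hw ?_
  rintro _ ⟨a, ha, rfl⟩
  refine ⟨((c : ℝ) : ℂ) • a, show IsNonneg ι _ from ?_, Completion.coe_smul _ a⟩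
  have h1 := Lp.coeFn_smul ((c : ℝ) : ℂ) (ι a)
  rw [← map_smul] at h1
  filter_upwards [h1, ha] with x hx ⟨r, hr, hr'⟩
  exact ⟨c * r, mul_nonneg c.2 hr, by rw [hx, Pi.smul_apply, hr', smul_eq_mul]; push_cast; rfl⟩

theorem multiplication_mem_positiveCone {g : Y → ℝ} (hg : IsMultiplier ι g) (h0 : ∀ y, 0 ≤ g y)
    {w : Completion H₀} (hw : w ∈ positiveCone ι) : multiplication ι g w ∈ positiveCone ι := by
  refine map_mem_closure (multiplication ι g).continuous hw ?_
  rintro _ ⟨a, ha, rfl⟩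
  obtain ⟨v, hv, hv'⟩ := hg.multiplication_coe a
  refine ⟨v, show IsNonneg ι _ from ?_, hv.symm⟩
  filter_upwards [hv', ha] with x hx ⟨r, hr, hr'⟩
  exact ⟨g x * r, mul_nonneg (h0 x) hr, by rw [hx, hr']; push_cast; rfl⟩

variable {T : Y → Y} {L : H₀ →L[ℂ] H₀}

theorem IsNonneg.ae_eq {u : H₀} (hu : IsNonneg ι u) :
    ∀ᵐ x ∂m, 0 ≤ (ι u x).re ∧ ι u x = ((ι u x).re : ℂ) := by
  filter_upwards [hu] with x ⟨r, hr, h⟩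
  rw [h]
  exact ⟨by simpa using hr, by simp⟩

/-- The integral of the image over `A` is that of `u` over `T ⁻¹' A`, a nonnegative real. Real and
imaginary parts are then controlled by their integrals over all measurable sets. -/
theorem IsNonneg.transfer (hT : Measurable T) {u w : H₀} (hL : IsTransfer T m (ι u) (ι w))
    (hu : IsNonneg ι u) : IsNonneg ι w := by
  have key : ∀ A : Set Y, MeasurableSet A →
      ∫ x in A, ι w x ∂m = ((∫ x in T ⁻¹' A, (ι u x).re ∂m : ℝ) : ℂ) := by
    intro A hA
    have h1 := hL (A.indicator 1) (measurable_one.indicator hA) ⟨1, fun x => by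
      by_cases hx : x ∈ A <;> simp [hx]⟩
    have e1 : ∫ x, ι w x * A.indicator 1 x ∂m = ∫ x in A, ι w x ∂m := by
      rw [← integral_indicator hA]
      refine integral_congr_ae (.of_forall fun x => ?_)
      by_cases hx : x ∈ A <;> simp [hx]
    have e2 : ∫ x, ι u x * A.indicator 1 (T x) ∂m = ∫ x in T ⁻¹' A, ι u x ∂m := by
      rw [← integral_indicator (hT hA)]
      refine integral_congr_ae (.of_forall fun x => ?_)
      by_cases hx : T x ∈ A <;> simp [hx]
    rw [← e1, h1, e2, ← integral_complex_ofReal]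
    exact integral_congr_ae (ae_restrict_of_ae (hu.ae_eq.mono fun x hx => hx.2))
  have hint := integrable_coe_Lp_top (ι w)
  have hre : 0 ≤ᵐ[m] fun x => (ι w x).re := by
    refine ae_nonneg_of_forall_setIntegral_nonneg hint.re fun A hA _ => ?_
    have h1 : ∫ x in A, (ι w x).re ∂m = (∫ x in A, ι w x ∂m).re := integral_re hint.integrableOn
    change 0 ≤ ∫ x in A, (ι w x).re ∂m
    rw [h1, key A hA, Complex.ofReal_re]
    exact integral_nonneg_of_ae (ae_restrict_of_ae (hu.ae_eq.mono fun x hx => hx.1))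
  have him : (fun x => (ι w x).im) =ᵐ[m] 0 := by
    refine Integrable.ae_eq_zero_of_forall_setIntegral_eq_zero hint.im fun A hA _ => ?_
    have h1 : ∫ x in A, (ι w x).im ∂m = (∫ x in A, ι w x ∂m).im := integral_im hint.integrableOn
    change ∫ x in A, (ι w x).im ∂m = 0
    rw [h1, key A hA, Complex.ofReal_im]
  filter_upwards [hre, him] with x h1 h2
  exact ⟨(ι w x).re, h1, Complex.ext rfl (by simpa using h2)⟩

theorem completion_mem_positiveCone (hT : Measurable T) (hL : ∀ u, IsTransfer T m (ι u) (ι (L u)))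
    {w : Completion H₀} (hw : w ∈ positiveCone ι) : L.completion w ∈ positiveCone ι := by
  refine map_mem_closure L.completion.continuous hw ?_
  rintro _ ⟨a, ha, rfl⟩
  exact ⟨L a, IsNonneg.transfer hT (hL a) ha, (ContinuousLinearMap.completion_apply_coe L a).symm⟩

variable (ι) in
/-- The measure with density `u`, for nonnegative `u ∈ H₀`. -/
def densityMeasure (u : H₀) : Measure Y := m.withDensity fun x => ENNReal.ofReal (ι u x).re

instance (u : H₀) : IsFiniteMeasure (densityMeasure ι u) :=
  isFiniteMeasure_withDensity_ofReal (integrable_coe_Lp_top (ι u)).re.2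

variable (ι) in
theorem aemeasurable_ofReal_re (u : H₀) : AEMeasurable (fun x => ENNReal.ofReal (ι u x).re) m :=
  (integrable_coe_Lp_top (ι u)).re.1.aemeasurable.ennreal_ofReal

theorem integral_densityMeasure {u : H₀} (hu : IsNonneg ι u) (g : Y → ℝ) :
    ((∫ x, g x ∂densityMeasure ι u : ℝ) : ℂ) = ∫ x, g x * ι u x ∂m := by
  rw [densityMeasure, integral_withDensity_eq_integral_toReal_smul₀ (aemeasurable_ofReal_re ι u)
    (.of_forall fun y => ENNReal.ofReal_lt_top), ← integral_complex_ofReal]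
  refine integral_congr_ae ?_
  filter_upwards [hu.ae_eq] with x ⟨h1, h2⟩
  rw [ENNReal.toReal_ofReal h1, smul_eq_mul, mul_comm]
  push_cast
  rw [← h2]

theorem integral_map_densityMeasure (hT : Measurable T) {u w : H₀} (hL : IsTransfer T m (ι u) (ι w))
    (hu : IsNonneg ι u) {g : Y → ℝ} (hg : Measurable g) {M : ℝ} (hM : ∀ x, |g x| ≤ M) :
    ∫ x, g x ∂(densityMeasure ι u).map T = ∫ x, g x ∂densityMeasure ι w := by
  have h1 := hL (fun x => (g x : ℂ)) (Complex.measurable_ofReal.comp hg)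
    ⟨M, fun x => by rw [Complex.norm_real]; exact hM x⟩
  rw [integral_map hT.aemeasurable hg.aestronglyMeasurable]
  apply Complex.ofReal_injective
  rw [integral_densityMeasure hu fun x => g (T x), integral_densityMeasure (hu.transfer hT hL)]
  simpa only [mul_comm] using h1.symm

end Completion

/-! ### From the normed space to the abstract setting -/

section

open UniformSpace

variable {Y : Type*} [TopologicalSpace Y] [MeasurableSpace Y]
  [TopologicalSpace.PseudoMetrizableSpace Y] [BorelSpace Y] {m : Measure Y} [IsFiniteMeasure m]
  {H₀ : Type*} [NormedAddCommGroup H₀] [NormedSpace ℂ H₀] {ι : H₀ →ₗ[ℂ] Lp ℂ (⊤ : ℝ≥0∞) m}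
  {T : Y → Y} {S : Set (Y → ℝ)} {L : H₀ →L[ℂ] H₀}

/-- A representing measure is chosen for each positive element of the completion; test functions
determine it, so the choices satisfy all compatibilities required by the abstract setting. -/
theorem hasPhysicalDescription_of_representation (hS : IsTestClass S)
    (hT : Measure.QuasiMeasurePreserving T m m) (hmul : ∀ g ∈ S, IsMultiplier ι g)
    (hint : ∃ C : ℝ, ∀ u : H₀, ‖∫ x, ι u x ∂m‖ ≤ C * ‖u‖)
    (hL : ∀ u, IsTransfer T m (ι u) (ι (L u))) (hLbdd : ∃ C : ℝ, ∀ n : ℕ, ‖L ^ n‖ ≤ C)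
    (hess : essentialSpectralRadius L.completion < 1)
    (hcut : ∃ f₀ : H₀, ∃ N₀ : ℕ, IsNonneg ι f₀ ∧ ∀ᵐ x ∂m, x ∈ range T^[N₀] → ι f₀ x = 1)
    (hmeas : ∀ w ∈ positiveCone ι, ∃ ν : Measure Y, IsFiniteMeasure ν ∧
      (∀ᵐ y ∂ν, ContinuousAt T y) ∧ ∀ g ∈ S, integration ι g w = ((∫ y, g y ∂ν : ℝ) : ℂ)) :
    HasPhysicalDescription T m := by
  classical
  have hTm := hT.measurable
  have hfun : ∀ g ∈ S, IsFunctional ι g := fun g hg => (hmul g hg).isFunctional hint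
  have hex : ∀ w : Completion H₀, ∃ ν : Measure Y, IsFiniteMeasure ν ∧ (w ∈ positiveCone ι →
      (∀ᵐ y ∂ν, ContinuousAt T y) ∧ ∀ g ∈ S, integration ι g w = ((∫ y, g y ∂ν : ℝ) : ℂ)) := fun w => by
    by_cases hw : w ∈ positiveCone ι
    · obtain ⟨ν, h1, h2⟩ := hmeas w hw
      exact ⟨ν, h1, fun _ => h2⟩
    · exact ⟨0, inferInstance, fun h => absurd h hw⟩
  choose μ hμf hμ using hex
  have hcoe : ∀ u : H₀, IsNonneg ι u → μ u = densityMeasure ι u := fun u hu =>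
    hS.measure_ext fun g hg => by
      apply Complex.ofReal_injective
      rw [← (hμ u (coe_mem_positiveCone hu)).2 g hg, (hfun g hg).integration_coe,
        integral_densityMeasure hu]
  have hlim : ∀ (w : ℕ → Completion H₀) (w₀ : Completion H₀), (∀ k, w k ∈ positiveCone ι) →
      w₀ ∈ positiveCone ι → Tendsto w atTop (𝓝 w₀) → WeakTendsto S (fun k => μ (w k)) (μ w₀) := by
    intro w w₀ hw hw₀ h g hg
    have h1 := (Complex.continuous_re.tendsto _).comp
      (((integration ι g).continuous.tendsto w₀).comp h)
    simpa only [Function.comp_def, (hμ _ hw₀).2 g hg, (hμ _ (hw _)).2 g hg, Complex.ofReal_re] using h1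
  -- On densities this is the duality defining the transfer operator. It passes to the limit because
  -- the limit measure ignores the discontinuities of `T`, so pushing forward by `T` is continuous
  -- there.
  have hμL : ∀ w ∈ positiveCone ι, μ (L.completion w) = (μ w).map T := by
    intro w hw
    obtain ⟨v, hv, hvw⟩ := mem_closure_iff_seq_limit.1 hw
    choose u hu huv using hv
    have h1 := (hlim v w (fun k => huv k ▸ coe_mem_positiveCone (hu k)) hw hvw).map hS hTm (hμ w hw).1
    have h2 := hlim (fun k => L.completion (v k)) _
      (fun k => completion_mem_positiveCone hTm hL (huv k ▸ coe_mem_positiveCone (hu k)))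
      (completion_mem_positiveCone hTm hL hw) ((L.completion.continuous.tendsto w).comp hvw)
    refine WeakTendsto.unique hS h2 fun g hg => (h1 g hg).congr fun k => ?_
    simp only [← huv k]
    rw [ContinuousLinearMap.completion_apply_coe, hcoe _ (hu k),
      hcoe _ (IsNonneg.transfer hTm (hL _) (hu k))]
    refine integral_map_densityMeasure hTm (hL _) (hu k) (hS.measurable hg) (M := 1) fun x => ?_
    rw [abs_of_nonneg (hS.mem_Icc g hg x).1]
    exact (hS.mem_Icc g hg x).2
  let D : TransferModel T S (Completion H₀) :=
    { L := L.completion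
      mul := multiplication ι
      pair := integration ι
      cone := positiveCone ι
      meas := μ
      isClosed_cone := isClosed_positiveCone
      add_mem := fun v hv w hw => add_mem_positiveCone hv hw
      smul_mem := fun c w hw => smul_mem_positiveCone c hw
      L_mem := fun w hw => completion_mem_positiveCone hTm hL hw
      mul_mem := fun g hg w hw =>
        multiplication_mem_positiveCone (hmul g hg) (fun y => (hS.mem_Icc g hg y).1) hw
      isFiniteMeasure := hμf
      pair_eq := fun g hg w hw => (hμ w hw).2 g hg
      ae_continuousAt := fun w hw => (hμ w hw).1
      meas_L := hμL
      pair_mul := fun g hg h hh w _ =>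
        integration_multiplication (hmul g hg) (hfun h hh) (hfun _ (hS.mul_mem g hg h hh)) w }
  obtain ⟨f₀, N₀, hf₀, hN₀⟩ := hcut
  obtain ⟨C, hC⟩ := hLbdd
  refine D.hasPhysicalDescription hS ⟨C, fun n => ?_⟩ hess hT (coe_mem_positiveCone hf₀)
    (aemeasurable_ofReal_re ι f₀) (hcoe f₀ hf₀) (N₀ := N₀) ?_
  · change ‖L.completion ^ n‖ ≤ C
    rw [ContinuousLinearMap.completion_pow]
    exact (ContinuousLinearMap.norm_completion_le _).trans (hC n)
  · filter_upwards [hN₀] with x hx hr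
    rw [hx hr]
    simp

end

/-! ### Smooth test functions on the manifold -/

section Manifold

variable {d : ℕ} {X : Type*} [TopologicalSpace X] [ChartedSpace (EuclideanSpace ℝ (Fin d)) X]

theorem IsHolder.continuous {α : ℝ} {f : X → ℝ} (hf : IsHolder d α f) : Continuous f := by
  refine continuous_iff_continuousAt.2 fun x => ?_
  have h := (hf _ (chart_mem_atlas (EuclideanSpace ℝ (Fin d)) x)).1.continuousOn
  set e := chartAt (EuclideanSpace ℝ (Fin d)) x with he
  have hx : x ∈ e.source := mem_chart_source _ x
  have h1 : ContinuousAt (f ∘ e.symm) (e x) := h.continuousAt (e.open_target.mem_nhds (e.map_source hx))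
  have h2 : ContinuousAt ((f ∘ e.symm) ∘ e) x := h1.comp (e.continuousAt hx)
  refine h2.congr ?_
  filter_upwards [e.open_source.mem_nhds hx] with y hy
  simp [e.left_inv hy]

/-- A `C¹` map is Lipschitz on a compact set, and the bounded diameter turns this into a Hölder
bound of any exponent at most one. The derivative of order `[α]` of a smooth function is treated
this way. -/
theorem exists_holder_bound {E F : Type*} [NormedAddCommGroup E] [NormedSpace ℝ E]
    [NormedAddCommGroup F] [NormedSpace ℝ F] {D : E → F} {K : Set E} (hK : IsCompact K)
    (hD : ∀ x ∈ K, ContDiffAt ℝ 1 D x) {β : ℝ} (h0 : 0 ≤ β) (h1 : β ≤ 1) :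
    ∃ M : ℝ, ∀ x ∈ K, ∀ y ∈ K, ‖D x - D y‖ ≤ M * ‖x - y‖ ^ β := by
  have hloc : LocallyLipschitzOn K D := fun x hx => by
    obtain ⟨c, t, ht, hl⟩ := (hD x hx).exists_lipschitzOnWith
    exact ⟨c, t, mem_nhdsWithin_of_mem_nhds ht, hl⟩
  obtain ⟨c, hc⟩ := LocallyLipschitzOn.exists_lipschitzOnWith_of_compact hK hloc
  refine ⟨c * Metric.diam K ^ (1 - β), fun x hx y hy => ?_⟩
  have h2 := hc.dist_le_mul x hx y hy
  rw [dist_eq_norm, dist_eq_norm] at h2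
  have h3 : ‖x - y‖ ≤ Metric.diam K := by
    rw [← dist_eq_norm]; exact Metric.dist_le_diam_of_mem hK.isBounded hx hy
  refine h2.trans ?_
  rw [mul_assoc]
  refine mul_le_mul_of_nonneg_left ?_ c.2
  calc ‖x - y‖ = ‖x - y‖ ^ (1 - β) * ‖x - y‖ ^ β := by
        rw [← Real.rpow_add_of_nonneg (norm_nonneg _) (by linarith) h0, sub_add_cancel, Real.rpow_one]
    _ ≤ _ := mul_le_mul_of_nonneg_right (Real.rpow_le_rpow (norm_nonneg _) h3 (by linarith))
        (Real.rpow_nonneg (norm_nonneg _) _)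

theorem ContMDiff.isHolder [IsManifold (𝓡 d) (⊤ : ℕ∞) X] {α : ℝ} (hα : 0 ≤ α) {f : X → ℝ}
    (hf : ContMDiff (𝓡 d) 𝓘(ℝ, ℝ) (⊤ : ℕ∞) f) : IsHolder d α f := by
  intro e he
  have h1 : ContMDiffOn (𝓡 d) (𝓡 d) (⊤ : ℕ∞) e.symm e.target :=
    contMDiffOn_symm_of_mem_maximalAtlas (IsManifold.subset_maximalAtlas he)
  have h2 : ContDiffOn ℝ (⊤ : ℕ∞) (f ∘ e.symm) e.target :=
    contMDiffOn_iff_contDiffOn.1 (hf.comp_contMDiffOn h1)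
  refine ⟨h2.of_le (by exact_mod_cast le_top), fun K hK hKc =>
    exists_holder_bound hKc (fun x hx => ?_) (sub_nonneg.2 (Nat.floor_le hα)) ?_⟩
  · refine (h2.contDiffAt (e.open_target.mem_nhds (hK hx))).iteratedFDeriv_right ?_
    exact_mod_cast le_top
  · linarith [Nat.lt_floor_add_one α]

variable [MeasurableSpace X] [BorelSpace X] {Leb : Measure X}

theorem IsLebesgueMeasure.isLocallyFiniteMeasure (h : IsLebesgueMeasure d Leb) :
    IsLocallyFiniteMeasure Leb := by
  refine ⟨fun x => ?_⟩
  obtain ⟨ρ, hρ, -, hA⟩ := h _ (chart_mem_atlas (EuclideanSpace ℝ (Fin d)) x)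
  set e := chartAt (EuclideanSpace ℝ (Fin d)) x with he
  have hx : x ∈ e.source := mem_chart_source _ x
  have hex : e x ∈ e.target := e.map_source hx
  have h1 : ∀ᶠ y in 𝓝 (e x), ρ y < ρ (e x) + 1 :=
    (hρ.continuousAt (e.open_target.mem_nhds hex)).eventually_lt_const (lt_add_one _)
  obtain ⟨V, hV, hVo, hxV⟩ := eventually_nhds_iff.1
    (h1.and ((Metric.ball_mem_nhds (e x) one_pos)))
  have hU : IsOpen (e.source ∩ e ⁻¹' V) := e.isOpen_inter_preimage hVo
  refine ⟨e.source ∩ e ⁻¹' V, hU.mem_nhds ⟨hx, hxV⟩, ?_⟩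
  rw [hA _ hU.measurableSet inter_subset_left]
  have hsub : e '' (e.source ∩ e ⁻¹' V) ⊆ V := by
    rintro _ ⟨z, hz, rfl⟩; exact hz.2
  calc ∫⁻ y in e '' (e.source ∩ e ⁻¹' V), (ρ y : ℝ≥0∞) ∂volume
      ≤ ∫⁻ y in V, (ρ y : ℝ≥0∞) ∂volume := lintegral_mono_set hsub
    _ ≤ ∫⁻ y in V, ((ρ (e x) + 1 : ℝ≥0) : ℝ≥0∞) ∂volume :=
        setLIntegral_mono measurable_const fun y hy => by exact_mod_cast (hV y hy).1.le
    _ = (ρ (e x) + 1 : ℝ≥0) * volume V := setLIntegral_const _ _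
    _ < ⊤ := ENNReal.mul_lt_top ENNReal.coe_lt_top
        ((measure_mono fun y hy => (hV y hy).2).trans_lt measure_ball_lt_top)

theorem IsLebesgueMeasure.isFiniteMeasure_lebOn (h : IsLebesgueMeasure d Leb) {X₀ : Set X}
    (hX₀ : IsOpen X₀) (hc : IsCompact (closure X₀)) : IsFiniteMeasure (lebOn Leb X₀) := by
  have := h.isLocallyFiniteMeasure
  refine ⟨?_⟩
  rw [lebOn, comap_subtype_coe_apply hX₀.measurableSet, image_univ, Subtype.range_coe]
  exact (measure_mono subset_closure).trans_lt hc.measure_lt_top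

/-- The restrictions to `X₀` of the smooth functions with values in `[0, 1]`. -/
def smoothTestFunctions (d : ℕ) {X : Type*} [TopologicalSpace X]
    [ChartedSpace (EuclideanSpace ℝ (Fin d)) X] (X₀ : Set X) : Set (X₀ → ℝ) :=
  {g | ∃ f : X → ℝ, ContMDiff (𝓡 d) 𝓘(ℝ, ℝ) (⊤ : ℕ∞) f ∧ (∀ x, f x ∈ Icc (0 : ℝ) 1) ∧
    g = fun x : X₀ => f x}

theorem isTestClass_smoothTestFunctions [T2Space X] [SecondCountableTopology X]
    [IsManifold (𝓡 d) (⊤ : ℕ∞) X] {X₀ : Set X} (hX₀ : IsOpen X₀) (hc : IsCompact (closure X₀)) :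
    IsTestClass (smoothTestFunctions d X₀) where
  continuous := by
    rintro _ ⟨f, hf, -, rfl⟩
    exact hf.continuous.comp continuous_subtype_val
  mem_Icc := by
    rintro _ ⟨f, -, hf, rfl⟩ y
    exact hf y
  one_mem := ⟨fun _ => 1, contMDiff_const, fun x => by simp, rfl⟩
  one_sub_mem := by
    rintro _ ⟨f, hf, hI, rfl⟩
    exact ⟨fun x => 1 - f x, contMDiff_const.sub hf,
      fun x => ⟨by linarith [(hI x).2], by linarith [(hI x).1]⟩, rfl⟩
  mul_mem := by
    rintro _ ⟨f, hf, hI, rfl⟩ _ ⟨g, hg, hJ, rfl⟩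
    exact ⟨fun x => f x * g x, hf.mul hg,
      fun x => ⟨mul_nonneg (hI x).1 (hJ x).1, mul_le_one₀ (hI x).2 (hJ x).1 (hJ x).2⟩, rfl⟩
  exists_below := by
    intro ν hν G hG ε hε
    have : LocallyCompactSpace X := ChartedSpace.locallyCompactSpace (EuclideanSpace ℝ (Fin d)) X
    have : SigmaCompactSpace X := inferInstance
    have : TopologicalSpace.MetrizableSpace X := Manifold.metrizableSpace (𝓡 d) X
    have hGo : IsOpen ((↑) '' G : Set X) := hX₀.isOpenMap_subtype_val G hG
    set ν' : Measure X := ν.map (↑) with hν'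
    have hνG : ν' ((↑) '' G) = ν G := by
      rw [hν', Measure.map_apply measurable_subtype_coe hGo.measurableSet,
        preimage_image_eq _ Subtype.val_injective]
    -- Inner regularity by closed sets, followed by a smooth Urysohn function equal to one on `F`
    -- and to zero off `G`.
    obtain ⟨F, hFG, hF, hlt⟩ := hGo.measurableSet.exists_isClosed_lt_add (measure_ne_top ν' _)
      (ε := ENNReal.ofReal ε) (by simpa using hε)
    obtain ⟨f, hf0, hf1, hfI⟩ := exists_contMDiffMap_zero_one_of_isClosed (n := (⊤ : ℕ∞)) (𝓡 d)
      hGo.isClosed_compl hF (disjoint_compl_left_iff_subset.2 hFG)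
    refine ⟨fun x => f x, ⟨f, f.contMDiff, hfI, rfl⟩, fun y hy => hf0 fun hy' => hy ?_, ?_⟩
    · obtain ⟨z, hz, hzy⟩ := hy'
      rwa [← Subtype.val_injective hzy]
    · have h1 : ν'.real F ≤ ∫ y : X₀, f y ∂ν := by
        have hm : MeasurableSet ((↑) ⁻¹' F : Set X₀) := measurable_subtype_coe hF.measurableSet
        rw [hν', map_measureReal_apply measurable_subtype_coe hF.measurableSet, ← integral_indicator_one hm]
        refine integral_mono ((integrable_const (1 : ℝ)).indicator hm)
          (integrable_of_measurable_of_mem_Icc (f.contMDiff.continuous.measurable.comp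
            measurable_subtype_coe) fun y => hfI y) fun y => ?_
        by_cases hy : (y : X) ∈ F
        · have := hf1 hy
          simp [hy, this]
        · simpa [hy] using (hfI y).1
      have h2 : ν.real G ≤ ν'.real F + ε := by
        rw [hνG] at hlt
        have h3 := (ENNReal.toReal_le_toReal (measure_ne_top _ _)
          (ENNReal.add_ne_top.2 ⟨measure_ne_top _ _, ENNReal.ofReal_ne_top⟩)).2 hlt.le
        rwa [ENNReal.toReal_add (measure_ne_top _ _) ENNReal.ofReal_ne_top,
          ENNReal.toReal_ofReal hε.le] at h3
      linarith
  exists_countable := by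
    have : LocallyCompactSpace X := ChartedSpace.locallyCompactSpace (EuclideanSpace ℝ (Fin d)) X
    have : SigmaCompactSpace X := inferInstance
    have : CompactSpace (closure X₀) := isCompact_iff_compactSpace.1 hc
    -- Compactness of `closure X₀` makes the continuous functions on it a separable metric space, so
    -- the restrictions of test functions have a countable uniformly dense subset.
    let r : {f : X → ℝ // ContMDiff (𝓡 d) 𝓘(ℝ, ℝ) (⊤ : ℕ∞) f ∧ ∀ x, f x ∈ Icc (0 : ℝ) 1} →
      C(closure X₀, ℝ) := fun f => ⟨fun x => f.1 x, f.2.1.continuous.comp continuous_subtype_val⟩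
    obtain ⟨t, htc, htd⟩ := TopologicalSpace.exists_countable_dense (range r)
    have hpre : ∀ z : range r, ∃ f, r f = z := fun z => z.2
    choose f hf using hpre
    refine ⟨(fun z => fun x : X₀ => (f z).1 x) '' t, ?_, htc.image _, ?_⟩
    · rintro _ ⟨z, -, rfl⟩
      exact ⟨_, (f z).2.1, (f z).2.2, rfl⟩
    · rintro _ ⟨g, hg, hI, rfl⟩ ε hε
      obtain ⟨z, hz, hzt⟩ := Metric.mem_closure_iff.1 (htd ⟨r ⟨g, hg, hI⟩, mem_range_self _⟩) ε hε
      refine ⟨_, ⟨z, hz, rfl⟩, fun y => ?_⟩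
      have h1 : dist (r ⟨g, hg, hI⟩) (r (f z)) < ε := by rw [hf z]; exact hzt
      have h2 := (ContinuousMap.dist_apply_le_dist (f := r ⟨g, hg, hI⟩) (g := r (f z))
        ⟨y, subset_closure y.2⟩).trans h1.le
      rwa [Real.dist_eq] at h2

end Manifold

/-! ### Measures representing limits of nonnegative functions -/

section Representation

open UniformSpace

theorem pairing_eq_integration {X : Type*} [MeasurableSpace X] {X₀ : Set X} {m : Measure X₀}
    [IsFiniteMeasure m]
    {H₀ : Type*} [NormedAddCommGroup H₀] [NormedSpace ℂ H₀] {ι : H₀ →ₗ[ℂ] Lp ℂ (⊤ : ℝ≥0∞) m}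
    {g : X → ℝ} (hg : IsFunctional ι fun x : X₀ => g x) (u : Completion H₀) :
    pairing ι g u = integration ι (fun x : X₀ => g x) u := by
  have hu : UniformContinuous fun u : H₀ => ∫ x : X₀, (g x : ℂ) * ι u x ∂m := by
    obtain ⟨φ, hφ⟩ := hg
    simpa only [← hφ] using φ.uniformContinuous
  induction u using Completion.induction_on with
  | hp => exact isClosed_eq Completion.continuous_extension (by fun_prop)
  | ih u => rw [pairing, Completion.extension_coe hu, hg.integration_coe]

variable {X : Type*} [TopologicalSpace X] [T2Space X] [MeasurableSpace X] [BorelSpace X]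

/-- A limit of nonnegative elements of `H₀` is represented by a measure on the closure of `X₀`. -/
theorem exists_measure_of_mem_positiveCone {X₀ : Set X} {m : Measure X₀} [IsFiniteMeasure m]
    (hc : IsCompact (closure X₀)) {H₀ : Type*} [NormedAddCommGroup H₀] [NormedSpace ℂ H₀]
    {ι : H₀ →ₗ[ℂ] Lp ℂ (⊤ : ℝ≥0∞) m} {G : Set (X → ℝ)} (hGc : ∀ g ∈ G, Continuous g)
    (hG : ∀ g ∈ G, IsFunctional ι fun x : X₀ => g x) (hG1 : (fun _ => 1) ∈ G)
    {w : Completion H₀} {u : ℕ → H₀} (hu : ∀ n, IsNonneg ι (u n))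
    (huw : Tendsto (fun n => (u n : Completion H₀)) atTop (𝓝 w)) :
    ∃ μ : Measure X, IsFiniteMeasure μ ∧ μ (closure X₀)ᶜ = 0 ∧
      ∀ g ∈ G, pairing ι g w = ((∫ x, g x ∂μ : ℝ) : ℂ) := by
  have : CompactSpace (closure X₀) := isCompact_iff_compactSpace.1 hc
  set j : X₀ → closure X₀ := Set.inclusion subset_closure with hj
  have hjc : Continuous j := continuous_inclusion _
  let ν : ℕ → FiniteMeasure (closure X₀) := fun n =>
    ⟨(densityMeasure ι (u n)).map j, inferInstance⟩
  have hint : ∀ n, ∀ g ∈ G, ∫ x : closure X₀, g x ∂(ν n : Measure (closure X₀))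
      = (integration ι (fun x : X₀ => g x) (u n)).re := fun n g hg => by
    change ∫ x : closure X₀, g x ∂(densityMeasure ι (u n)).map j = _
    have hgz : Continuous fun x : closure X₀ => g x := (hGc g hg).comp continuous_subtype_val
    rw [integral_map hjc.measurable.aemeasurable hgz.measurable.aestronglyMeasurable,
      (hG g hg).integration_coe, ← integral_densityMeasure (hu n) fun x : X₀ => g x, Complex.ofReal_re]
  have hlim : ∀ g ∈ G, Tendsto (fun n => integration ι (fun x : X₀ => g x) (u n)) atTop
      (𝓝 (integration ι (fun x : X₀ => g x) w)) := fun g _ =>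
    ((integration ι _).continuous.tendsto w).comp huw
  have hmass : ∀ n, ((ν n).mass : ℝ) = (integration ι (fun x : X₀ => (1 : ℝ)) (u n)).re := fun n => by
    rw [← hint n _ hG1]
    simp [FiniteMeasure.mass, Measure.real]
    rfl
  obtain ⟨M, hM⟩ : ∃ M : ℝ≥0, ∀ n, (ν n).mass ≤ M := by
    obtain ⟨M, hM⟩ := ((Complex.continuous_re.tendsto _).comp (hlim _ hG1)).bddAbove_range
    refine ⟨M.toNNReal, fun n => NNReal.coe_le_coe.1 ?_⟩
    rw [hmass n]
    exact (hM (mem_range_self n)).trans (Real.le_coe_toNNReal M)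
  -- The densities, pushed to the compact `closure X₀`, have bounded mass and lie in a compact set
  -- of measures. An ultrafilter limit suffices: the integrals converge along `atTop`, so their
  -- limits are unchanged along a finer filter.
  obtain ⟨μ, -, hμ⟩ := (isCompact_setOfPred_finiteMeasure_le_of_compactSpace (closure X₀) M).ultrafilter_le_nhds'
    (Ultrafilter.map ν (Filter.hyperfilter ℕ)) (Ultrafilter.mem_map.2 (Filter.univ_mem' hM))
  have hμt : Tendsto ν (Filter.hyperfilter ℕ) (𝓝 μ) := hμ
  have hle : (Filter.hyperfilter ℕ : Filter ℕ) ≤ atTop := by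
    rw [← Nat.cofinite_eq_atTop]; exact Filter.hyperfilter_le_cofinite
  refine ⟨(μ : Measure (closure X₀)).map (↑), inferInstance, ?_, fun g hg => ?_⟩
  · rw [Measure.map_apply measurable_subtype_coe isClosed_closure.measurableSet.compl]
    convert measure_empty (μ := (μ : Measure (closure X₀)))
    ext x
    simp
  · have hgz : Continuous fun x : closure X₀ => g x := (hGc g hg).comp continuous_subtype_val
    have h1 := FiniteMeasure.tendsto_iff_forall_integral_tendsto.1 hμt
      (BoundedContinuousFunction.mkOfCompact ⟨fun x : closure X₀ => g x, hgz⟩)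
    simp only [BoundedContinuousFunction.mkOfCompact_apply, ContinuousMap.coe_mk] at h1
    have h2 : Tendsto (fun n => ((∫ x : closure X₀, g x ∂(ν n : Measure (closure X₀)) : ℝ) : ℂ)) atTop
        (𝓝 (integration ι (fun x : X₀ => g x) w)) := by
      refine (hlim g hg).congr fun n => ?_
      rw [hint n g hg, (hG g hg).integration_coe, ← integral_densityMeasure (hu n) fun x : X₀ => g x,
        Complex.ofReal_re]
    rw [pairing_eq_integration (hG g hg), integral_map measurable_subtype_coe.aemeasurable
      (hGc g hg).measurable.aestronglyMeasurable]
    exact tendsto_nhds_unique (h2.mono_left hle) ((Complex.continuous_ofReal.tendsto _).comp h1)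

/-- A measure that does not charge the discontinuities of `T` lives on the continuity points. -/
theorem exists_comap_of_discontinuitySet {X₀ : Set X} (hX₀ : IsOpen X₀) {T : X₀ → X₀} {μ : Measure X}
    [IsFiniteMeasure μ] (h1 : μ (closure X₀)ᶜ = 0) (h2 : μ (discontinuitySet T) = 0) :
    ∃ ν : Measure X₀, IsFiniteMeasure ν ∧ (∀ᵐ y ∂ν, ContinuousAt T y) ∧
      ∀ g : X → ℝ, ∫ y : X₀, g y ∂ν = ∫ x, g x ∂μ := by
  have hm := hX₀.measurableSet
  have hae : ∀ᵐ x ∂μ, ∃ h : x ∈ X₀, ContinuousAt T ⟨x, h⟩ := by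
    have h1' : ∀ᵐ x ∂μ, x ∈ closure X₀ := h1
    have h2' : ∀ᵐ x ∂μ, x ∉ discontinuitySet T := measure_eq_zero_iff_ae_notMem.1 h2
    filter_upwards [h1', h2'] with x hx hx'
    by_contra hcon
    exact hx' ⟨hx, hcon⟩
  have hmap : (μ.comap ((↑) : X₀ → X)).map (↑) = μ := by
    rw [map_comap_subtype_coe hm]
    exact Measure.restrict_eq_self_of_ae_mem (hae.mono fun x ⟨h, _⟩ => h)
  refine ⟨μ.comap (↑), ⟨?_⟩, ?_, fun g => ?_⟩
  · rw [comap_subtype_coe_apply hm]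
    exact measure_lt_top _ _
  · rw [← hmap] at hae
    refine (ae_of_ae_map measurable_subtype_coe.aemeasurable hae).mono fun y ⟨_, hy⟩ => hy
  · conv_rhs => rw [← hmap]
    exact ((MeasurableEmbedding.subtype_coe hm).integral_map _).symm

end Representation

end

theorem theoremE4 {d : ℕ} {X : Type*} [TopologicalSpace X] [T2Space X]
    [SecondCountableTopology X] [ChartedSpace (EuclideanSpace ℝ (Fin d)) X]
    [IsManifold (𝓡 d) ∞ X] [MeasurableSpace X] [BorelSpace X]
    (Leb : Measure X) (hLeb : IsLebesgueMeasure d Leb)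
    -- the map
    (X₀ : Set X) (hX₀ : IsOpen X₀) (hX₀c : IsCompact (closure X₀))
    (T : X₀ → X₀)
    (hT : Measure.QuasiMeasurePreserving T (lebOn Leb X₀) (lebOn Leb X₀))
    -- the normed space, included in `L^∞` by `ι`
    {H₀ : Type*} [NormedAddCommGroup H₀] [NormedSpace ℂ H₀]
    (ι : H₀ →ₗ[ℂ] Lp ℂ (⊤ : ℝ≥0∞) (lebOn Leb X₀)) (hι : Function.Injective ι)
    -- multiplication by `C^α` functions
    (𝒰 : ChartCover d X₀) (α : ℝ) (hα : 0 < α)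
    (hmul : ∃ C : ℝ, ∀ f : X → ℝ, IsHolder d α f → ∀ u : H₀, ∃ w : H₀,
      (∀ᵐ x ∂(lebOn Leb X₀), ι w x = (f x : ℂ) * ι u x) ∧
        ‖w‖ ≤ C * 𝒰.holderNorm α f * ‖u‖)
    -- integration
    (hint : ∃ C : ℝ, ∀ u : H₀, ‖∫ x, ι u x ∂(lebOn Leb X₀)‖ ≤ C * ‖u‖)
    -- the transfer operator
    (L : H₀ →L[ℂ] H₀) (hL : ∀ u : H₀, IsTransfer T (lebOn Leb X₀) (ι u) (ι (L u)))
    (hLbdd : ∃ C : ℝ, ∀ n : ℕ, ‖L ^ n‖ ≤ C)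
    (hess : essentialSpectralRadius L.completion < 1)
    -- the cutoff
    (hcut : ∃ f₀ : H₀, ∃ N₀ : ℕ, 0 < N₀ ∧
      (∀ᵐ x ∂(lebOn Leb X₀), ∃ r ∈ Icc (0 : ℝ) 1, ι f₀ x = (r : ℂ)) ∧
      ∀ᵐ x ∂(lebOn Leb X₀), x ∈ range T^[N₀] → ι f₀ x = 1)
    -- limit measures do not charge the discontinuity set
    (hdisc : ∀ (u : UniformSpace.Completion H₀) (w : ℕ → H₀),
      (∀ n, ∀ᵐ x ∂(lebOn Leb X₀), ∃ r : ℝ, 0 ≤ r ∧ ι (w n) x = (r : ℂ)) →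
      Tendsto (fun n => (w n : UniformSpace.Completion H₀)) atTop (𝓝 u) →
      ∀ μ : Measure X, IsFiniteMeasure μ →
        (∀ g : X → ℝ, IsHolder d α g → pairing ι g u = ((∫ x, g x ∂μ : ℝ) : ℂ)) →
        μ (discontinuitySet T) = 0) :
    HasPhysicalDescription T (lebOn Leb X₀) := by
  have hfin : IsFiniteMeasure (lebOn Leb X₀) := hLeb.isFiniteMeasure_lebOn hX₀ hX₀c
  have : LocallyCompactSpace X := ChartedSpace.locallyCompactSpace (EuclideanSpace ℝ (Fin d)) X
  have : TopologicalSpace.MetrizableSpace X := Manifold.metrizableSpace (𝓡 d) X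
  obtain ⟨C, hC⟩ := hmul
  -- For a fixed `f`, the constant `C * 𝒰.holderNorm α f` is just a real number, which is all that
  -- boundedness of this multiplication requires.
  have hmult : ∀ f : X → ℝ, IsHolder d α f → IsMultiplier ι fun x : X₀ => f x := fun f hf =>
    IsMultiplier.of_bound hι (hC f hf)
  have hfun : ∀ f : X → ℝ, IsHolder d α f → IsFunctional ι fun x : X₀ => f x := fun f hf =>
    (hmult f hf).isFunctional hint
  obtain ⟨f₀, N₀, -, hf₀, hf₁⟩ := hcut
  refine hasPhysicalDescription_of_representation
    (isTestClass_smoothTestFunctions (d := d) hX₀ hX₀c) hT ?_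
    hint hL hLbdd hess ⟨f₀, N₀, hf₀.mono fun x ⟨r, hr, h⟩ => ⟨r, hr.1, h⟩, hf₁⟩ fun w hw => ?_
  · rintro _ ⟨f, hf, -, rfl⟩
    exact hmult f (hf.isHolder hα.le)
  · obtain ⟨v, hv, hvw⟩ := mem_closure_iff_seq_limit.1 hw
    choose u hu huv using hv
    obtain rfl : (fun n => (u n : UniformSpace.Completion H₀)) = v := funext huv
    obtain ⟨μ, hμ, hμc, hμp⟩ := exists_measure_of_mem_positiveCone hX₀c (G := {g | IsHolder d α g})
      (fun g hg => IsHolder.continuous hg) hfun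
      (show IsHolder d α fun _ => 1 from contMDiff_const.isHolder hα.le) hu hvw
    -- `discontinuitySet T` contains the boundary of `X₀`, so `hdisc` both brings the limit measure
    -- back to `X₀` and makes `T` continuous almost everywhere for it.
    obtain ⟨ν, hν, hνc, hνp⟩ := exists_comap_of_discontinuitySet hX₀ hμc (hdisc w u hu hvw μ hμ hμp)
    refine ⟨ν, hν, hνc, ?_⟩
    rintro _ ⟨f, hf, -, rfl⟩
    have hfα : IsHolder d α f := hf.isHolder hα.le
    rw [← pairing_eq_integration (hfun f hfα), hμp f hfα, hνp f]
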